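/- **Setting.** Let $p>0$, $r>q>0$, $b_1=p(r-q)$, $b_0=pq+1$, and let $a_2\neq0$, $b_2$ be real. All powers, logarithms and special functions have principal values; in particular $(-1)^s=e^{i\pi s}$, and a negative base has argument $\pi$. On the cut $(1,\infty)$ the functions ${}_2F_1$ and ${}_3F_2$ are their limits from below. "$\int f=G$" means that $G$ is an antiderivative of $f$ in the real variable indicated. For fundamental solutions $y_1,y_2$ their Wronskian is $W=y_1y_2'-y_2y_1'$. **1. Inner interval, variance $v(x)=b_2+a_2x$ linear in strike ($x=K/S$).** Let $b_2\ne0$ and $$m=\frac{b_2+b_1+\sqrt{4b_2b_0+(b_2+b_1)^2}}{2b_2},\qquad c=2m-\frac{b_1}{b_2},\qquad z=-\frac{a_2}{b_2}x,$$ $$y_1=z^m{}_2F_1(m-1,m;c;z),\qquad y_2=z^m z^{1-c}{}_2F_1(m-c,m+1-c;2-c;z),$$ with $W$ taken in $x$ and written as a function of $z$. Assume $c\notin\mathbb Z$ and that neither $2-m$ nor $c-m+1$ is in $\{0,-1,-2,\dots\}$. Then, for all $x>0$ with $v(x)>0$ and all real $\bar\gamma_0,\gamma_1,\bar\gamma_2$,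 $$\int\frac{y_1(z)(\bar\gamma_0+\gamma_1z+\bar\gamma_2z^2)}{(1-z)z^2W}dz=I_0+I_1+I_2,\qquad \int\frac{y_2(z)(\bar\gamma_0+\gamma_1z+\bar\gamma_2z^2)}{(1-z)z^2W}dz=\mathcal I_0+\mathcal I_1+\mathcal I_2,$$ term by term in the coefficients $\bar\gamma_0,\gamma_1,\bar\gamma_2$, where, with $A_1(z)=\frac{b_2}{a_2}\Gamma(c-1)z^{c-m-1}$ and $A_2(z)=\frac{b_2}{a_2}\frac{\Gamma(1-c)}{\Gamma(2-c)}z^{-m}$, $$I_0=\frac{\bar\gamma_0A_1(z)}{\Gamma(c)(c-m-1)}\,{}_2F_1(c-m-1,c-m+1;c;z),\qquad I_1=\frac{\gamma_1zA_1(z)}{\Gamma(c)(c-m)}\,{}_2F_1(c-m,c-m;c;z),$$ $$I_2=\frac{\bar\gamma_2z^2A_1(z)}{\Gamma(c)(c-m+1)}\,{}_3F_2(c-m,c-m+1,c-m+1;c,2+c-m;z),$$ $$\mathcal I_0=\frac{\bar\gamma_0A_2(z)}{m}\,{}_2F_1(2-m,-m;2-c;z),\qquad \mathcal I_1=\frac{\gamma_1zA_2(z)}{m-1}\,{}_2F_1(1-m,1-m;2-c;z),$$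 $$\mathcal I_2=\frac{\bar\gamma_2z^2A_2(z)}{m-2}\,{}_3F_2(1-m,2-m,2-m;2-c,3-m;z).$$ Let $S>0$, $0<x_1<x_3$, let $A,B,P_1,P_3$ be real, and let the previous-maturity put price be interpolated on $[x_1,x_3]$ by $$P(x)=\gamma_0+\gamma_2x^2,\qquad \gamma_0=\frac{P_3x_1^2-P_1x_3^2}{x_1^2-x_3^2},\qquad \gamma_2=\frac{P_1-P_3}{x_1^2-x_3^2},$$ so that the source is $c(x)=P(x)-[ASx-BS]^+$. At each $x\in[x_1,x_3]$ with $v(x)>0$, put $\theta=1$ if $Ax\ge B$ or $\theta=0$ if $Ax\le B$ (either value if $Ax=B$). Then $c(x)=\bar\gamma_0+\gamma_1z+\bar\gamma_2z^2$ with $\bar\gamma_0=\gamma_0+\theta BS$, $\gamma_1=\theta\frac{b_2}{a_2}AS$, $\bar\gamma_2=\gamma_2\frac{b_2^2}{a_2^2}$. With these constants, $-\frac{a_2}{b_2^2}(I_0+I_1+I_2)$ and $-\frac{a_2}{b_2^2}(\mathcal I_0+\mathcal I_1+\mathcal I_2)$, as functions of $x$, have derivatives $\frac{y_1c}{v x^2W}$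 and $\frac{y_2c}{v x^2W}$ at $x$, and the function $$I_{12}=-y_2\Big(-\frac{a_2}{b_2^2}\Big)(I_0+I_1+I_2)+y_1\Big(-\frac{a_2}{b_2^2}\Big)(\mathcal I_0+\mathcal I_1+\mathcal I_2)$$ satisfies $-v x^2V''+b_1xV'+b_0V=c$ at $x$. **2. Edge intervals, variance $v(\chi)=b_2+a_2\chi>0$ linear in log-strike $\chi=\log x$.** Let $z=\chi+b_2/a_2$, $\alpha_1=1+\frac{b_0+b_1}{a_2}$, $\beta_1=2+\frac{b_1}{a_2}\notin\mathbb Z$, $$y_1=(a_2z)^{\beta_1-1}U(\alpha_1,\beta_1,z),\qquad y_2=e^z(a_2z)^{\beta_1-1}U(\beta_1-\alpha_1,\beta_1,-z),$$ with $W$ taken in $\chi$, where $M,U$ are Kummer's functions. For $\epsilon\in\{0,-1\}$ write $M_\nu(\epsilon;a,b,z)=\int e^{\epsilon z}z^\nu M(a,b,z)\,dz$ and $U_\nu(\epsilon;a,b,z)=\int e^{\epsilon z}z^\nu U(a,b,z)\,dz$ for the antiderivatives $$M_\nu(0;a,b,z)=\frac{z^{\nu+1}}{\nu+1}\,{}_2F_2(\nu+1,a;\nu+2,b;z)\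 (\nu\ne-1),$$ $$M_{-1}(0;a,b,z)=\log z+\frac ab z\,{}_3F_3(a+1,1,1;b+1,2,2;z),$$ $$M_\nu(-1;a,b,z)=\frac{z^{\nu+1}}{\nu+1}\,{}_2F_2(\nu+1,b-a;\nu+2,b;-z)\ (\nu\ne-1),$$ $$M_{-1}(-1;a,b,z)=\log z-\frac{b-a}b z\,{}_3F_3(b-a+1,1,1;b+1,2,2;-z),$$ $$U_\nu(\epsilon;a,b,z)=\frac{\pi}{\sin\pi b}\Big[\frac{M_\nu(\epsilon;a,b,z)}{\Gamma(1+a-b)\Gamma(b)}-\frac{M_{\nu+1-b}(\epsilon;1+a-b,2-b,z)}{\Gamma(a)\Gamma(2-b)}\Big].$$ *Last interval* ($a_2>0$, so $z>0$), source $c(\chi)=\gamma_\infty z^{-\nu}$ with $\gamma_\infty$ real, $\nu>0$, and neither $1-\nu$ nor $2-\beta_1-\nu$ in $\{0,-1,-2,\dots\}$. With $\xi_\infty=(-1)^{\beta_1-\alpha_1}\gamma_\infty a_2^{-\beta_1}$, $$\int\frac{y_1c}{vW}d\chi=\xi_\infty\int e^{-z}z^{-\nu}U(\alpha_1,\beta_1,z)dz=\xi_\infty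 U_{-\nu}(-1;\alpha_1,\beta_1,z),$$ $$\int\frac{y_2c}{vW}d\chi=\xi_\infty\int z^{-\nu}U(\beta_1-\alpha_1,\beta_1,-z)dz=(-1)^{\nu+1}\xi_\infty U_{-\nu}(0;\beta_1-\alpha_1,\beta_1,-z).$$ Alternative antiderivatives of the same integrands are $$\xi_\infty\,G^{2,1}_{2,3}\!\left(z\,\middle|\,{1,\ 2+\alpha_1-\beta_1-\nu\atop 1-\nu,\ 2-\beta_1-\nu,\ 0}\right)\quad\text{and}\quad\frac{\xi_\infty z^{1-\nu}}{\Gamma(1-\alpha_1)\Gamma(\beta_1-\alpha_1)}\,G^{2,2}_{2,3}\!\left(-z\,\middle|\,{\nu,\ 1+\alpha_1-\beta_1\atop 0,\ 1-\beta_1,\ \nu-1}\right),$$ the second when neither $1-\alpha_1$ nor $\beta_1-\alpha_1$ is in $\{0,-1,-2,\dots\}$. *First interval* ($a_2<0$, so $z<0$), source $c(\chi)=\omega_0e^z/z$ with $\omega_0$ real. With $\xi_0=e^{i\pi\alpha_1}\omega_0|a_2|^{-\beta_1}$, $$\int\frac{y_1c}{vW}d\chi=\xi_0\int z^{-1}U(\alpha_1,\beta_1,z)dz=\xi_0U_{-1}(0;\alpha_1,\beta_1,z),$$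 $$\int\frac{y_2c}{vW}d\chi=\xi_0\int e^zz^{-1}U(\beta_1-\alpha_1,\beta_1,-z)dz=\xi_0U_{-1}(-1;\beta_1-\alpha_1,\beta_1,-z).$$ Alternative antiderivatives of the same integrands are $$-\frac{\xi_0}{\Gamma(\alpha_1)\Gamma(1+\alpha_1-\beta_1)}\,G^{3,1}_{2,3}\!\left(z\,\middle|\,{1-\alpha_1,\ 1\atop 0,\ 0,\ 1-\beta_1}\right)\quad\text{and}\quad-\xi_0\,G^{3,0}_{2,3}\!\left(-z\,\middle|\,{1-\alpha_1,\ 1\atop 0,\ 0,\ 1-\beta_1}\right),$$ the first when neither $\alpha_1$ nor $1+\alpha_1-\beta_1$ is in $\{0,-1,-2,\dots\}$. On both edge intervals, and both with the pair of Kummer integrals and (when both are defined) with the pair of $G$-functions, the source term $I_{12}=y_1\int\frac{y_2c}{vW}d\chi-y_2\int\frac{y_1c}{vW}d\chi$ satisfies $-vV''+(b_1+v)V'+b_0V=c$. -/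

import Mathlib

open Filter Topology
open scoped Nat

/-! ### Generalized hypergeometric functions -/

/-- Rising factorial `(a)ₙ = a (a + 1) ⋯ (a + n - 1)`. -/
noncomputable def rising (a : ℂ) (n : ℕ) : ℂ := (ascPochhammer ℂ n).eval a

/-- The generalized hypergeometric power series with upper parameters `as` and lower parameters
`bs`. It is entire when `bs` is at least as long as `as`, and converges in the unit disc when `as`
is longer by one. -/
noncomputable def hypSeries (as bs : List ℂ) (z : ℂ) : ℂ :=
  ∑' n : ℕ, (as.map fun a => rising a n).prod /
    ((bs.map fun b => rising b n).prod * (n ! : ℂ)) * z ^ n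

theorem hypSeries_eq_ordinaryHypergeometric (a b c z : ℂ) :
    hypSeries [a, b] [c] z = ordinaryHypergeometric a b c z := by
  rw [ordinaryHypergeometric_eq_tsum]
  unfold hypSeries rising
  refine tsum_congr fun n => ?_
  simp only [List.map_cons, List.map_nil, List.prod_cons, List.prod_nil, mul_one, smul_eq_mul,
    div_eq_mul_inv, mul_inv]
  ring

/-- `f` is the principal branch of the hypergeometric function with one more upper than lower
parameter: holomorphic in the plane cut along `[1, ∞)`, equal to the power series in the unit
disc, and on the cut `(1, ∞)` equal to its limit from below. (On the reals left of `1` this is the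
usual value. The limit from below fits the principal power of `1 - z`, whose argument on the cut
is `π`.) -/
def IsHypContinuation (as bs : List ℂ) (f : ℂ → ℂ) : Prop :=
  DifferentiableOn ℂ f {z : ℂ | 1 - z ∈ Complex.slitPlane} ∧
  (∀ z : ℂ, ‖z‖ < 1 → f z = hypSeries as bs z) ∧
  ∀ x : ℝ, 1 < x →
    Tendsto (fun ε : ℝ => f ((x : ℂ) - (ε : ℂ) * Complex.I)) (𝓝[>] 0) (𝓝 (f x))

/-- The analytically continued hypergeometric function (one more upper than lower parameter). The
three conditions determine it at every point except `z = 1`. -/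
noncomputable def hypCont (as bs : List ℂ) : ℂ → ℂ :=
  Classical.epsilon (IsHypContinuation as bs)

/-- Gauss' hypergeometric function. -/
noncomputable def hyp2F1 (a b c z : ℂ) : ℂ := hypCont [a, b] [c] z

noncomputable def hyp3F2 (a₁ a₂ a₃ b₁ b₂ z : ℂ) : ℂ := hypCont [a₁, a₂, a₃] [b₁, b₂] z

/-- `x` is none of `0, -1, -2, …`. -/
def NotNonposInt (x : ℂ) : Prop := ∀ n : ℕ, x ≠ -(n : ℂ)

/-! ### Kummer functions and their integrals -/

/-- Kummer's function of the first kind. -/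
noncomputable def kummerM (a b z : ℂ) : ℂ := hypSeries [a] [b] z

/-- Kummer's function of the second kind (principal branch, `b` not an integer). -/
noncomputable def kummerU (a b z : ℂ) : ℂ :=
  Real.pi / Complex.sin (Real.pi * b) *
    (kummerM a b z / (Complex.Gamma (1 + a - b) * Complex.Gamma b) -
      z ^ (1 - b) * kummerM (1 + a - b) (2 - b) z / (Complex.Gamma a * Complex.Gamma (2 - b)))

/-- `M_ν(0; a, b, z)`: the indefinite integral of `z ^ ν M(a, b, z)`. -/
noncomputable def kummerMInt (ν a b z : ℂ) : ℂ :=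
  open Classical in
  if ν = -1 then Complex.log z + a / b * z * hypSeries [a + 1, 1, 1] [b + 1, 2, 2] z
  else z ^ (ν + 1) / (ν + 1) * hypSeries [ν + 1, a] [ν + 2, b] z

/-- `M_ν(-1; a, b, z)`: the indefinite integral of `exp (-z) z ^ ν M(a, b, z)`, which is the
integral of `z ^ ν M(b - a, b, -z)`. -/
noncomputable def kummerMExpInt (ν a b z : ℂ) : ℂ :=
  open Classical in
  if ν = -1 then
    Complex.log z + (b - a) / b * (-z) * hypSeries [b - a + 1, 1, 1] [b + 1, 2, 2] (-z)
  else z ^ (ν + 1) / (ν + 1) * hypSeries [ν + 1, b - a] [ν + 2, b] (-z)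

/-- `U_ν(0; a, b, z)`: the indefinite integral of `z ^ ν U(a, b, z)`. -/
noncomputable def kummerUInt (ν a b z : ℂ) : ℂ :=
  Real.pi / Complex.sin (Real.pi * b) *
    (kummerMInt ν a b z / (Complex.Gamma (1 + a - b) * Complex.Gamma b) -
      kummerMInt (ν + 1 - b) (1 + a - b) (2 - b) z /
        (Complex.Gamma a * Complex.Gamma (2 - b)))

/-- `U_ν(-1; a, b, z)`: the indefinite integral of `exp (-z) z ^ ν U(a, b, z)`. -/
noncomputable def kummerUExpInt (ν a b z : ℂ) : ℂ :=
  Real.pi / Complex.sin (Real.pi * b) *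
    (kummerMExpInt ν a b z / (Complex.Gamma (1 + a - b) * Complex.Gamma b) -
      kummerMExpInt (ν + 1 - b) (1 + a - b) (2 - b) z /
        (Complex.Gamma a * Complex.Gamma (2 - b)))

/-! ### Meijer's G-function -/

/-- The residue of `f` at an isolated singularity `s₀`: the integral of `f` over small positively
oriented circles about `s₀`, divided by `2πi`. -/
noncomputable def residueAt (f : ℂ → ℂ) (s₀ : ℂ) : ℂ :=
  limUnder (𝓝[>] (0 : ℝ)) fun ε : ℝ =>
    (2 * Real.pi * Complex.I)⁻¹ * ∮ s in C(s₀, ε), f s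

/-- The Mellin-Barnes integrand. Here `an = (a₁, …, aₙ)`, `ap = (aₙ₊₁, …, a_p)`,
`bm = (b₁, …, b_m)` and `bq = (b_{m+1}, …, b_q)`. -/
noncomputable def meijerIntegrand (an ap bm bq : List ℂ) (z s : ℂ) : ℂ :=
  (bm.map fun b => Complex.Gamma (b - s)).prod * (an.map fun a => Complex.Gamma (1 - a + s)).prod /
    ((bq.map fun b => Complex.Gamma (1 - b + s)).prod *
      (ap.map fun a => Complex.Gamma (a - s)).prod) * z ^ s

/-- Meijer's function `G^{m,n}_{p,q}` for `p < q` and `z ≠ 0` (principal branch), when no pole of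
a factor `Γ(b - s)` is a pole of a factor `Γ(1 - a + s)`: the Mellin-Barnes integral, divided by
`2πi`, over a loop that starts and ends at `+∞`, encircles each pole of the factors `Γ(b - s)` once
in the negative direction, and encircles no pole of the factors `Γ(1 - a + s)`. Evaluated pole by
pole, it is minus the sum of the residues at the points `b + k`, each counted once. -/
noncomputable def meijerG (an ap bm bq : List ℂ) (z : ℂ) : ℂ :=
  -∑' s : {s : ℂ // ∃ b ∈ bm, ∃ k : ℕ, s = b + k},
    residueAt (meijerIntegrand an ap bm bq z) s

/-! ### The model at one maturity and on one strike interval -/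

/-- Wronskian of two complex-valued functions of a real variable. -/
noncomputable def wronskian (y₁ y₂ : ℝ → ℂ) (x : ℝ) : ℂ :=
  y₁ x * deriv y₂ x - y₂ x * deriv y₁ x

/-- `V` is twice continuously differentiable near `x` and satisfies
`k₂ V'' + k₁ V' + k₀ V = c` at `x`. -/
def SolvesAt (k₂ k₁ k₀ c : ℝ) (V : ℝ → ℂ) (x : ℝ) : Prop :=
  ContDiffAt ℝ 2 V x ∧
    (k₂ : ℂ) * deriv (deriv V) x + (k₁ : ℂ) * deriv V x + (k₀ : ℂ) * V x = (c : ℂ)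

/-- `p` is the increment of the clock, `r` the interest rate, `q` the dividend yield, and
`b₂`, `a₂` are the level and the slope of the variance `p σ² / 2` on the interval. -/
structure Segment where
  p : ℝ
  r : ℝ
  q : ℝ
  b₂ : ℝ
  a₂ : ℝ

namespace Segment

noncomputable section

variable (M : Segment)

def b₁ : ℝ := M.p * (M.r - M.q)

def b₀ : ℝ := M.p * M.q + 1

/-- The variance: linear in the inverse moneyness `x = K / S`, respectively in its logarithm. -/
def v (x : ℝ) : ℝ := M.b₂ + M.a₂ * x

/-! #### Variance linear in strike -/

/-- The root `m⁺`, possibly complex. -/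
def m : ℂ :=
  (((M.b₂ + M.b₁ : ℝ) : ℂ) +
    ((4 * M.b₂ * M.b₀ + (M.b₂ + M.b₁) ^ 2 : ℝ) : ℂ) ^ (1 / 2 : ℂ)) / (2 * (M.b₂ : ℂ))

def c : ℂ := 2 * M.m - (M.b₁ : ℂ) / (M.b₂ : ℂ)

/-- The variable `z` of the hypergeometric equation. -/
def zStrike (x : ℝ) : ℝ := -M.a₂ * x / M.b₂

/-- The fundamental solutions as functions of `z`. -/
def Y₁ (z : ℝ) : ℂ := (z : ℂ) ^ M.m * hyp2F1 (M.m - 1) M.m M.c z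

def Y₂ (z : ℝ) : ℂ :=
  (z : ℂ) ^ M.m * ((z : ℂ) ^ (1 - M.c) * hyp2F1 (M.m - M.c) (M.m + 1 - M.c) (2 - M.c) z)

/-- The fundamental solutions as functions of `x`. -/
def y₁ (x : ℝ) : ℂ := M.Y₁ (M.zStrike x)

def y₂ (x : ℝ) : ℂ := M.Y₂ (M.zStrike x)

/-- The factor `A(z)` in the integrals of the first solution. -/
def A₁ (z : ℝ) : ℂ :=
  (M.b₂ : ℂ) / (M.a₂ : ℂ) * Complex.Gamma (M.c - 1) * (z : ℂ) ^ (M.c - M.m - 1)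

def I₀ (γ : ℝ) (z : ℝ) : ℂ :=
  γ * M.A₁ z * (1 / (Complex.Gamma M.c * (M.c - M.m - 1))) *
    hyp2F1 (M.c - M.m - 1) (M.c - M.m + 1) M.c z

def I₁ (γ : ℝ) (z : ℝ) : ℂ :=
  γ * z * M.A₁ z * (1 / (Complex.Gamma M.c * (M.c - M.m))) *
    hyp2F1 (M.c - M.m) (M.c - M.m) M.c z

def I₂ (γ : ℝ) (z : ℝ) : ℂ :=
  γ * M.A₁ z * (z : ℂ) ^ 2 * (1 / ((M.c - M.m + 1) * Complex.Gamma M.c)) *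
    hyp3F2 (M.c - M.m) (M.c - M.m + 1) (M.c - M.m + 1) M.c (2 + M.c - M.m) z

/-- The factor `A(z)` in the integrals of the second solution. -/
def A₂ (z : ℝ) : ℂ :=
  (M.b₂ : ℂ) / (M.a₂ : ℂ) * (Complex.Gamma (1 - M.c) / Complex.Gamma (2 - M.c)) *
    (z : ℂ) ^ (-M.m)

def calI₀ (γ : ℝ) (z : ℝ) : ℂ :=
  γ * M.A₂ z * (1 / M.m) * hyp2F1 (2 - M.m) (-M.m) (2 - M.c) z

def calI₁ (γ : ℝ) (z : ℝ) : ℂ :=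
  γ * M.A₂ z * z * (1 / (M.m - 1)) * hyp2F1 (1 - M.m) (1 - M.m) (2 - M.c) z

def calI₂ (γ : ℝ) (z : ℝ) : ℂ :=
  γ * M.A₂ z * (z : ℂ) ^ 2 * (1 / (M.m - 2)) *
    hyp3F2 (1 - M.m) (2 - M.m) (2 - M.m) (2 - M.c) (3 - M.m) z

/-- Closed form of the integral of `y₁ c / (v x² W)`, where `c` is a quadratic in `z` with
coefficients `γ₀, γ₁, γ₂`. -/
def strikeSource₁ (γ₀ γ₁ γ₂ : ℝ) (x : ℝ) : ℂ :=
  -((M.a₂ : ℂ) / (M.b₂ : ℂ) ^ 2) *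
    (M.I₀ γ₀ (M.zStrike x) + M.I₁ γ₁ (M.zStrike x) + M.I₂ γ₂ (M.zStrike x))

/-- Closed form of the integral of `y₂ c / (v x² W)`. -/
def strikeSource₂ (γ₀ γ₁ γ₂ : ℝ) (x : ℝ) : ℂ :=
  -((M.a₂ : ℂ) / (M.b₂ : ℂ) ^ 2) *
    (M.calI₀ γ₀ (M.zStrike x) + M.calI₁ γ₁ (M.zStrike x) + M.calI₂ γ₂ (M.zStrike x))

/-! #### Variance linear in log-strike -/

def α₁ : ℝ := 1 + (M.b₀ + M.b₁) / M.a₂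

def β₁ : ℝ := 2 + M.b₁ / M.a₂

def zLog (χ : ℝ) : ℝ := χ + M.b₂ / M.a₂

/-- The fundamental solutions in log-strike. Where they are used, `a₂ z = v > 0`. -/
def u₁ (χ : ℝ) : ℂ :=
  ((M.a₂ * M.zLog χ : ℝ) : ℂ) ^ ((M.β₁ : ℂ) - 1) * kummerU M.α₁ M.β₁ (M.zLog χ)

def u₂ (χ : ℝ) : ℂ :=
  Complex.exp (M.zLog χ) * ((M.a₂ * M.zLog χ : ℝ) : ℂ) ^ ((M.β₁ : ℂ) - 1) *
    kummerU (M.β₁ - M.α₁) M.β₁ (-(M.zLog χ : ℂ))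

/-- The integrands of the source term in log-strike, for the source `cc`. -/
def logIntegrand₁ (cc : ℝ → ℝ) (χ : ℝ) : ℂ :=
  M.u₁ χ * cc χ / (M.v χ * wronskian M.u₁ M.u₂ χ)

def logIntegrand₂ (cc : ℝ → ℝ) (χ : ℝ) : ℂ :=
  M.u₂ χ * cc χ / (M.v χ * wronskian M.u₁ M.u₂ χ)

/-- The interpolation on the last interval, where `z > 0`. -/
def powerSource (γ ν : ℝ) (χ : ℝ) : ℝ := γ * M.zLog χ ^ (-ν)

/-- The interpolation on the first interval, where `z < 0`. -/
def expSource (ω : ℝ) (χ : ℝ) : ℝ := ω * Real.exp (M.zLog χ) / M.zLog χ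

/-- The constant on the last interval, where `a₂ > 0`. -/
def ξInf (γ : ℝ) : ℂ :=
  (-1 : ℂ) ^ ((M.β₁ : ℂ) - M.α₁) * γ * (M.a₂ : ℂ) ^ (-(M.β₁ : ℂ))

/-- The constant on the first interval, where `a₂ < 0`. It is `(-1)^(β₁ - α₁) ω a₂^(-β₁)` with
both powers taken at argument `-π`, as `-z = exp (-π i) z` for the principal argument of `z < 0`. -/
def ξZero (ω : ℝ) : ℂ :=
  Complex.exp (Complex.I * Real.pi * M.α₁) * ω * ((|M.a₂| : ℝ) : ℂ) ^ (-(M.β₁ : ℂ))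

/-- Last interval, first integral, through the integral of a Kummer function. -/
def lastKummer₁ (γ ν : ℝ) (χ : ℝ) : ℂ :=
  M.ξInf γ * kummerUExpInt (-ν) M.α₁ M.β₁ (M.zLog χ)

def lastKummer₂ (γ ν : ℝ) (χ : ℝ) : ℂ :=
  (-1 : ℂ) ^ ((ν : ℂ) + 1) * M.ξInf γ *
    kummerUInt (-ν) (M.β₁ - M.α₁) M.β₁ (-(M.zLog χ : ℂ))

/-- Last interval, first integral, through `G^{2,1}_{2,3}`. -/
def lastMeijer₁ (γ ν : ℝ) (χ : ℝ) : ℂ :=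
  M.ξInf γ * meijerG [1] [2 + M.α₁ - M.β₁ - ν] [1 - ν, 2 - M.β₁ - ν] [0] (M.zLog χ)

/-- Last interval, second integral, through `G^{2,2}_{2,3}`. -/
def lastMeijer₂ (γ ν : ℝ) (χ : ℝ) : ℂ :=
  M.ξInf γ * ((M.zLog χ : ℂ) ^ (1 - (ν : ℂ)) /
    (Complex.Gamma (1 - M.α₁) * Complex.Gamma (M.β₁ - M.α₁)) *
      meijerG [(ν : ℂ), 1 + M.α₁ - M.β₁] [] [0, 1 - M.β₁] [ν - 1] (-(M.zLog χ : ℂ)))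

/-- First interval, first integral, through the integral of a Kummer function. -/
def firstKummer₁ (ω : ℝ) (χ : ℝ) : ℂ :=
  M.ξZero ω * kummerUInt (-1) M.α₁ M.β₁ (M.zLog χ)

def firstKummer₂ (ω : ℝ) (χ : ℝ) : ℂ :=
  M.ξZero ω * kummerUExpInt (-1) (M.β₁ - M.α₁) M.β₁ (-(M.zLog χ : ℂ))

/-- First interval, first integral, through `G^{3,1}_{2,3}`. -/
def firstMeijer₁ (ω : ℝ) (χ : ℝ) : ℂ :=
  -(M.ξZero ω / (Complex.Gamma M.α₁ * Complex.Gamma (1 + M.α₁ - M.β₁)) *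
    meijerG [1 - (M.α₁ : ℂ)] [1] [0, 0, 1 - M.β₁] [] (M.zLog χ))

/-- First interval, second integral, through `G^{3,0}_{2,3}`. -/
def firstMeijer₂ (ω : ℝ) (χ : ℝ) : ℂ :=
  -(M.ξZero ω * meijerG [] [1 - (M.α₁ : ℂ), 1] [0, 0, 1 - M.β₁] [] (-(M.zLog χ : ℂ)))

/-- The source term `y₁ ∫ y₂ c / (v W) - y₂ ∫ y₁ c / (v W)` built from two antiderivatives solves
the inhomogeneous equation in log-strike with right-hand side `cc`. -/
def LogSourceSolvesAt (cc : ℝ → ℝ) (G₁ G₂ : ℝ → ℂ) (χ : ℝ) : Prop :=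
  SolvesAt (-M.v χ) (M.b₁ + M.v χ) M.b₀ (cc χ) (fun t => M.u₁ t * G₂ t - M.u₂ t * G₁ t) χ

end

end Segment

/-! ### The quadratic interpolation of the price at the previous maturity -/

/-- Coefficients of the interpolation `P(x) = γ₀ + γ₂ x²` through `(x₁, P₁)` and `(x₃, P₃)`. -/
noncomputable def quadCoeff₀ (x₁ x₃ P₁ P₃ : ℝ) : ℝ :=
  (P₃ * x₁ ^ 2 - P₁ * x₃ ^ 2) / (x₁ ^ 2 - x₃ ^ 2)

noncomputable def quadCoeff₂ (x₁ x₃ P₁ P₃ : ℝ) : ℝ := (P₁ - P₃) / (x₁ ^ 2 - x₃ ^ 2)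

/-- The covered put `P - (A K - B S)⁺`, at `K = S x`, of the interpolated price. -/
noncomputable def coveredPut (S A B x₁ x₃ P₁ P₃ x : ℝ) : ℝ :=
  quadCoeff₀ x₁ x₃ P₁ P₃ + quadCoeff₂ x₁ x₃ P₁ P₃ * x ^ 2 - max (A * (S * x) - B * S) 0

/-! On every interval the source term is variation of parameters. If `G₁`, `G₂` are antiderivatives
of `y₁ c / (k W)` and `y₂ c / (k W)`, then the derivatives of the `G`s cancel in the first
derivative of `y₁ G₂ - y₂ G₁` and contribute `-c / k` to the second (`solvesAt_source_term`). What
remains, for each interval, is that the `y`s solve the homogeneous equation, that their Wronskian is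
explicit and nonzero, and that the integrand has the stated antiderivative.

Strike. Here `v = b₂ (1 - z)`, and removing a factor `z ^ μ`, with `μ` either root `m`, `m + 1 - c`
of the indicial equation, leaves Gauss' equation (`Segment.strike_solution`). The Wronskian is a
power of `z` times `(1 - z) ^ (c - 2m)`, and the power of `1 - z` in the integrand is exactly the
one in Euler's transformation (`hyp2F1_euler`). The integrand thus becomes a power of `z` times one
Gauss function. Raising a parameter integrates it for the source terms `1` and `z`; for `z ^ 2` the
integral is a `₃F₂`.

These identities are formal for power series at `0`, but `z` may be large, and `z > 1` when `b₂ <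
0`. The principal fourth root of `1 - z` has argument in `(-π/4, π/4]`, so a Cayley transform
carries the plane without `1` into the open unit disc, the cut included, with its boundary value
from below. In the disc coordinate the hypergeometric equation has the origin as only singular
point, a regular one, so a local analytic solution has a Taylor series converging in the whole disc
(`coeffBounded_of_regular_singular`). This constructs the continuations, and the identity theorem
carries every relation between germs to the real line (`ContinuesTo.eq`).

Log-strike. A factor `v ^ (β₁ - 1)` reduces the equation to Kummer's. By Kummer's transformation
both solutions are combinations of the same two series, up to a phase of `(-z) ^ (1 - b)` fixed by
the sign of `z`, and the reflection formula evaluates the Wronskian (`kummerUCoeff_wronskian`). The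
series are integrated term by term. The residue series of the `G`-functions are the same integrals,
since `Γ(s) / Γ(s + 1) = 1 / s` is integration on the Mellin side. On the last interval the two
antiderivatives coincide; on the first a double pole at `0` produces the logarithm and an additive
constant. -/

/-! ### Power series given by their coefficients -/

/-- The coefficients `u` grow at most geometrically: `u n * r ^ n` is bounded for `r < R`. -/
def CoeffBounded (u : ℕ → ℂ) (R : ℝ) : Prop :=
  ∀ r : ℝ, 0 < r → r < R → ∃ C : ℝ, ∀ n, ‖u n‖ * r ^ n ≤ C

/-- The sum of the power series with coefficients `u`. -/
noncomputable def powSum (u : ℕ → ℂ) (z : ℂ) : ℂ := ∑' n : ℕ, u n * z ^ n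

theorem bddAbove_of_eventually_antitone {s : ℕ → ℝ} (h : ∀ᶠ n in atTop, s (n + 1) ≤ s n) :
    ∃ C, ∀ n, s n ≤ C := by
  obtain ⟨N, hN⟩ := eventually_atTop.1 h
  have hb : ∀ n, N ≤ n → s n ≤ s N := fun n hn => by
    induction n, hn using Nat.le_induction with
    | base => exact le_rfl
    | succ k hk ih => exact (hN k hk).trans ih
  obtain ⟨C, hC⟩ := ((Finset.range (N + 1)).image s).bddAbove
  refine ⟨C, fun n => ?_⟩
  rcases le_total N n with hn | hn
  · exact (hb n hn).trans (hC (by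
      simp only [Finset.coe_image, Set.mem_image, Finset.coe_range, Set.mem_Iio]
      exact ⟨N, by omega, rfl⟩))
  · exact hC (by
      simp only [Finset.coe_image, Set.mem_image, Finset.coe_range, Set.mem_Iio]
      exact ⟨n, by omega, rfl⟩)

/-- The ratio test in the form used throughout: once `‖ρ n‖ * r ≤ 1`, the sequence `‖u n‖ * r ^ n`
no longer increases. -/
theorem coeffBounded_of_ratio {u ρ : ℕ → ℂ} {R : ℝ} (h : ∀ n, u (n + 1) = u n * ρ n)
    (hρ : ∀ r, 0 < r → r < R → ∀ᶠ n in atTop, ‖ρ n‖ * r ≤ 1) : CoeffBounded u R := by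
  intro r hr hrR
  refine bddAbove_of_eventually_antitone ?_
  filter_upwards [hρ r hr hrR] with n hn
  rw [h, norm_mul, pow_succ]
  have : 0 ≤ ‖u n‖ * r ^ n := by positivity
  nlinarith

/-- The radius is split as `r = r' * (r / r')` with `r < r' < R`: `u` absorbs `r' ^ n`, and `v`
absorbs `(r / r') ^ n`, whose base is below `1`. -/
theorem CoeffBounded.mul {u v : ℕ → ℂ} {R : ℝ} (hu : CoeffBounded u R)
    (hv : CoeffBounded v 1) : CoeffBounded (fun n => u n * v n) R := by
  intro r hr hrR
  obtain ⟨r', h1, h2⟩ := exists_between hrR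
  have hr' : 0 < r' := hr.trans h1
  obtain ⟨C, hC⟩ := hu r' hr' h2
  obtain ⟨D, hD⟩ := hv (r / r') (by positivity) ((div_lt_one hr').2 h1)
  refine ⟨C * D, fun n => ?_⟩
  calc ‖u n * v n‖ * r ^ n = (‖u n‖ * r' ^ n) * (‖v n‖ * (r / r') ^ n) := by
        rw [norm_mul, div_pow]
        field_simp
    _ ≤ C * D := by
        refine mul_le_mul (hC n) (hD n) (by positivity) ?_
        exact le_trans (by positivity) (hC 0)

theorem CoeffBounded.const_mul {u : ℕ → ℂ} {R : ℝ} (hu : CoeffBounded u R) (a : ℂ) :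
    CoeffBounded (fun n => a * u n) R := by
  intro r hr hrR
  obtain ⟨C, hC⟩ := hu r hr hrR
  refine ⟨‖a‖ * C, fun n => ?_⟩
  rw [norm_mul, mul_assoc]
  exact mul_le_mul_of_nonneg_left (hC n) (norm_nonneg a)

theorem CoeffBounded.shift {u : ℕ → ℂ} {R : ℝ} (hu : CoeffBounded u R) :
    CoeffBounded (fun n => u (n + 1)) R := by
  intro r hr hrR
  obtain ⟨C, hC⟩ := hu r hr hrR
  refine ⟨C / r, fun n => ?_⟩
  rw [le_div_iff₀ hr, mul_assoc, ← pow_succ]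
  exact hC (n + 1)

theorem CoeffBounded.summable_norm {u : ℕ → ℂ} {R : ℝ} (hu : CoeffBounded u R) {r : ℝ}
    (hr : 0 ≤ r) (hrR : r < R) : Summable fun n => ‖u n‖ * r ^ n := by
  obtain ⟨r', h1, h2⟩ := exists_between hrR
  have hr' : 0 < r' := hr.trans_lt h1
  obtain ⟨C, hC⟩ := hu r' hr' h2
  refine Summable.of_nonneg_of_le (fun n => by positivity) (fun n => ?_)
    ((summable_geometric_of_lt_one (by positivity) ((div_lt_one hr').2 h1)).mul_left C)
  calc ‖u n‖ * r ^ n = (‖u n‖ * r' ^ n) * (r / r') ^ n := by rw [div_pow]; field_simp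
    _ ≤ C * (r / r') ^ n := mul_le_mul_of_nonneg_right (hC n) (by positivity)

theorem CoeffBounded.hasSum {u : ℕ → ℂ} {R : ℝ} (hu : CoeffBounded u R) {z : ℂ} (hz : ‖z‖ < R) :
    HasSum (fun n => u n * z ^ n) (powSum u z) := by
  refine Summable.hasSum (Summable.of_norm ?_)
  simpa only [norm_mul, norm_pow] using hu.summable_norm (norm_nonneg z) hz

theorem tendsto_norm_add_div_add (a b : ℂ) :
    Tendsto (fun n : ℕ => ‖(a + n) / (b + n)‖) atTop (𝓝 1) := by
  have h : ∀ a : ℂ, Tendsto (fun n : ℕ => a / n + 1) atTop (𝓝 1) := fun a => by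
    simpa using (tendsto_const_div_atTop_nhds_zero_nat a).add_const 1
  have h2 := ((h a).div (h b) one_ne_zero).norm
  simp only [div_one, norm_one] at h2
  refine h2.congr' ?_
  filter_upwards [eventually_gt_atTop 0] with n hn
  have hn' : (n : ℂ) ≠ 0 := by exact_mod_cast hn.ne'
  congr 1
  have e : ∀ a : ℂ, a / n + 1 = (a + n) / n := fun a => by field_simp
  simp only [Pi.div_apply]
  rw [e, e, div_div_div_cancel_right₀ hn']

theorem coeffBounded_of_ratio_add_div_add {u : ℕ → ℂ} (a b : ℂ)
    (h : ∀ n, u (n + 1) = u n * ((a + n) / (b + n))) : CoeffBounded u 1 := by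
  refine coeffBounded_of_ratio h fun r hr hr1 => ?_
  have := ((tendsto_norm_add_div_add a b).mul_const r).eventually_lt_const
    (by simpa using hr1 : 1 * r < 1)
  filter_upwards [this] with n hn using hn.le

/-! ### Rising factorials and the growth of coefficient sequences. -/

theorem rising_zero (a : ℂ) : rising a 0 = 1 := by simp [rising]

theorem rising_succ (a : ℂ) (n : ℕ) : rising a (n + 1) = rising a n * (a + n) := by
  simp [rising, ascPochhammer_succ_eval]

theorem rising_succ_left (a : ℂ) (n : ℕ) : rising a (n + 1) = a * rising (a + 1) n := by
  induction n with
  | zero => simp [rising_succ, rising_zero]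
  | succ n ih => rw [rising_succ, ih, rising_succ]; push_cast; ring

theorem rising_one (n : ℕ) : rising 1 n = n ! := by
  induction n with
  | zero => simp [rising_zero]
  | succ n ih => rw [rising_succ, ih, Nat.factorial_succ]; push_cast; ring

theorem rising_ne_zero {a : ℂ} (ha : NotNonposInt a) (n : ℕ) : rising a n ≠ 0 := by
  induction n with
  | zero => simp [rising_zero]
  | succ n ih =>
    rw [rising_succ]
    exact mul_ne_zero ih fun h => ha n (eq_neg_of_add_eq_zero_left h)

theorem rising_add_one (a : ℂ) (n : ℕ) : a * rising (a + 1) n = (a + n) * rising a n := by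
  rw [← rising_succ_left, rising_succ, mul_comm]

/-- No condition on `b` is needed: if `b` is a nonpositive integer, the denominators vanish from
some index on, the quotients are `0` by convention, and the ratio recurrence survives. -/
theorem coeffBounded_rising_div (a b : ℂ) : CoeffBounded (fun n => rising a n / rising b n) 1 :=
  coeffBounded_of_ratio_add_div_add a b fun n => by
    rw [rising_succ, rising_succ, mul_div_mul_comm]

theorem coeffBounded_natCast : CoeffBounded (fun n => (n : ℂ)) 1 := by
  -- The shift avoids the ratio at `n = 0`: the quotient of consecutive terms of `n + 1` is `(2 + n)
  -- / (1 + n)`.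
  have h : CoeffBounded (fun n => ((n + 1 : ℕ) : ℂ)) 1 :=
    coeffBounded_of_ratio_add_div_add 2 1 fun n => by
      have : (1 + n : ℂ) ≠ 0 := by exact_mod_cast (by omega : 1 + n ≠ 0)
      push_cast
      field_simp
      ring
  intro r hr h1
  obtain ⟨C, hC⟩ := h r hr h1
  refine ⟨C, fun n => le_trans ?_ (hC n)⟩
  gcongr
  rw [Complex.norm_natCast, Complex.norm_natCast]
  push_cast
  linarith

/-- The sequence converges, hence is bounded; a single term with `a + n = 0` is `0` by convention
and does no harm. -/
theorem coeffBounded_inv_add (a : ℂ) : CoeffBounded (fun n => 1 / (a + n)) 1 := by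
  have h : Tendsto (fun n : ℕ => (1 / (n : ℂ)) / (a / n + 1)) atTop (𝓝 (0 / (0 + 1))) :=
    (tendsto_const_div_atTop_nhds_zero_nat 1).div
      ((tendsto_const_div_atTop_nhds_zero_nat a).add_const 1) (by simp)
  have h2 : Tendsto (fun n : ℕ => ‖1 / (a + n)‖) atTop (𝓝 ‖(0 / (0 + 1) : ℂ)‖) := by
    refine h.norm.congr' ?_
    filter_upwards [eventually_gt_atTop 0] with n hn
    have hn' : (n : ℂ) ≠ 0 := by exact_mod_cast hn.ne'
    rw [show a / n + 1 = (a + n) / n by field_simp, div_div_div_cancel_right₀ hn']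
  obtain ⟨C, hC⟩ := h2.bddAbove_range
  intro r hr hr1
  refine ⟨C, fun n => le_trans ?_ (hC ⟨n, rfl⟩)⟩
  exact mul_le_of_le_one_right (norm_nonneg _) (pow_le_one₀ hr.le hr1.le)

theorem coeffBounded_inv_factorial (R : ℝ) : CoeffBounded (fun n => 1 / (n ! : ℂ)) R := by
  refine coeffBounded_of_ratio (ρ := fun n => 1 / ((n : ℂ) + 1)) (fun n => ?_) fun r hr _ => ?_
  · rw [Nat.factorial_succ]; push_cast; field_simp
  · have h : Tendsto (fun n : ℕ => 1 / ((n : ℂ) + 1)) atTop (𝓝 0) :=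
      tendsto_one_div_add_atTop_nhds_zero_nat
    have h2 := (h.norm.mul_const r).eventually_lt_const (by simp : ‖(0 : ℂ)‖ * r < 1)
    filter_upwards [h2] with n hn using hn.le

theorem CoeffBounded.natCast_mul {u : ℕ → ℂ} {R : ℝ} (hu : CoeffBounded u R) :
    CoeffBounded (fun n => n * u n) R := by
  simpa only [mul_comm] using hu.mul coeffBounded_natCast

theorem CoeffBounded.deriv_coeff {u : ℕ → ℂ} {R : ℝ} (hu : CoeffBounded u R) :
    CoeffBounded (fun n => (n + 1) * u (n + 1)) R := by
  simpa using hu.natCast_mul.shift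

theorem CoeffBounded.hasDerivAt {u : ℕ → ℂ} {R : ℝ} (hu : CoeffBounded u R) {z : ℂ}
    (hz : ‖z‖ < R) :
    HasDerivAt (powSum u) (powSum (fun n => (n + 1) * u (n + 1)) z) z := by
  obtain ⟨r, h1, h2⟩ := exists_between hz
  have hr : 0 < r := (norm_nonneg z).trans_lt h1
  -- The majorant is divided by `r` because differentiation lowers the exponent to `n - 1`; at `n =
  -- 0` the truncated exponent is harmless, as the factor `n` vanishes.
  have hs : Summable fun n : ℕ => ‖(n : ℂ) * u n‖ * r ^ n / r :=
    (hu.natCast_mul.summable_norm hr.le h2).div_const r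
  have hz' : z ∈ Metric.ball (0 : ℂ) r := by simpa using h1
  have hd : ∀ (n : ℕ) (y : ℂ), y ∈ Metric.ball (0 : ℂ) r →
      HasDerivAt (fun w : ℂ => u n * w ^ n) (u n * (n * y ^ (n - 1))) y :=
    fun n y _ => (hasDerivAt_pow n y).const_mul _
  have hb : ∀ (n : ℕ) (y : ℂ), y ∈ Metric.ball (0 : ℂ) r →
      ‖u n * (n * y ^ (n - 1))‖ ≤ ‖(n : ℂ) * u n‖ * r ^ n / r := by
    intro n y hy
    rcases n with _ | n
    · simp
    · have hy' : ‖y‖ ≤ r := by simpa using (Metric.mem_ball.1 hy).le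
      have : ‖y‖ ^ n ≤ r ^ n := pow_le_pow_left₀ (norm_nonneg y) hy' n
      simp only [norm_mul, norm_pow, Nat.add_sub_cancel, pow_succ]
      rw [← mul_assoc, ← mul_assoc, mul_div_cancel_right₀ _ hr.ne', mul_comm ‖u (n + 1)‖]
      gcongr
  have key := hasDerivAt_tsum_of_isPreconnected hs Metric.isOpen_ball
    (convex_ball (0 : ℂ) r).isPreconnected hd hb hz' (hu.hasSum hz).summable hz'
  have hs' : Summable fun n : ℕ => u n * (n * z ^ (n - 1)) :=
    Summable.of_norm_bounded hs fun n => hb n z hz'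
  have e : powSum (fun n => (n + 1) * u (n + 1)) z = ∑' n : ℕ, u n * (n * z ^ (n - 1)) := by
    rw [hs'.tsum_eq_zero_add]
    simp only [powSum, Nat.cast_zero, zero_mul, mul_zero, zero_add, Nat.add_sub_cancel]
    exact tsum_congr fun n => by push_cast; ring
  rw [e]
  exact key

theorem CoeffBounded.differentiableOn {u : ℕ → ℂ} {R : ℝ} (hu : CoeffBounded u R) :
    DifferentiableOn ℂ (powSum u) (Metric.ball 0 R) := fun z hz =>
  (hu.hasDerivAt (by simpa using hz)).differentiableAt.differentiableWithinAt

/-- Multiplication by the variable. -/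
theorem CoeffBounded.hasSum_mul_deriv {u : ℕ → ℂ} {R : ℝ} (hu : CoeffBounded u R) {z : ℂ}
    (hz : ‖z‖ < R) :
    z * powSum (fun n => (n + 1) * u (n + 1)) z = powSum (fun n => n * u n) z := by
  have h := (hu.natCast_mul.hasSum hz).summable
  rw [powSum, powSum, h.tsum_eq_zero_add, ← tsum_mul_left]
  simp only [Nat.cast_zero, zero_mul, zero_add]
  exact tsum_congr fun n => by push_cast; ring

theorem powSum_zero (u : ℕ → ℂ) : powSum u 0 = u 0 := by
  rw [powSum, tsum_eq_single 0 (fun n hn => by simp [hn])]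
  simp

theorem powSum_const_mul (a : ℂ) (u : ℕ → ℂ) (z : ℂ) :
    powSum (fun n => a * u n) z = a * powSum u z := by
  simp only [powSum, mul_assoc, tsum_mul_left]

theorem CoeffBounded.powSum_add {u v : ℕ → ℂ} {R : ℝ} (hu : CoeffBounded u R)
    (hv : CoeffBounded v R) {z : ℂ} (hz : ‖z‖ < R) :
    powSum (fun n => u n + v n) z = powSum u z + powSum v z := by
  rw [powSum, powSum, powSum, ← (hu.hasSum hz).summable.tsum_add (hv.hasSum hz).summable]
  simp only [add_mul]

/-! ### Taylor coefficients at the origin -/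

/-- The Taylor coefficients of `f` at `0`. -/
noncomputable def taylorCoeff (f : ℂ → ℂ) (n : ℕ) : ℂ := iteratedDeriv n f 0 / n !

theorem taylorCoeff_congr {f g : ℂ → ℂ} (h : f =ᶠ[𝓝 0] g) (n : ℕ) :
    taylorCoeff f n = taylorCoeff g n := by
  rw [taylorCoeff, taylorCoeff, h.iteratedDeriv_eq n]

theorem hasSum_taylorCoeff {f : ℂ → ℂ} {R : ℝ} (hf : DifferentiableOn ℂ f (Metric.ball 0 R))
    {z : ℂ} (hz : ‖z‖ < R) : HasSum (fun n => taylorCoeff f n * z ^ n) (f z) := by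
  have h := Complex.hasSum_taylorSeries_on_ball hf (z := z) (by simpa using hz)
  have e : (fun n : ℕ => (n ! : ℂ)⁻¹ • (z - 0) ^ n • iteratedDeriv n f 0) =
      fun n => taylorCoeff f n * z ^ n := by
    funext n
    simp only [taylorCoeff, sub_zero, smul_eq_mul]
    ring
  rwa [e] at h

theorem coeffBounded_taylorCoeff {f : ℂ → ℂ} {R : ℝ}
    (hf : DifferentiableOn ℂ f (Metric.ball 0 R)) : CoeffBounded (taylorCoeff f) R := by
  intro r hr hrR
  have hn : ‖(r : ℂ)‖ = r := by simp [abs_of_pos hr]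
  have h := (hasSum_taylorCoeff hf (z := (r : ℂ)) (by rwa [hn])).summable.tendsto_atTop_zero
  obtain ⟨C, hC⟩ := h.norm.bddAbove_range
  refine ⟨C, fun n => ?_⟩
  have := hC ⟨n, rfl⟩
  simpa only [norm_mul, norm_pow, hn] using this

theorem AnalyticAt.exists_differentiableOn_ball {f : ℂ → ℂ} (hf : AnalyticAt ℂ f 0) :
    ∃ R > 0, DifferentiableOn ℂ f (Metric.ball 0 R) := by
  obtain ⟨R, hR, h⟩ := Metric.eventually_nhds_iff_ball.1 hf.eventually_analyticAt
  exact ⟨R, hR, fun z hz => (h z hz).differentiableAt.differentiableWithinAt⟩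

theorem AnalyticAt.eventually_eq_powSum {f : ℂ → ℂ} (hf : AnalyticAt ℂ f 0) :
    ∀ᶠ z in 𝓝 0, f z = powSum (taylorCoeff f) z := by
  obtain ⟨R, hR, h⟩ := hf.exists_differentiableOn_ball
  filter_upwards [Metric.ball_mem_nhds 0 hR] with z hz
  exact (hasSum_taylorCoeff h (by simpa using hz)).tsum_eq.symm

/-- Leibniz' rule divided by `n !`: the Cauchy product, which turns differential equations with
analytic coefficients into recursions. -/
theorem taylorCoeff_mul {f g : ℂ → ℂ} (hf : AnalyticAt ℂ f 0) (hg : AnalyticAt ℂ g 0) (n : ℕ) :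
    taylorCoeff (fun z => f z * g z) n =
      ∑ i ∈ Finset.range (n + 1), taylorCoeff f i * taylorCoeff g (n - i) := by
  have h := iteratedDeriv_mul (n := n) hf.contDiffAt hg.contDiffAt
  rw [taylorCoeff, show (fun z => f z * g z) = f * g from rfl, h, Finset.sum_div]
  refine Finset.sum_congr rfl fun i hi => ?_
  have hi' : i ≤ n := by simpa [Nat.lt_succ_iff] using hi
  have h1 : (i ! : ℂ) ≠ 0 := by exact_mod_cast i.factorial_ne_zero
  have h2 : ((n - i)! : ℂ) ≠ 0 := by exact_mod_cast (n - i).factorial_ne_zero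
  have h3 : (n ! : ℂ) ≠ 0 := by exact_mod_cast n.factorial_ne_zero
  rw [taylorCoeff, taylorCoeff, Nat.cast_choose ℂ hi']
  field_simp

theorem taylorCoeff_add {f g : ℂ → ℂ} (hf : AnalyticAt ℂ f 0) (hg : AnalyticAt ℂ g 0) (n : ℕ) :
    taylorCoeff (fun z => f z + g z) n = taylorCoeff f n + taylorCoeff g n := by
  have h := iteratedDeriv_add (n := n) (𝕜 := ℂ) hf.contDiffAt hg.contDiffAt
  rw [taylorCoeff, show (fun z => f z + g z) = f + g from rfl, h, add_div]; rfl

theorem taylorCoeff_sum {ι : Type*} (s : Finset ι) {f : ι → ℂ → ℂ}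
    (hf : ∀ i ∈ s, AnalyticAt ℂ (f i) 0) (n : ℕ) :
    taylorCoeff (fun z => ∑ i ∈ s, f i z) n = ∑ i ∈ s, taylorCoeff (f i) n := by
  classical
  induction s using Finset.induction_on with
  | empty => simp [taylorCoeff]
  | insert a s ha ih =>
    simp only [Finset.sum_insert ha]
    rw [taylorCoeff_add (hf a (Finset.mem_insert_self a s))
      (Finset.analyticAt_fun_sum _ fun i hi => hf i (Finset.mem_insert_of_mem hi)),
      ih fun i hi => hf i (Finset.mem_insert_of_mem hi)]

theorem taylorCoeff_deriv (f : ℂ → ℂ) (n : ℕ) :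
    taylorCoeff (deriv f) n = (n + 1) * taylorCoeff f (n + 1) := by
  rw [taylorCoeff, taylorCoeff, ← iteratedDeriv_succ', Nat.factorial_succ]
  have h1 : (n ! : ℂ) ≠ 0 := by exact_mod_cast n.factorial_ne_zero
  have h2 : (n + 1 : ℂ) ≠ 0 := by exact_mod_cast n.succ_ne_zero
  push_cast
  field_simp

theorem taylorCoeff_id_mul {f : ℂ → ℂ} (hf : AnalyticAt ℂ f 0) (n : ℕ) :
    taylorCoeff (fun z => z * f z) (n + 1) = taylorCoeff f n := by
  rw [taylorCoeff_mul (f := fun z => z) analyticAt_id hf, Finset.sum_eq_single 1]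
  · simp [taylorCoeff, iteratedDeriv_one]
  · intro i _ hi
    have : taylorCoeff (fun z => z) i = 0 := by
      rcases i with _ | _ | i
      · simp [taylorCoeff]
      · exact absurd rfl hi
      · rw [taylorCoeff, iteratedDeriv_succ', iteratedDeriv_succ']
        simp
    rw [this, zero_mul]
  · intro h; simp at h

theorem taylorCoeff_id_mul_deriv {f : ℂ → ℂ} (hf : AnalyticAt ℂ f 0) (n : ℕ) :
    taylorCoeff (fun z => z * deriv f z) n = n * taylorCoeff f n := by
  rcases n with _ | n
  · simp [taylorCoeff]
  · rw [taylorCoeff_id_mul hf.deriv, taylorCoeff_deriv]; push_cast; rfl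

/-! ### Regular singular points -/

/-- A discrete Gronwall inequality. For the partial sums `E` the hypothesis reads `n (E (n+1) - E n)
≤ C E (n+1)`, that is `(1 - C / n) E (n+1) ≤ E n` for `n > 0`. Once `n ≥ C q / (q - 1)`, the factor
is at least `1 / q`, so `E n / q ^ n` is eventually decreasing. -/
theorem exists_le_geometric_of_mul_le_sum {e : ℕ → ℝ} (he : ∀ n, 0 ≤ e n) {C : ℝ}
    (h : ∀ n : ℕ, n * e n ≤ C * ∑ l ∈ Finset.range (n + 1), e l) {q : ℝ} (hq : 1 < q) :
    ∃ K, ∀ n, e n ≤ K * q ^ n := by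
  have hq0 : 0 < q := one_pos.trans hq
  set E : ℕ → ℝ := fun n => ∑ l ∈ Finset.range n, e l with hE
  have hE0 : ∀ n, 0 ≤ E n := fun n => Finset.sum_nonneg fun l _ => he l
  have hev : ∀ᶠ n : ℕ in atTop, E (n + 1) / q ^ (n + 1) ≤ E n / q ^ n := by
    have h1 : ∀ᶠ n : ℕ in atTop, C * q / (q - 1) ≤ n :=
      tendsto_natCast_atTop_atTop.eventually_ge_atTop _
    filter_upwards [h1, eventually_gt_atTop 0] with n hn hn0
    have h2 := h n
    have h3 : E (n + 1) = E n + e n := Finset.sum_range_succ _ _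
    rw [div_le_iff₀ (by linarith)] at hn
    have hn0' : (0 : ℝ) < n := by exact_mod_cast hn0
    have h4 : E (n + 1) ≤ E n * q := by
      have h5 : (n : ℝ) * (E (n + 1) - E n) ≤ C * E (n + 1) := by
        rwa [h3, add_sub_cancel_left, ← h3]
      have h6 : (n : ℝ) * E (n + 1) ≤ n * (E n * q) := by
        nlinarith [mul_le_mul_of_nonneg_right hn (hE0 (n + 1))]
      exact le_of_mul_le_mul_left h6 hn0'
    rw [pow_succ, div_le_div_iff₀ (by positivity) (by positivity)]
    nlinarith [pow_pos hq0 n]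
  obtain ⟨K, hK⟩ := bddAbove_of_eventually_antitone (s := fun n => E n / q ^ n) hev
  refine ⟨K * q, fun n => ?_⟩
  have h3 : E (n + 1) = E n + e n := Finset.sum_range_succ _ _
  have h4 := hK (n + 1)
  rw [div_le_iff₀ (by positivity)] at h4
  calc e n ≤ E (n + 1) := by linarith [hE0 n]
    _ ≤ K * q ^ (n + 1) := h4
    _ = K * q * q ^ n := by ring

/-- A local analytic solution of a linear system `w Y' = A Y` has a Taylor series that converges
in every disc in which the coefficients are holomorphic. -/
theorem coeffBounded_of_regular_singular {ι : Type*} [Fintype ι] {A : ι → ι → ℂ → ℂ}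
    {Y : ι → ℂ → ℂ} {R : ℝ} (hA : ∀ i j, DifferentiableOn ℂ (A i j) (Metric.ball 0 R))
    (hY : ∀ i, AnalyticAt ℂ (Y i) 0)
    (h : ∀ i, ∀ᶠ w in 𝓝 0, w * deriv (Y i) w = ∑ j, A i j w * Y j w) (i : ι) :
    CoeffBounded (taylorCoeff (Y i)) R := by
  intro r hr hrR
  -- The estimates are made at the radius `r'`; the gap to `r` pays for the geometric loss `(r' / r)
  -- ^ n` in the Gronwall bound.
  obtain ⟨r', h1, h2⟩ := exists_between hrR
  have hr' : 0 < r' := hr.trans h1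
  have hAan : ∀ i j, AnalyticAt ℂ (A i j) 0 := fun i j =>
    (hA i j).analyticAt (Metric.ball_mem_nhds 0 (hr'.trans h2))
  have hC : ∀ i j, ∃ C, ∀ n, ‖taylorCoeff (A i j) n‖ * r' ^ n ≤ C := fun i j =>
    coeffBounded_taylorCoeff (hA i j) r' hr' h2
  choose C hC using hC
  have hC0 : ∀ i j, 0 ≤ C i j := fun i j => le_trans (by positivity) (hC i j 0)
  set D : ℝ := ∑ i, ∑ j, C i j with hD
  have hCD : ∀ i j, C i j ≤ ∑ i, C i j := fun i j =>
    Finset.single_le_sum (f := fun i => C i j) (fun i _ => hC0 i j) (Finset.mem_univ i)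
  set e : ℕ → ℝ := fun n => ∑ i, ‖taylorCoeff (Y i) n‖ * r' ^ n with he
  have he0 : ∀ n, 0 ≤ e n := fun n => Finset.sum_nonneg fun i _ => by positivity
  have hle : ∀ i n, ‖taylorCoeff (Y i) n‖ * r' ^ n ≤ e n := fun i n =>
    Finset.single_le_sum (f := fun i => ‖taylorCoeff (Y i) n‖ * r' ^ n)
      (fun i _ => by positivity) (Finset.mem_univ i)
  -- Comparison of the coefficients of `w ^ n`: the operator `w d/dw` multiplies by `n`, and the
  -- right side is a Cauchy product.
  have hrec : ∀ i (n : ℕ), (n : ℂ) * taylorCoeff (Y i) n =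
      ∑ j, ∑ k ∈ Finset.range (n + 1), taylorCoeff (A i j) k * taylorCoeff (Y j) (n - k) := by
    intro i n
    rw [← taylorCoeff_id_mul_deriv (hY i), taylorCoeff_congr (h i),
      taylorCoeff_sum _ fun j _ => (hAan i j).fun_mul (hY j)]
    exact Finset.sum_congr rfl fun j _ => taylorCoeff_mul (hAan i j) (hY j) n
  have hbound : ∀ i (n : ℕ), n * (‖taylorCoeff (Y i) n‖ * r' ^ n) ≤
      (∑ j, C i j) * ∑ l ∈ Finset.range (n + 1), e l := by
    intro i n
    have : (n : ℝ) * ‖taylorCoeff (Y i) n‖ = ‖(n : ℂ) * taylorCoeff (Y i) n‖ := by simp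
    rw [← mul_assoc, this, hrec, Finset.sum_mul]
    calc ‖∑ j, ∑ k ∈ Finset.range (n + 1), taylorCoeff (A i j) k * taylorCoeff (Y j) (n - k)‖
          * r' ^ n
        ≤ (∑ j, ∑ k ∈ Finset.range (n + 1),
            ‖taylorCoeff (A i j) k * taylorCoeff (Y j) (n - k)‖) * r' ^ n := by
          gcongr
          exact (norm_sum_le _ _).trans (Finset.sum_le_sum fun j _ => norm_sum_le _ _)
      _ = ∑ j, ∑ k ∈ Finset.range (n + 1), (‖taylorCoeff (A i j) k‖ * r' ^ k) *
            (‖taylorCoeff (Y j) (n - k)‖ * r' ^ (n - k)) := by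
          rw [Finset.sum_mul]
          refine Finset.sum_congr rfl fun j _ => ?_
          rw [Finset.sum_mul]
          refine Finset.sum_congr rfl fun k hk => ?_
          have hk' : k ≤ n := by simpa [Nat.lt_succ_iff] using hk
          rw [norm_mul, ← Nat.add_sub_cancel' hk', pow_add, Nat.add_sub_cancel_left]
          ring
      _ ≤ ∑ j, C i j * ∑ l ∈ Finset.range (n + 1), e l := by
          refine Finset.sum_le_sum fun j _ => ?_
          rw [← Finset.sum_range_reflect e, Finset.mul_sum]
          refine Finset.sum_le_sum fun k _ => ?_
          exact mul_le_mul (hC i j k) (by simpa using hle j (n - k)) (by positivity) (hC0 i j)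
  have hsum : ∀ n : ℕ, n * e n ≤ D * ∑ l ∈ Finset.range (n + 1), e l := by
    intro n
    rw [he, Finset.mul_sum, hD, Finset.sum_mul]
    exact Finset.sum_le_sum fun i _ => hbound i n
  obtain ⟨K, hK⟩ := exists_le_geometric_of_mul_le_sum he0 hsum ((one_lt_div hr).2 h1)
  refine ⟨K, fun n => ?_⟩
  have h3 := (hle i n).trans (hK n)
  rw [div_pow, mul_div_assoc', le_div_iff₀ (by positivity)] at h3
  have h4 : 0 < r' ^ n := by positivity
  nlinarith

/-- Uniqueness of the analytic solution at a regular singular point. -/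
theorem eventually_eq_zero_of_regular_singular {y p q : ℂ → ℂ} (hy : AnalyticAt ℂ y 0)
    (hp : AnalyticAt ℂ p 0) (hq : AnalyticAt ℂ q 0)
    (h : ∀ᶠ z in 𝓝 0, z * deriv (deriv y) z + p z * deriv y z + q z * y z = 0)
    (hp0 : NotNonposInt (p 0)) (hy0 : y 0 = 0) : ∀ᶠ z in 𝓝 0, y z = 0 := by
  have hz : ∀ n, taylorCoeff y n = 0 := by
    intro n
    induction n using Nat.strong_induction_on with
    | _ n ih =>
    rcases n with _ | n
    · simp [taylorCoeff, hy0]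
    have h1 : taylorCoeff (fun z => z * deriv (deriv y) z + p z * deriv y z + q z * y z) n = 0 := by
      rw [taylorCoeff_congr (g := fun _ => 0) h]; simp [taylorCoeff]
    have hid : AnalyticAt ℂ (fun z : ℂ => z) 0 := analyticAt_id
    rw [taylorCoeff_add ((hid.fun_mul hy.deriv.deriv).fun_add (hp.fun_mul hy.deriv))
      (hq.fun_mul hy), taylorCoeff_add (hid.fun_mul hy.deriv.deriv) (hp.fun_mul hy.deriv),
      taylorCoeff_id_mul_deriv hy.deriv, taylorCoeff_mul hp hy.deriv, taylorCoeff_mul hq hy,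
      Finset.sum_eq_single 0, Finset.sum_eq_zero, taylorCoeff_deriv] at h1
    · have h2 : ((n : ℂ) + 1) * (p 0 + n) * taylorCoeff y (n + 1) = 0 := by
        simp only [Nat.sub_zero, taylorCoeff_deriv] at h1
        simp only [taylorCoeff, Nat.factorial_zero, iteratedDeriv_zero] at h1 ⊢
        linear_combination h1
      refine (mul_eq_zero.1 h2).resolve_left (mul_ne_zero (by exact_mod_cast n.succ_ne_zero) ?_)
      exact fun h => hp0 n (eq_neg_of_add_eq_zero_left h)
    · intro i hi
      rw [ih (n - i) (by omega), mul_zero]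
    · intro i hi hi0
      have : n - i + 1 < n + 1 := by
        have := Finset.mem_range.1 hi; omega
      rw [taylorCoeff_deriv, ih _ this, mul_zero, mul_zero]
    · intro h; simp at h
  filter_upwards [hy.eventually_eq_powSum] with z hz'
  rw [hz', powSum]
  simp [hz]

/-! ### Uniformization of the plane cut along a ray from `1` -/

/-- The principal fourth root of `1 - z`. -/
noncomputable def cutRoot (z : ℂ) : ℂ := (1 - z) ^ (((4 : ℕ) : ℂ)⁻¹)

/-- A coordinate with values in the unit disc on the plane without `1`. -/
noncomputable def discCoord (z : ℂ) : ℂ := (1 - cutRoot z) / (1 + cutRoot z)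

/-- The inverse of `discCoord`, which is defined in the whole unit disc. -/
noncomputable def discMap (w : ℂ) : ℂ := 1 - ((1 - w) / (1 + w)) ^ 4

/-- The derivative of `discMap`. -/
noncomputable def discMapDeriv (w : ℂ) : ℂ := 8 * (1 - w) ^ 3 / (1 + w) ^ 5

theorem cutRoot_pow (z : ℂ) : cutRoot z ^ 4 = 1 - z := Complex.cpow_nat_inv_pow _ (by norm_num)

theorem cutRoot_eq_exp {z : ℂ} (hz : z ≠ 1) : cutRoot z = Complex.exp (Complex.log (1 - z) / 4) := by
  rw [cutRoot, Complex.cpow_def_of_ne_zero (sub_ne_zero.2 hz.symm)]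
  push_cast
  rw [div_eq_mul_inv]

theorem log_cutRoot {z : ℂ} (hz : z ≠ 1) : 4 * Complex.log (cutRoot z) = Complex.log (1 - z) := by
  have hpi := Real.pi_pos
  have h1 := Complex.neg_pi_lt_log_im (1 - z)
  have h2 := Complex.log_im_le_pi (1 - z)
  have h3 : (Complex.log (1 - z) / 4).im = (Complex.log (1 - z)).im / 4 := by
    simp
  rw [cutRoot_eq_exp hz, Complex.log_exp (by rw [h3]; linarith) (by rw [h3]; linarith)]
  ring

/-- The argument of `1 - z` lies in `(-π, π]`, so a quarter of it stays strictly inside `(-π/2,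
π/2)`, even on the cut. A square root would reach the imaginary axis there, and the cut would land
on the boundary of the disc. -/
theorem cutRoot_re_pos {z : ℂ} (hz : z ≠ 1) : 0 < (cutRoot z).re := by
  have hpi := Real.pi_pos
  have h1 := Complex.neg_pi_lt_log_im (1 - z)
  have h2 := Complex.log_im_le_pi (1 - z)
  have h3 : (Complex.log (1 - z) / 4).im = (Complex.log (1 - z)).im / 4 := by simp
  rw [cutRoot_eq_exp hz, Complex.exp_re, h3]
  exact mul_pos (Real.exp_pos _) (Real.cos_pos_of_mem_Ioo ⟨by linarith, by linarith⟩)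

theorem one_add_cutRoot_ne_zero {z : ℂ} (hz : z ≠ 1) : 1 + cutRoot z ≠ 0 := fun h => by
  have h1 := congrArg Complex.re h
  have h2 := cutRoot_re_pos hz
  simp at h1
  linarith

theorem norm_discCoord_lt_one {z : ℂ} (hz : z ≠ 1) : ‖discCoord z‖ < 1 := by
  have h := cutRoot_re_pos hz
  rw [discCoord, norm_div, div_lt_one (norm_pos_iff.2 (one_add_cutRoot_ne_zero hz)),
    ← sq_lt_sq₀ (norm_nonneg _) (norm_nonneg _), ← Complex.normSq_eq_norm_sq,
    ← Complex.normSq_eq_norm_sq, Complex.normSq_apply, Complex.normSq_apply]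
  simp
  nlinarith

theorem discCoord_mem {z : ℂ} (hz : z ≠ 1) : discCoord z ∈ Metric.ball (0 : ℂ) 1 := by
  simpa using norm_discCoord_lt_one hz

theorem one_add_ne_zero_of_mem_ball {w : ℂ} (hw : w ∈ Metric.ball (0 : ℂ) 1) : 1 + w ≠ 0 := by
  intro h
  rw [eq_neg_of_add_eq_zero_right h] at hw
  simp at hw

theorem one_sub_ne_zero_of_mem_ball {w : ℂ} (hw : w ∈ Metric.ball (0 : ℂ) 1) : 1 - w ≠ 0 := by
  intro h
  rw [← sub_eq_zero.1 h] at hw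
  simp at hw

/-- Since `discMap w = 8 w (1 + w ^ 2) / (1 + w) ^ 4`, this makes the origin the only point of the
disc over `0`. -/
theorem one_add_sq_ne_zero_of_mem_ball {w : ℂ} (hw : w ∈ Metric.ball (0 : ℂ) 1) :
    1 + w ^ 2 ≠ 0 := by
  have : w ^ 2 ∈ Metric.ball (0 : ℂ) 1 := by
    simp only [Metric.mem_ball, dist_zero_right, norm_pow] at hw ⊢
    exact pow_lt_one₀ (norm_nonneg w) hw two_ne_zero
  exact one_add_ne_zero_of_mem_ball this

theorem div_discCoord {z : ℂ} (hz : z ≠ 1) :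
    (1 - discCoord z) / (1 + discCoord z) = cutRoot z := by
  have h := one_add_cutRoot_ne_zero hz
  rw [discCoord]
  field_simp
  ring

theorem discMap_discCoord {z : ℂ} (hz : z ≠ 1) : discMap (discCoord z) = z := by
  rw [discMap, div_discCoord hz, cutRoot_pow, sub_sub_cancel]

theorem discMap_zero : discMap 0 = 0 := by simp [discMap]

theorem discCoord_zero : discCoord 0 = 0 := by simp [discCoord, cutRoot]

theorem hasDerivAt_discMap {w : ℂ} (hw : w ∈ Metric.ball (0 : ℂ) 1) :
    HasDerivAt discMap (discMapDeriv w) w := by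
  have h := one_add_ne_zero_of_mem_ball hw
  have h1 : HasDerivAt (fun w : ℂ => 1 - w) (-1) w := by
    simpa using (hasDerivAt_id w).const_sub 1
  have h2 : HasDerivAt (fun w : ℂ => 1 + w) 1 w := by
    simpa using (hasDerivAt_id w).const_add 1
  refine (((h1.div h2 h).pow 4).const_sub 1).congr_deriv ?_
  simp only [discMapDeriv, Pi.div_apply, div_pow]
  rw [neg_eq_iff_eq_neg, mul_div_assoc', ← neg_div]
  norm_num
  field_simp
  ring

theorem discMapDeriv_ne_zero {w : ℂ} (hw : w ∈ Metric.ball (0 : ℂ) 1) : discMapDeriv w ≠ 0 := by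
  have h := one_add_ne_zero_of_mem_ball hw
  have h' := one_sub_ne_zero_of_mem_ball hw
  exact div_ne_zero (mul_ne_zero (by norm_num) (pow_ne_zero 3 h')) (pow_ne_zero 5 h)

/-- The value of the derivative comes from the left inverse `discMap`. The field is left free to
cover two cases: the complex variable off the cut, and the real variable along the cut, where
`discCoord` is not complex differentiable. -/
theorem hasDerivAt_discCoord_comp {𝕜 : Type*} [NontriviallyNormedField 𝕜] [NormedAlgebra 𝕜 ℂ]
    {g : 𝕜 → ℂ} {t : 𝕜} (hg : HasDerivAt g 1 t) (ht : g t ≠ 1)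
    (hc : DifferentiableAt 𝕜 (fun x => cutRoot (g x)) t) :
    HasDerivAt (fun x => discCoord (g x)) (1 / discMapDeriv (discCoord (g t))) t := by
  have hd : DifferentiableAt 𝕜 (fun x => discCoord (g x)) t :=
    (hc.const_sub 1).fun_div (hc.const_add 1) (one_add_cutRoot_ne_zero ht)
  have h1 := (hasDerivAt_discMap (discCoord_mem ht)).comp_of_eq t hd.hasDerivAt rfl
  have h2 : (fun x => discMap (discCoord (g x))) =ᶠ[𝓝 t] g := by
    filter_upwards [hg.continuousAt.eventually_ne ht] with x hx using discMap_discCoord hx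
  have h3 := (h1.congr_of_eventuallyEq h2.symm).unique hg
  rw [← eq_div_of_mul_eq (discMapDeriv_ne_zero (discCoord_mem ht)) (by rw [mul_comm]; exact h3)]
  exact hd.hasDerivAt

theorem hasDerivAt_discCoord {z : ℂ} (hz : 1 - z ∈ Complex.slitPlane) :
    HasDerivAt discCoord (1 / discMapDeriv (discCoord z)) z := by
  have h1 : z ≠ 1 := fun h => by simp [h] at hz
  refine hasDerivAt_discCoord_comp (g := fun z : ℂ => z) (hasDerivAt_id z) h1 ?_
  exact ((hasDerivAt_id z).const_sub 1).differentiableAt.cpow_const hz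

theorem hasDerivAt_discCoord_ofReal {x : ℝ} (hx : x ≠ 1) :
    HasDerivAt (fun t : ℝ => discCoord t) (1 / discMapDeriv (discCoord x)) x := by
  refine hasDerivAt_discCoord_comp (g := fun t : ℝ => (t : ℂ)) Complex.ofRealCLM.hasDerivAt
    (by exact_mod_cast hx) ?_
  have h := (hasDerivAt_ofReal_cpow_const (x := 1 - x) (sub_ne_zero.2 hx.symm)
    (r := ((4 : ℕ) : ℂ)⁻¹) (by norm_num)).comp_const_sub 1 x
  simpa [cutRoot] using h.differentiableAt

theorem tendsto_discCoord_below {x : ℝ} (hx : 1 < x) :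
    Tendsto (fun ε : ℝ => discCoord ((x : ℂ) - (ε : ℂ) * Complex.I)) (𝓝[>] 0)
      (𝓝 (discCoord x)) := by
  have hx1 : (x : ℂ) ≠ 1 := by exact_mod_cast hx.ne'
  -- For `z = x - ε i` the number `1 - z` has imaginary part `ε > 0`, and the principal logarithm is
  -- continuous at negative reals from the closed upper half plane.
  have hlog : Tendsto (fun ε : ℝ => Complex.log (1 - ((x : ℂ) - (ε : ℂ) * Complex.I))) (𝓝[>] 0)
      (𝓝 (Complex.log (1 - x))) := by
    have h := Complex.continuousWithinAt_log_of_re_neg_of_im_zero (z := 1 - (x : ℂ))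
      (by simpa using hx) (by simp)
    refine h.tendsto.comp (tendsto_nhdsWithin_iff.2 ⟨?_, ?_⟩)
    · refine (Continuous.tendsto' (by fun_prop) 0 _ (by simp)).mono_left nhdsWithin_le_nhds
    · filter_upwards [self_mem_nhdsWithin] with ε hε
      simpa using (Set.mem_Ioi.1 hε).le
  have hroot : Tendsto (fun ε : ℝ => cutRoot ((x : ℂ) - (ε : ℂ) * Complex.I)) (𝓝[>] 0)
      (𝓝 (cutRoot x)) := by
    rw [cutRoot_eq_exp hx1]
    refine ((Complex.continuous_exp.tendsto _).comp (hlog.div_const 4)).congr' ?_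
    filter_upwards [self_mem_nhdsWithin] with ε hε
    rw [cutRoot_eq_exp]
    · rfl
    · intro h
      have := congrArg Complex.im h
      simp at this
      exact (Set.mem_Ioi.1 hε).ne' this
  exact (hroot.const_sub 1).div (hroot.const_add 1) (one_add_cutRoot_ne_zero hx1)

/-! ### Continuation of germs at the origin to the real line -/

/-- `f` is the continuation, along the real line below the point `1`, of the germ of `F` at `0`,
by means of a holomorphic function in the coordinate `discCoord`. -/
def ContinuesTo (F : ℂ → ℂ) (f : ℝ → ℂ) : Prop :=
  ∃ Φ : ℂ → ℂ, DifferentiableOn ℂ Φ (Metric.ball 0 1) ∧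
    (∀ᶠ z in 𝓝 0, F z = Φ (discCoord z)) ∧ ∀ x : ℝ, x ≠ 1 → f x = Φ (discCoord x)

theorem eventually_one_sub_mem_slitPlane :
    ∀ᶠ z : ℂ in 𝓝 0, 1 - z ∈ Complex.slitPlane := by
  have h : ContinuousAt (fun z : ℂ => 1 - z) 0 := by fun_prop
  exact h.eventually (Complex.isOpen_slitPlane.mem_nhds (by simp))

theorem slitPlane_ne_one {z : ℂ} (hz : 1 - z ∈ Complex.slitPlane) : z ≠ 1 := fun h => by
  simp [h] at hz

theorem continuousAt_discCoord_zero : ContinuousAt discCoord 0 :=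
  (hasDerivAt_discCoord (by simp)).continuousAt

/-- The identity theorem in the disc. As `discCoord` is injective near `0` and continuous, points
`discCoord z` with `z ≠ 0` accumulate at `0`, which is all that the theorem needs. -/
theorem eqOn_of_eventually_eq_discCoord {Φ Ψ : ℂ → ℂ} (hΦ : DifferentiableOn ℂ Φ (Metric.ball 0 1))
    (hΨ : DifferentiableOn ℂ Ψ (Metric.ball 0 1))
    (h : ∀ᶠ z in 𝓝 0, Φ (discCoord z) = Ψ (discCoord z)) :
    Set.EqOn Φ Ψ (Metric.ball 0 1) := by
  refine AnalyticOnNhd.eqOn_of_preconnected_of_frequently_eq (z₀ := 0)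
    (hΦ.analyticOnNhd Metric.isOpen_ball) (hΨ.analyticOnNhd Metric.isOpen_ball)
    (convex_ball (0 : ℂ) 1).isPreconnected (by simp) ?_
  have ht : Tendsto discCoord (𝓝[≠] 0) (𝓝[≠] 0) := by
    refine tendsto_nhdsWithin_iff.2 ⟨?_, ?_⟩
    · have := continuousAt_discCoord_zero.tendsto
      rw [discCoord_zero] at this
      exact this.mono_left nhdsWithin_le_nhds
    · filter_upwards [self_mem_nhdsWithin,
        nhdsWithin_le_nhds eventually_one_sub_mem_slitPlane] with z hz hz1 h0
      apply hz
      have := discMap_discCoord (slitPlane_ne_one hz1)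
      rw [Set.mem_singleton_iff.1 h0, discMap_zero] at this
      exact this.symm
  exact ht.frequently (h.filter_mono nhdsWithin_le_nhds).frequently

/-- Permanence of functional relations: two germs that agree at `0` have the same representative in
the disc. All identities between hypergeometric functions on the real line, cut included, are
obtained in this way from power series. -/
theorem ContinuesTo.eq {F G : ℂ → ℂ} {f g : ℝ → ℂ} (hF : ContinuesTo F f) (hG : ContinuesTo G g)
    (h : ∀ᶠ z in 𝓝 0, F z = G z) {x : ℝ} (hx : x ≠ 1) : f x = g x := by
  obtain ⟨Φ, hΦ, hF1, hf⟩ := hF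
  obtain ⟨Ψ, hΨ, hG1, hg⟩ := hG
  rw [hf x hx, hg x hx]
  refine eqOn_of_eventually_eq_discCoord hΦ hΨ ?_ (discCoord_mem (by exact_mod_cast hx))
  filter_upwards [hF1, hG1, h] with z h1 h2 h3
  rw [← h1, ← h2, h3]

theorem ContinuesTo.add {F G : ℂ → ℂ} {f g : ℝ → ℂ} (hF : ContinuesTo F f)
    (hG : ContinuesTo G g) : ContinuesTo (fun z => F z + G z) (fun x => f x + g x) := by
  obtain ⟨Φ, hΦ, hF1, hf⟩ := hF
  obtain ⟨Ψ, hΨ, hG1, hg⟩ := hG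
  refine ⟨fun w => Φ w + Ψ w, hΦ.fun_add hΨ, ?_, fun x hx => by simp only [hf x hx, hg x hx]⟩
  filter_upwards [hF1, hG1] with z h1 h2
  rw [h1, h2]

theorem ContinuesTo.mul {F G : ℂ → ℂ} {f g : ℝ → ℂ} (hF : ContinuesTo F f)
    (hG : ContinuesTo G g) : ContinuesTo (fun z => F z * G z) (fun x => f x * g x) := by
  obtain ⟨Φ, hΦ, hF1, hf⟩ := hF
  obtain ⟨Ψ, hΨ, hG1, hg⟩ := hG
  refine ⟨fun w => Φ w * Ψ w, hΦ.fun_mul hΨ, ?_, fun x hx => by simp only [hf x hx, hg x hx]⟩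
  filter_upwards [hF1, hG1] with z h1 h2
  rw [h1, h2]

theorem continuesTo_const (a : ℂ) : ContinuesTo (fun _ => a) (fun _ => a) :=
  ⟨fun _ => a, differentiableOn_const a, .of_forall fun _ => rfl, fun _ _ => rfl⟩

theorem ContinuesTo.const_mul {F : ℂ → ℂ} {f : ℝ → ℂ} (a : ℂ) (hF : ContinuesTo F f) :
    ContinuesTo (fun z => a * F z) (fun x => a * f x) :=
  (continuesTo_const a).mul hF

theorem ContinuesTo.sub {F G : ℂ → ℂ} {f g : ℝ → ℂ} (hF : ContinuesTo F f)
    (hG : ContinuesTo G g) : ContinuesTo (fun z => F z - G z) (fun x => f x - g x) := by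
  simpa [sub_eq_add_neg] using hF.add (hG.const_mul (-1))

theorem differentiableOn_discMap : DifferentiableOn ℂ discMap (Metric.ball 0 1) := fun _ hw =>
  (hasDerivAt_discMap hw).differentiableAt.differentiableWithinAt

theorem continuesTo_id : ContinuesTo (fun z => z) (fun x => (x : ℂ)) := by
  refine ⟨discMap, differentiableOn_discMap, ?_, fun x hx => ?_⟩
  · filter_upwards [eventually_one_sub_mem_slitPlane] with z hz
    exact (discMap_discCoord (slitPlane_ne_one hz)).symm
  · exact (discMap_discCoord (z := x) (by exact_mod_cast hx)).symm

theorem one_sub_div_one_add_mem_slitPlane {w : ℂ} (hw : w ∈ Metric.ball (0 : ℂ) 1) :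
    (1 - w) / (1 + w) ∈ Complex.slitPlane := by
  have h := one_add_ne_zero_of_mem_ball hw
  refine Or.inl ?_
  have hw' : w.re * w.re + w.im * w.im < 1 := by
    rw [← Complex.normSq_apply, Complex.normSq_eq_norm_sq]
    have : ‖w‖ < 1 := by simpa using hw
    nlinarith [norm_nonneg w]
  have hn : 0 < Complex.normSq (1 + w) := Complex.normSq_pos.2 h
  rw [Complex.div_re, ← add_div]
  refine div_pos ?_ hn
  simp
  nlinarith

/-- In the disc, `4 log ((1 - w) / (1 + w))` is a holomorphic logarithm of `1 - discMap w`, because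
`(1 - w) / (1 + w)` has positive real part. It agrees with the principal logarithm of `1 - z` on the
cut as well. -/
theorem continuesTo_one_sub_cpow (s : ℂ) :
    ContinuesTo (fun z => (1 - z) ^ s) (fun x => (1 - (x : ℂ)) ^ s) := by
  have key : ∀ z : ℂ, z ≠ 1 → (1 - z) ^ s =
      Complex.exp (4 * Complex.log ((1 - discCoord z) / (1 + discCoord z)) * s) := fun z hz => by
    rw [div_discCoord hz, log_cutRoot hz, Complex.cpow_def_of_ne_zero (sub_ne_zero.2 hz.symm)]
  refine ⟨fun w => Complex.exp (4 * Complex.log ((1 - w) / (1 + w)) * s), ?_, ?_,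
    fun x hx => key x (by exact_mod_cast hx)⟩
  · intro w hw
    have h1 : DifferentiableAt ℂ (fun w : ℂ => (1 - w) / (1 + w)) w :=
      DifferentiableAt.fun_div (by fun_prop) (by fun_prop) (one_add_ne_zero_of_mem_ball hw)
    exact (((h1.clog (one_sub_div_one_add_mem_slitPlane hw)).const_mul 4).mul_const
      s).cexp.differentiableWithinAt
  · filter_upwards [eventually_one_sub_mem_slitPlane] with z hz using key z (slitPlane_ne_one hz)

theorem ContinuesTo.exists_deriv {F : ℂ → ℂ} {f : ℝ → ℂ} (hF : ContinuesTo F f) :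
    ∃ f' : ℝ → ℂ, ContinuesTo (deriv F) f' ∧ ∀ x : ℝ, x ≠ 1 → HasDerivAt f (f' x) x := by
  obtain ⟨Φ, hΦ, hF1, hf⟩ := hF
  have hΦd : ∀ w ∈ Metric.ball (0 : ℂ) 1, HasDerivAt Φ (deriv Φ w) w := fun w hw =>
    (hΦ.differentiableAt (Metric.isOpen_ball.mem_nhds hw)).hasDerivAt
  refine ⟨fun x => deriv Φ (discCoord x) * (1 / discMapDeriv (discCoord x)),
    ⟨fun w => deriv Φ w * (1 / discMapDeriv w), ?_, ?_, fun x _ => rfl⟩, fun x hx => ?_⟩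
  · refine (hΦ.deriv Metric.isOpen_ball).fun_mul fun w hw => ?_
    have h := one_add_ne_zero_of_mem_ball hw
    refine DifferentiableAt.differentiableWithinAt ?_
    refine DifferentiableAt.fun_div (by fun_prop) ?_ (discMapDeriv_ne_zero hw)
    unfold discMapDeriv
    exact DifferentiableAt.fun_div (by fun_prop) (by fun_prop) (pow_ne_zero 5 h)
  · filter_upwards [hF1.eventually_nhds, eventually_one_sub_mem_slitPlane] with z hz hz1
    have h1 := hΦd _ (discCoord_mem (slitPlane_ne_one hz1))
    exact ((h1.comp z (hasDerivAt_discCoord hz1)).congr_of_eventuallyEq hz).deriv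
  · have h1 := hΦd _ (discCoord_mem (z := x) (by exact_mod_cast hx))
    refine (h1.comp x (hasDerivAt_discCoord_ofReal hx)).congr_of_eventuallyEq ?_
    filter_upwards [eventually_ne_nhds hx] with y hy using hf y hy

/-- The function `Φ ∘ discCoord` meets all three conditions of `IsHypContinuation`, so the chosen
function meets them too. The two agree off the cut by the identity theorem and on the cut by
uniqueness of the limit from below. -/
theorem hypCont_eq_comp_discCoord {as bs : List ℂ} {Φ : ℂ → ℂ}
    (has : DifferentiableOn ℂ (hypSeries as bs) (Metric.ball 0 1))
    (hΦ : DifferentiableOn ℂ Φ (Metric.ball 0 1))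
    (h : ∀ᶠ z in 𝓝 0, hypSeries as bs z = Φ (discCoord z)) {z : ℂ} (hz : z ≠ 1) :
    hypCont as bs z = Φ (discCoord z) := by
  set U : Set ℂ := {z : ℂ | 1 - z ∈ Complex.slitPlane} with hU
  have hUo : IsOpen U := Complex.isOpen_slitPlane.preimage (by fun_prop : Continuous fun z : ℂ => 1 - z)
  have hUc : IsPreconnected U := by
    have h1 := Complex.starConvex_one_slitPlane.isPathConnected (Or.inl (by simp))
    have h2 := h1.isConnected.isPreconnected.image (fun z : ℂ => 1 - z) (by fun_prop)
    convert h2 using 1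
    ext z
    simp only [hU, Set.mem_ofPred_eq, Set.mem_image]
    exact ⟨fun h => ⟨1 - z, h, by ring⟩, fun ⟨y, hy, hyz⟩ => by rw [← hyz]; simpa using hy⟩
  have hball : Metric.ball (0 : ℂ) 1 ⊆ U := fun z hz => by
    refine Or.inl ?_
    have := (Complex.re_le_norm z).trans_lt (by simpa using hz)
    simpa using this
  have h0 : (0 : ℂ) ∈ U := hball (by simp)
  set g : ℂ → ℂ := fun z => Φ (discCoord z) with hg
  have hgU : DifferentiableOn ℂ g U := fun z hz =>
    ((hΦ.differentiableAt (Metric.isOpen_ball.mem_nhds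
      (discCoord_mem (slitPlane_ne_one hz)))).comp z
      (hasDerivAt_discCoord hz).differentiableAt).differentiableWithinAt
  have hgs : ∀ z : ℂ, ‖z‖ < 1 → g z = hypSeries as bs z := by
    intro z hz
    exact (AnalyticOnNhd.eqOn_of_preconnected_of_eventuallyEq
      (has.analyticOnNhd Metric.isOpen_ball)
      ((hgU.mono hball).analyticOnNhd Metric.isOpen_ball)
      (convex_ball (0 : ℂ) 1).isPreconnected (by simp) h (by simpa using hz)).symm
  have hglim : ∀ x : ℝ, 1 < x →
      Tendsto (fun ε : ℝ => g ((x : ℂ) - (ε : ℂ) * Complex.I)) (𝓝[>] 0) (𝓝 (g x)) := by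
    intro x hx
    have h1 := hΦ.continuousOn.continuousAt (Metric.isOpen_ball.mem_nhds
      (discCoord_mem (z := x) (by exact_mod_cast hx.ne')))
    exact h1.tendsto.comp (tendsto_discCoord_below hx)
  have hgc : IsHypContinuation as bs g := ⟨hgU, hgs, hglim⟩
  obtain ⟨h1, h2, h3⟩ : IsHypContinuation as bs (hypCont as bs) := Classical.epsilon_spec ⟨g, hgc⟩
  have heq : Set.EqOn (hypCont as bs) g U := by
    refine AnalyticOnNhd.eqOn_of_preconnected_of_eventuallyEq (h1.analyticOnNhd hUo)
      (hgU.analyticOnNhd hUo) hUc h0 ?_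
    filter_upwards [Metric.ball_mem_nhds (0 : ℂ) one_pos] with z hz
    have hz' : ‖z‖ < 1 := by simpa using hz
    rw [h2 z hz', hgs z hz']
  by_cases hzU : z ∈ U
  · exact heq hzU
  -- Off the slit domain only the ray `[1, ∞)` is left, and its endpoint is excluded by `hz`.
  · have hz2 : z.im = 0 ∧ 1 < z.re := by
      have h4 : ¬(0 < (1 - z).re ∨ (1 - z).im ≠ 0) := hzU
      rw [not_or, not_lt, not_not] at h4
      have h5 : z.im = 0 := by simpa using h4.2
      have h6 : 1 ≤ z.re := by simpa using h4.1
      refine ⟨h5, lt_of_le_of_ne h6 fun h7 => hz (Complex.ext h7.symm (by simpa using h5))⟩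
    obtain ⟨x, rfl⟩ : ∃ x : ℝ, (x : ℂ) = z := ⟨z.re, Complex.ext rfl (by simpa using hz2.1.symm)⟩
    have hx : 1 < x := by simpa using hz2.2
    refine tendsto_nhds_unique (h3 x hx) ((hglim x hx).congr' ?_)
    filter_upwards [self_mem_nhdsWithin] with ε hε
    refine (heq (Or.inr ?_)).symm
    simpa using (Set.mem_Ioi.1 hε).ne'

theorem continuesTo_hypCont {as bs : List ℂ}
    (has : DifferentiableOn ℂ (hypSeries as bs) (Metric.ball 0 1)) {f : ℝ → ℂ}
    (hf : ContinuesTo (hypSeries as bs) f) :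
    ContinuesTo (hypSeries as bs) (fun x => hypCont as bs x) := by
  obtain ⟨Φ, hΦ, h1, -⟩ := hf
  exact ⟨Φ, hΦ, h1, fun x hx => hypCont_eq_comp_discCoord has hΦ h1 (by exact_mod_cast hx)⟩

/-! ### Differential operators acting on power series. -/

theorem CoeffBounded.deriv_powSum {u : ℕ → ℂ} {R : ℝ} (hu : CoeffBounded u R) {z : ℂ}
    (hz : ‖z‖ < R) : deriv (powSum u) z = powSum (fun n => (n + 1) * u (n + 1)) z :=
  (hu.hasDerivAt hz).deriv

theorem CoeffBounded.deriv_deriv_powSum {u : ℕ → ℂ} {R : ℝ} (hu : CoeffBounded u R) {z : ℂ}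
    (hz : ‖z‖ < R) : deriv (deriv (powSum u)) z =
      powSum (fun n => (n + 1) * ((n + 1 + 1) * u (n + 1 + 1))) z := by
  have h : deriv (powSum u) =ᶠ[𝓝 z] powSum (fun n => (n + 1) * u (n + 1)) := by
    filter_upwards [Metric.isOpen_ball.mem_nhds (by simpa using hz : z ∈ Metric.ball 0 R)]
      with y hy using hu.deriv_powSum (by simpa using hy)
  rw [h.deriv_eq, hu.deriv_coeff.deriv_powSum hz]
  push_cast
  rfl

theorem CoeffBounded.analyticAt {u : ℕ → ℂ} {R : ℝ} (hu : CoeffBounded u R) {z : ℂ}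
    (hz : ‖z‖ < R) : AnalyticAt ℂ (powSum u) z :=
  hu.differentiableOn.analyticAt (Metric.isOpen_ball.mem_nhds (by simpa using hz))

theorem CoeffBounded.mul_deriv_powSum {u : ℕ → ℂ} {R : ℝ} (hu : CoeffBounded u R) {z : ℂ}
    (hz : ‖z‖ < R) : z * deriv (powSum u) z = powSum (fun n => n * u n) z := by
  rw [hu.deriv_powSum hz, hu.hasSum_mul_deriv hz]

theorem CoeffBounded.mul_deriv_deriv_powSum {u : ℕ → ℂ} {R : ℝ} (hu : CoeffBounded u R) {z : ℂ}
    (hz : ‖z‖ < R) : z * deriv (deriv (powSum u)) z =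
      powSum (fun n => n * ((n + 1) * u (n + 1))) z := by
  rw [hu.deriv_deriv_powSum hz, ← hu.deriv_coeff.hasSum_mul_deriv hz]
  push_cast
  rfl

theorem CoeffBounded.sq_mul_deriv_deriv_powSum {u : ℕ → ℂ} {R : ℝ} (hu : CoeffBounded u R) {z : ℂ}
    (hz : ‖z‖ < R) : z ^ 2 * deriv (deriv (powSum u)) z =
      powSum (fun n => n * ((n - 1) * u n)) z := by
  have h1 : CoeffBounded (fun n => ((n : ℂ) - 1) * u n) R := by
    intro r hr hrR
    obtain ⟨C, hC⟩ := hu.natCast_mul r hr hrR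
    obtain ⟨D, hD⟩ := hu r hr hrR
    refine ⟨C + D, fun n => ?_⟩
    calc ‖((n : ℂ) - 1) * u n‖ * r ^ n ≤ (‖(n : ℂ) * u n‖ + ‖u n‖) * r ^ n := by
          gcongr
          rw [sub_mul, one_mul]
          exact norm_sub_le _ _
      _ ≤ C + D := by rw [add_mul]; exact add_le_add (hC n) (hD n)
  rw [sq, mul_assoc, hu.mul_deriv_deriv_powSum hz, ← h1.hasSum_mul_deriv hz]
  congr 2
  funext n
  push_cast
  ring

/-! ### Gauss' hypergeometric series -/

/-- The coefficients of Gauss' hypergeometric series. -/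
noncomputable def gaussCoeff (a b c : ℂ) (n : ℕ) : ℂ :=
  rising a n * rising b n / (rising c n * n !)

theorem hypSeries_two_one (a b c : ℂ) : hypSeries [a, b] [c] = powSum (gaussCoeff a b c) := by
  funext z
  simp [hypSeries, powSum, gaussCoeff]

theorem coeffBounded_gauss (a b c : ℂ) : CoeffBounded (gaussCoeff a b c) 1 := by
  have h := (coeffBounded_rising_div a c).mul (coeffBounded_rising_div b 1)
  simp only [rising_one, div_mul_div_comm] at h
  exact h

theorem gaussCoeff_succ {c : ℂ} (hc : NotNonposInt c) (a b : ℂ) (n : ℕ) :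
    (c + n) * ((n + 1) * gaussCoeff a b c (n + 1)) = (a + n) * (b + n) * gaussCoeff a b c n := by
  have h1 : c + n ≠ 0 := fun h => hc n (eq_neg_of_add_eq_zero_left h)
  have h2 : rising c n ≠ 0 := rising_ne_zero hc n
  have h3 : (n ! : ℂ) ≠ 0 := by exact_mod_cast n.factorial_ne_zero
  have h4 : (n + 1 : ℂ) ≠ 0 := by exact_mod_cast n.succ_ne_zero
  simp only [gaussCoeff, rising_succ, Nat.factorial_succ]
  push_cast
  field_simp

/-- Coefficient by coefficient, the equation is the two-term recursion `gaussCoeff_succ`. -/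
theorem gauss_ode {c : ℂ} (hc : NotNonposInt c) (a b : ℂ) {z : ℂ} (hz : ‖z‖ < 1) :
    z * (1 - z) * deriv (deriv (hypSeries [a, b] [c])) z +
      (c - (a + b + 1) * z) * deriv (hypSeries [a, b] [c]) z - a * b * hypSeries [a, b] [c] z = 0 := by
  rw [hypSeries_two_one]
  have hu := coeffBounded_gauss a b c
  set u := gaussCoeff a b c with hu_def
  have e1 := hu.mul_deriv_deriv_powSum hz
  have e2 := hu.sq_mul_deriv_deriv_powSum hz
  have e3 := hu.deriv_powSum hz
  have e4 := hu.mul_deriv_powSum hz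
  have s1 := (hu.deriv_coeff.natCast_mul).hasSum hz
  have s3 := hu.deriv_coeff.hasSum hz
  have s4 := hu.natCast_mul.hasSum hz
  have s5 := hu.hasSum hz
  have s2 : HasSum (fun n : ℕ => (n : ℂ) * ((n - 1) * u n) * z ^ n)
      (powSum (fun n => n * ((n - 1) * u n)) z) := by
    have h := (hu.natCast_mul.natCast_mul.hasSum hz).sub s4
    have e : (fun n : ℕ => (n : ℂ) * (n * u n) * z ^ n - n * u n * z ^ n) =
      fun n : ℕ => (n : ℂ) * ((n - 1) * u n) * z ^ n := funext fun n => by ring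
    rw [e] at h
    exact h.summable.hasSum
  have key := ((((s1.sub s2).add (s3.mul_left c)).sub (s4.mul_left (a + b + 1))).sub
    (s5.mul_left (a * b)))
  have hz0 : ∀ n : ℕ, (n : ℂ) * ((n + 1) * u (n + 1)) * z ^ n - n * ((n - 1) * u n) * z ^ n +
      c * ((n + 1) * u (n + 1) * z ^ n) - (a + b + 1) * (n * u n * z ^ n) -
      a * b * (u n * z ^ n) = 0 := fun n => by
    linear_combination z ^ n * gaussCoeff_succ hc a b n
  simp only [hz0] at key
  have h0 := key.unique hasSum_zero
  rw [← e1, ← e2, ← e3, ← e4] at h0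
  linear_combination h0

theorem gaussCoeff_add_one (a b c : ℂ) (n : ℕ) :
    a * gaussCoeff (a + 1) b c n = n * gaussCoeff a b c n + a * gaussCoeff a b c n := by
  have h := rising_add_one a n
  simp only [gaussCoeff, div_eq_mul_inv]
  linear_combination rising b n * (rising c n * (n ! : ℂ))⁻¹ * h

/-- On the coefficient of `z ^ n` the operator `z d/dz + a` is multiplication by `n + a`, and `(a +
n) (a)ₙ = a (a + 1)ₙ`. It provides the antiderivative of `z ^ (a - 1)` times a Gauss function with
parameter `a + 1`. -/
theorem gauss_raise (a b c : ℂ) {z : ℂ} (hz : ‖z‖ < 1) :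
    z * deriv (hypSeries [a, b] [c]) z + a * hypSeries [a, b] [c] z =
      a * hypSeries [a + 1, b] [c] z := by
  have hu := coeffBounded_gauss a b c
  rw [hypSeries_two_one, hypSeries_two_one, hu.mul_deriv_powSum hz, ← powSum_const_mul,
    ← powSum_const_mul, ← hu.natCast_mul.powSum_add (hu.const_mul a) hz]
  simp only [gaussCoeff_add_one]

theorem hypSeries_three_two (a b c d e : ℂ) : hypSeries [a, b, c] [d, e] =
    powSum (fun n => gaussCoeff a b d n * (rising c n / rising e n)) := by
  funext z
  simp only [hypSeries, powSum, gaussCoeff]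
  refine tsum_congr fun n => ?_
  simp only [List.map_cons, List.map_nil, List.prod_cons, List.prod_nil, mul_one, div_mul_div_comm]
  congr 2 <;> ring

theorem coeffBounded_three_two (a b c d e : ℂ) :
    CoeffBounded (fun n => gaussCoeff a b d n * (rising c n / rising e n)) 1 :=
  (coeffBounded_gauss a b d).mul (coeffBounded_rising_div c e)

/-- The extra pair of parameters multiplies the coefficients by `(s)ₙ / (s + 1)ₙ = s / (s + n)`,
which is what integration against `z ^ (s - 1)` does. -/
theorem gauss_integral {s : ℂ} (hs : NotNonposInt s) (a b c : ℂ) {z : ℂ} (hz : ‖z‖ < 1) :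
    z * deriv (hypSeries [a, b, s] [c, s + 1]) z + s * hypSeries [a, b, s] [c, s + 1] z =
      s * hypSeries [a, b] [c] z := by
  have hu := coeffBounded_three_two a b s c (s + 1)
  rw [hypSeries_three_two, hypSeries_two_one,
    hu.mul_deriv_powSum hz, ← powSum_const_mul, ← powSum_const_mul,
    ← hu.natCast_mul.powSum_add (hu.const_mul s) hz]
  congr 1
  funext n
  have h1 : rising (s + 1) n ≠ 0 := by
    refine rising_ne_zero (fun k hk => hs (k + 1) ?_) n
    push_cast
    linear_combination hk
  have h := rising_add_one s n
  field_simp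
  linear_combination -gaussCoeff a b c n * h

/-- Germs that satisfy the hypergeometric equation, and their integrals, continue. -/
theorem exists_continuesTo_of_gauss_ode {F G : ℂ → ℂ} {a b c s : ℂ} (hF : AnalyticAt ℂ F 0)
    (hG : AnalyticAt ℂ G 0)
    (hode : ∀ᶠ z in 𝓝 0, z * (1 - z) * deriv (deriv F) z + (c - (a + b + 1) * z) * deriv F z -
      a * b * F z = 0)
    (hint : ∀ᶠ z in 𝓝 0, z * deriv G z + s * G z = s * F z) :
    (∃ f, ContinuesTo F f) ∧ ∃ g, ContinuesTo G g := by
  -- `h` is `w` times the logarithmic derivative of `discMap`, and `k` is `1 / (1 - discMap)`. Both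
  -- are holomorphic in the whole disc: the factors `w` cancel, and `discMap` omits the value `1`.
  set h : ℂ → ℂ := fun w => (1 - w) ^ 3 / ((1 + w) * (1 + w ^ 2)) with hh
  set k : ℂ → ℂ := fun w => ((1 + w) / (1 - w)) ^ 4 with hk
  have hhd : DifferentiableOn ℂ h (Metric.ball 0 1) := fun w hw => by
    have h1 : DifferentiableAt ℂ (fun w : ℂ => (1 - w) ^ 3) w := by fun_prop
    have h2 : DifferentiableAt ℂ (fun w : ℂ => (1 + w) * (1 + w ^ 2)) w := by fun_prop
    exact (h1.fun_div h2 (mul_ne_zero (one_add_ne_zero_of_mem_ball hw)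
      (one_add_sq_ne_zero_of_mem_ball hw))).differentiableWithinAt
  have hkd : DifferentiableOn ℂ k (Metric.ball 0 1) := fun w hw =>
    ((DifferentiableAt.fun_div (by fun_prop) (by fun_prop)
      (one_sub_ne_zero_of_mem_ball hw)).pow 4).differentiableWithinAt
  have hmul : ∀ w ∈ Metric.ball (0 : ℂ) 1, w * discMapDeriv w = h w * discMap w := by
    intro w hw
    have h1 := one_add_ne_zero_of_mem_ball hw
    have h2 := one_add_sq_ne_zero_of_mem_ball hw
    simp only [discMapDeriv, discMap, hh]
    field_simp
    ring
  have hkm : ∀ w ∈ Metric.ball (0 : ℂ) 1, k w * (1 - discMap w) = 1 := by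
    intro w hw
    have h1 := one_add_ne_zero_of_mem_ball hw
    have h2 := one_sub_ne_zero_of_mem_ball hw
    simp only [discMap, hk]
    field_simp
    ring
  have hmap : DifferentiableOn ℂ discMap (Metric.ball 0 1) := differentiableOn_discMap
  have hball : Metric.ball (0 : ℂ) 1 ∈ 𝓝 0 := Metric.ball_mem_nhds 0 one_pos
  have hmapan : AnalyticAt ℂ discMap 0 := hmap.analyticAt hball
  have hmapt : Tendsto discMap (𝓝 0) (𝓝 0) := by
    have := hmapan.continuousAt.tendsto
    rwa [discMap_zero] at this
  have hcomp : ∀ {H : ℂ → ℂ}, AnalyticAt ℂ H 0 → AnalyticAt ℂ (fun w => H (discMap w)) 0 :=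
    fun {H} hH => AnalyticAt.fun_comp (by rwa [discMap_zero]) hmapan
  have hderiv : ∀ {H : ℂ → ℂ}, AnalyticAt ℂ H 0 → ∀ᶠ w in 𝓝 0,
      w * deriv (fun w => H (discMap w)) w = h w * (discMap w * deriv H (discMap w)) := by
    intro H hH
    filter_upwards [hball, hmapt.eventually hH.eventually_analyticAt] with w hw hw1
    have h1 := hw1.differentiableAt.hasDerivAt.comp w (hasDerivAt_discMap hw)
    rw [show (fun w => H (discMap w)) = H ∘ discMap from rfl, h1.deriv]
    linear_combination deriv H (discMap w) * hmul w hw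
  -- With `T = z F'` the second order equation becomes a first order system in Euler form `w Y' = A
  -- Y`; the integral `G` is its third component.
  set T : ℂ → ℂ := fun z => z * deriv F z with hT
  have hTan : AnalyticAt ℂ T 0 := analyticAt_id.fun_mul hF.deriv
  set Y : Fin 3 → ℂ → ℂ := ![fun w => F (discMap w), fun w => T (discMap w),
    fun w => G (discMap w)] with hY
  set A : Fin 3 → Fin 3 → ℂ → ℂ := ![![fun _ => 0, h, fun _ => 0],
    ![fun w => h w * k w * (a * b * discMap w),
      fun w => h w * k w * ((a + b) * discMap w - (c - 1)), fun _ => 0],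
    ![fun w => s * h w, fun _ => 0, fun w => -(s * h w)]] with hA
  have hYan : ∀ i, AnalyticAt ℂ (Y i) 0 := by
    intro i
    fin_cases i
    · exact hcomp hF
    · exact hcomp hTan
    · exact hcomp hG
  have hAd : ∀ i j, DifferentiableOn ℂ (A i j) (Metric.ball 0 1) := by
    have hd0 : DifferentiableOn ℂ (fun _ : ℂ => (0 : ℂ)) (Metric.ball 0 1) :=
      differentiableOn_const 0
    have hd1 : DifferentiableOn ℂ (fun w => h w * k w * (a * b * discMap w))
      (Metric.ball 0 1) := by fun_prop
    have hd2 : DifferentiableOn ℂ (fun w => h w * k w * ((a + b) * discMap w - (c - 1)))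
      (Metric.ball 0 1) := by fun_prop
    have hd3 : DifferentiableOn ℂ (fun w => s * h w) (Metric.ball 0 1) := by fun_prop
    have hd4 : DifferentiableOn ℂ (fun w => -(s * h w)) (Metric.ball 0 1) := by fun_prop
    intro i j
    fin_cases i <;> fin_cases j
    exacts [hd0, hhd, hd0, hd1, hd2, hd0, hd3, hd0, hd4]
  have hTd : ∀ᶠ z in 𝓝 0, (1 - z) * deriv T z =
      a * b * F z + ((a + b) * z - (c - 1)) * deriv F z := by
    filter_upwards [hode, hF.eventually_analyticAt] with z hz hz1
    have h1 : HasDerivAt T (1 * deriv F z + z * deriv (deriv F) z) z :=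
      (hasDerivAt_id z).mul hz1.deriv.differentiableAt.hasDerivAt
    rw [h1.deriv]
    linear_combination hz
  have hsys : ∀ i, ∀ᶠ w in 𝓝 0, w * deriv (Y i) w = ∑ j, A i j w * Y j w := by
    intro i
    fin_cases i
    · filter_upwards [hderiv hF] with w hw
      rw [Fin.sum_univ_three]
      change w * deriv (fun w => F (discMap w)) w =
        0 * F (discMap w) + h w * T (discMap w) + 0 * G (discMap w)
      rw [hw]
      simp only [hT]
      ring
    · filter_upwards [hderiv hTan, hball, hmapt.eventually hTd] with w hw hw1 hw2
      rw [Fin.sum_univ_three]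
      change w * deriv (fun w => T (discMap w)) w =
        h w * k w * (a * b * discMap w) * F (discMap w) +
          h w * k w * ((a + b) * discMap w - (c - 1)) * T (discMap w) + 0 * G (discMap w)
      rw [hw]
      have hTe : T (discMap w) = discMap w * deriv F (discMap w) := rfl
      rw [hTe]
      have h3 := hkm w hw1
      linear_combination -(h w * discMap w * deriv T (discMap w)) * h3 +
        h w * k w * discMap w * hw2
    · filter_upwards [hderiv hG, hmapt.eventually hint] with w hw hw2
      rw [Fin.sum_univ_three]
      change w * deriv (fun w => G (discMap w)) w =
        s * h w * F (discMap w) + 0 * T (discMap w) + -(s * h w) * G (discMap w)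
      rw [hw]
      linear_combination h w * hw2
  have hres : ∀ (i : Fin 3) (H : ℂ → ℂ), Y i = (fun w => H (discMap w)) →
      ∃ f, ContinuesTo H f := by
    intro i H hi
    -- The Taylor series in `w` converges in the whole unit disc and serves as the representative
    -- `Φ`.
    have hb := coeffBounded_of_regular_singular hAd hYan hsys i
    refine ⟨fun x => powSum (taylorCoeff (Y i)) (discCoord x), powSum (taylorCoeff (Y i)),
      hb.differentiableOn, ?_, fun x _ => rfl⟩
    have h1 := (hYan i).eventually_eq_powSum
    have h2 : Tendsto discCoord (𝓝 0) (𝓝 0) := by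
      have := continuousAt_discCoord_zero.tendsto
      rwa [discCoord_zero] at this
    filter_upwards [h2.eventually h1, eventually_one_sub_mem_slitPlane] with z hz hz1
    rw [← hz, hi]
    dsimp
    rw [discMap_discCoord (slitPlane_ne_one hz1)]
  exact ⟨hres 0 F rfl, hres 2 G rfl⟩

theorem analyticAt_gauss (a b c : ℂ) : AnalyticAt ℂ (hypSeries [a, b] [c]) 0 := by
  rw [hypSeries_two_one]
  exact (coeffBounded_gauss a b c).analyticAt (by simp)

theorem eventually_norm_lt_one : ∀ᶠ z : ℂ in 𝓝 0, ‖z‖ < 1 := by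
  filter_upwards [Metric.ball_mem_nhds (0 : ℂ) one_pos] with z hz using by simpa using hz

theorem continuesTo_hyp2F1 {c : ℂ} (hc : NotNonposInt c) (a b : ℂ) :
    ContinuesTo (hypSeries [a, b] [c]) (fun x => hyp2F1 a b c x) := by
  -- The integral component plays no role here; zero with `s = 0` fills its place.
  obtain ⟨⟨f, hf⟩, -⟩ := exists_continuesTo_of_gauss_ode (G := fun _ => 0) (a := a) (b := b) (c := c)
    (s := 0) (analyticAt_gauss a b c) analyticAt_const
    (eventually_norm_lt_one.mono fun z hz => gauss_ode hc a b hz) (by simp)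
  refine continuesTo_hypCont ?_ hf
  rw [hypSeries_two_one]
  exact (coeffBounded_gauss a b c).differentiableOn

theorem continuesTo_hyp3F2 {c s : ℂ} (hc : NotNonposInt c) (hs : NotNonposInt s) (a b : ℂ) :
    ContinuesTo (hypSeries [a, b, s] [c, s + 1]) (fun x => hyp3F2 a b s c (s + 1) x) := by
  have hu := coeffBounded_three_two a b s c (s + 1)
  obtain ⟨-, g, hg⟩ := exists_continuesTo_of_gauss_ode (G := hypSeries [a, b, s] [c, s + 1])
    (a := a) (b := b) (c := c)
    (s := s) (analyticAt_gauss a b c) (by rw [hypSeries_three_two]; exact hu.analyticAt (by simp))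
    (eventually_norm_lt_one.mono fun z hz => gauss_ode hc a b hz)
    (eventually_norm_lt_one.mono fun z hz => gauss_integral hs a b c hz)
  refine continuesTo_hypCont ?_ hg
  rw [hypSeries_three_two]
  exact hu.differentiableOn

/-- Euler's transformation, near the origin. -/
theorem eventually_gauss_euler {c : ℂ} (hc : NotNonposInt c) (a b : ℂ) :
    ∀ᶠ z in 𝓝 0, (1 - z) ^ (a + b - c) * hypSeries [a, b] [c] z =
      hypSeries [c - a, c - b] [c] z := by
  set s : ℂ := a + b - c with hs
  set F := hypSeries [a, b] [c] with hF
  set E := hypSeries [c - a, c - b] [c] with hE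
  have hFan : AnalyticAt ℂ F 0 := analyticAt_gauss a b c
  have hEan : AnalyticAt ℂ E 0 := analyticAt_gauss (c - a) (c - b) c
  set P : ℂ → ℂ := fun z => (1 - z) ^ s with hP
  have hPd : ∀ z : ℂ, 1 - z ∈ Complex.slitPlane → HasDerivAt P (-(s * P z / (1 - z))) z := by
    intro z hz
    have hz0 : 1 - z ≠ 0 := Complex.slitPlane_ne_zero hz
    refine (((hasDerivAt_id z).const_sub 1).cpow_const (c := s) hz).congr_deriv ?_
    simp only [hP, id, Complex.cpow_sub _ _ hz0, Complex.cpow_one]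
    ring
  have hPan : AnalyticAt ℂ P 0 :=
    (analyticAt_const.fun_sub analyticAt_id).cpow analyticAt_const (by simp)
  have hPFan : AnalyticAt ℂ (fun z => P z * F z) 0 := hPan.fun_mul hFan
  have hyan : AnalyticAt ℂ (fun z => P z * F z - E z) 0 := hPFan.fun_sub hEan
  have h1z : AnalyticAt ℂ (fun z : ℂ => 1 - z) 0 := analyticAt_const.fun_sub analyticAt_id
  have hG' : ∀ᶠ z in 𝓝 0, deriv (fun z => P z * F z) z =
      P z * (deriv F z - s * F z / (1 - z)) := by
    filter_upwards [hFan.eventually_analyticAt, eventually_one_sub_mem_slitPlane] with z h1 h2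
    rw [((hPd z h2).fun_mul h1.differentiableAt.hasDerivAt).deriv]
    ring
  have hG'' : ∀ᶠ z in 𝓝 0, deriv (deriv (fun z => P z * F z)) z =
      P z * (deriv (deriv F) z - 2 * s * deriv F z / (1 - z) + s * (s - 1) * F z / (1 - z) ^ 2) := by
    filter_upwards [hFan.eventually_analyticAt, eventually_one_sub_mem_slitPlane,
      hG'.eventually_nhds] with z h1 h2 h3
    have hz0 : 1 - z ≠ 0 := Complex.slitPlane_ne_zero h2
    rw [Filter.EventuallyEq.deriv_eq h3]
    have h4 : HasDerivAt (fun z : ℂ => 1 - z) (-1) z := (hasDerivAt_id z).const_sub 1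
    have h5 := (hPd z h2).fun_mul (h1.deriv.differentiableAt.hasDerivAt.fun_sub
      ((h1.differentiableAt.hasDerivAt.const_mul s).fun_div h4 hz0))
    rw [h5.deriv]
    field_simp
    ring
  -- Both functions solve Gauss' equation with parameters `c - a`, `c - b` and have value `1` at the
  -- origin. After division by `1 - z`, the uniqueness lemma applies to the difference with `p 0 =
  -- c`.
  have key : ∀ᶠ z in 𝓝 0, P z * F z - E z = 0 := by
    refine eventually_eq_zero_of_regular_singular (y := fun z => P z * F z - E z)
      (p := fun z => (c - (c - s + 1) * z) / (1 - z))
      (q := fun z => -((c - a) * (c - b)) / (1 - z)) hyan ?_ ?_ ?_ (by simpa using hc) ?_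
    · exact AnalyticAt.fun_div (by fun_prop) h1z (by simp)
    · exact AnalyticAt.fun_div (by fun_prop) h1z (by simp)
    · have hy' : ∀ᶠ z in 𝓝 0, deriv (fun z => P z * F z - E z) z =
          deriv (fun z => P z * F z) z - deriv E z := by
        filter_upwards [hPFan.eventually_analyticAt, hEan.eventually_analyticAt] with z h1 h2
        exact deriv_fun_sub h1.differentiableAt h2.differentiableAt
      have hy'' : ∀ᶠ z in 𝓝 0, deriv (deriv (fun z => P z * F z - E z)) z =
          deriv (deriv (fun z => P z * F z)) z - deriv (deriv E) z := by
        filter_upwards [hPFan.eventually_analyticAt, hEan.eventually_analyticAt,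
          hy'.eventually_nhds] with z h1 h2 h3
        rw [Filter.EventuallyEq.deriv_eq h3]
        exact deriv_fun_sub h1.deriv.differentiableAt h2.deriv.differentiableAt
      filter_upwards [hy', hy'', hG', hG'', eventually_norm_lt_one,
        eventually_one_sub_mem_slitPlane] with z h1 h2 h3 h4 h5 h6
      have hz0 : 1 - z ≠ 0 := Complex.slitPlane_ne_zero h6
      have o1 := gauss_ode hc a b h5
      have o2 := gauss_ode hc (c - a) (c - b) h5
      rw [← hF] at o1
      rw [← hE] at o2
      rw [h1, h2, h3, h4]
      have hab : a + b = c + s := by rw [hs]; ring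
      have hb : b = c + s - a := by rw [← hab]; ring
      rw [hb] at o1 o2 ⊢
      field_simp
      linear_combination P z * (1 - z) * o1 - (1 - z) * o2
    · simp only [hP, hF, hE, hypSeries_two_one, powSum_zero]
      simp [gaussCoeff, rising_zero]
  filter_upwards [key] with z hz using sub_eq_zero.1 hz

/-- The Wronskian of the two hypergeometric solutions at the origin. -/
theorem eventually_gauss_wronskian {c : ℂ} (hc : NotNonposInt c) (hc' : NotNonposInt (2 - c))
    (a b : ℂ) : ∀ᶠ z in 𝓝 0,
      hypSeries [a, b] [c] z * ((1 - c) * hypSeries [a - c + 1, b - c + 1] [2 - c] z +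
        z * deriv (hypSeries [a - c + 1, b - c + 1] [2 - c]) z) -
      z * hypSeries [a - c + 1, b - c + 1] [2 - c] z * deriv (hypSeries [a, b] [c]) z =
      (1 - c) * (1 - z) ^ (c - (a + b + 1)) := by
  set F := hypSeries [a, b] [c] with hF
  set E := hypSeries [a - c + 1, b - c + 1] [2 - c] with hE
  set s : ℂ := c - (a + b + 1) with hs
  have hb : Metric.ball (0 : ℂ) 1 ∈ 𝓝 0 := Metric.ball_mem_nhds 0 one_pos
  have hFan : ∀ z ∈ Metric.ball (0 : ℂ) 1, AnalyticAt ℂ F z := fun z hz => by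
    rw [hF, hypSeries_two_one]
    exact (coeffBounded_gauss a b c).analyticAt (by simpa using hz)
  have hEan : ∀ z ∈ Metric.ball (0 : ℂ) 1, AnalyticAt ℂ E z := fun z hz => by
    rw [hE, hypSeries_two_one]
    exact (coeffBounded_gauss _ _ _).analyticAt (by simpa using hz)
  -- The bracket is the Wronskian of `F` and `z ^ (1 - c) E` without its factor `z ^ (-c)`. By
  -- Abel's formula, division by `(1 - z) ^ s` makes it constant.
  set Q : ℂ → ℂ := fun z => (1 - z) ^ (-s) *
    (F z * ((1 - c) * E z + z * deriv E z) - z * E z * deriv F z) with hQ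
  have hQd : ∀ z ∈ Metric.ball (0 : ℂ) 1, HasDerivAt Q 0 z := by
    intro z hz
    have hz1 : ‖z‖ < 1 := by simpa using hz
    have hsl : 1 - z ∈ Complex.slitPlane :=
      Or.inl (by simpa using (Complex.re_le_norm z).trans_lt hz1)
    have hz0 : 1 - z ≠ 0 := Complex.slitPlane_ne_zero hsl
    have hP := ((hasDerivAt_id z).const_sub 1).cpow_const (c := -s) hsl
    have f1 := (hFan z hz).differentiableAt.hasDerivAt
    have f2 := (hFan z hz).deriv.differentiableAt.hasDerivAt
    have e1 := (hEan z hz).differentiableAt.hasDerivAt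
    have e2 := (hEan z hz).deriv.differentiableAt.hasDerivAt
    have hid : HasDerivAt (fun z : ℂ => z) 1 z := hasDerivAt_id z
    refine (hP.fun_mul ((f1.fun_mul ((e1.const_mul (1 - c)).fun_add (hid.fun_mul e2))).fun_sub
      ((hid.fun_mul e1).fun_mul f2))).congr_deriv ?_
    have o1 := gauss_ode hc a b hz1
    have o2 := gauss_ode hc' (a - c + 1) (b - c + 1) hz1
    rw [← hF] at o1
    rw [← hE] at o2
    simp only [id, Complex.cpow_sub _ _ hz0, Complex.cpow_one]
    field_simp
    simp only [hs]
    linear_combination (1 - z) ^ (-(c - (a + b + 1))) * (F z * o2 - E z * o1)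
  have hconst : ∀ z ∈ Metric.ball (0 : ℂ) 1, Q z = Q 0 := by
    intro z hz
    exact Metric.isOpen_ball.is_const_of_deriv_eq_zero (convex_ball (0 : ℂ) 1).isPreconnected
      (fun z hz => (hQd z hz).differentiableAt.differentiableWithinAt)
      (fun z hz => (hQd z hz).deriv) hz (by simp)
  have hQ0 : Q 0 = 1 - c := by
    simp only [hQ, hF, hE, hypSeries_two_one, powSum_zero]
    simp [gaussCoeff, rising_zero]
  filter_upwards [hb, eventually_one_sub_mem_slitPlane] with z hz hz1
  have hz0 : 1 - z ≠ 0 := Complex.slitPlane_ne_zero hz1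
  have h1 := hconst z hz
  have h2 : (1 - z) ^ s * (1 - z) ^ (-s) = 1 := by
    rw [← Complex.cpow_add _ _ hz0, add_neg_cancel, Complex.cpow_zero]
  rw [hQ0] at h1
  simp only [hQ] at h1
  linear_combination (1 - z) ^ s * h1 + (-(F z * ((1 - c) * E z + z * deriv E z) - z * E z * deriv F z)) * h2

/-! ### Functions with two derivatives near a real point -/

/-- Near `x`, `f` has the derivative `f'` and `f'` has the derivative `f''`, which is continuous
at `x`. -/
def HasDeriv2At (f f' f'' : ℝ → ℂ) (x : ℝ) : Prop :=
  (∀ᶠ t in 𝓝 x, HasDerivAt f (f' t) t ∧ HasDerivAt f' (f'' t) t) ∧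
    ∀ᶠ t in 𝓝 x, ContinuousAt f'' t

namespace HasDeriv2At

variable {f f' f'' g g' g'' : ℝ → ℂ} {x : ℝ}

theorem hasDerivAt (h : HasDeriv2At f f' f'' x) : HasDerivAt f (f' x) x := h.1.self_of_nhds.1

theorem hasDerivAt_deriv (h : HasDeriv2At f f' f'' x) : HasDerivAt f' (f'' x) x :=
  h.1.self_of_nhds.2

theorem deriv_eq (h : HasDeriv2At f f' f'' x) : deriv f x = f' x := h.hasDerivAt.deriv

theorem deriv_eventuallyEq (h : HasDeriv2At f f' f'' x) : deriv f =ᶠ[𝓝 x] f' :=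
  h.1.mono fun _ ht => ht.1.deriv

theorem deriv_deriv_eq (h : HasDeriv2At f f' f'' x) : deriv (deriv f) x = f'' x := by
  rw [h.deriv_eventuallyEq.deriv_eq, h.hasDerivAt_deriv.deriv]

theorem contDiffAt (h : HasDeriv2At f f' f'' x) : ContDiffAt ℝ 2 f x := by
  obtain ⟨U, hU, hUo, hxU⟩ := eventually_nhds_iff.1 (h.1.and h.2)
  have h1 : ContDiffOn ℝ 0 f'' U :=
    contDiffOn_zero.2 fun t ht => (hU t ht).2.continuousWithinAt
  have h2 : ContDiffOn ℝ (0 + 1) f' U := by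
    refine (contDiffOn_succ_iff_deriv_of_isOpen hUo).2 ⟨fun t ht =>
      (hU t ht).1.2.differentiableAt.differentiableWithinAt, by simp, ?_⟩
    exact h1.congr fun t ht => (hU t ht).1.2.deriv
  have h3 : ContDiffOn ℝ (0 + 1 + 1) f U := by
    refine (contDiffOn_succ_iff_deriv_of_isOpen hUo).2 ⟨fun t ht =>
      (hU t ht).1.1.differentiableAt.differentiableWithinAt, by simp, ?_⟩
    exact h2.congr fun t ht => (hU t ht).1.1.deriv
  have h4 := h3.contDiffAt (hUo.mem_nhds hxU)
  norm_num at h4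
  exact h4

theorem congr (h : HasDeriv2At f f' f'' x) (hg : g =ᶠ[𝓝 x] f) : HasDeriv2At g f' f'' x := by
  refine ⟨?_, h.2⟩
  filter_upwards [h.1, hg.eventually_nhds] with t h1 h2
  exact ⟨h1.1.congr_of_eventuallyEq h2, h1.2⟩

theorem mul (hf : HasDeriv2At f f' f'' x) (hg : HasDeriv2At g g' g'' x) :
    HasDeriv2At (fun t => f t * g t) (fun t => f' t * g t + f t * g' t)
      (fun t => f'' t * g t + 2 * f' t * g' t + f t * g'' t) x := by
  refine ⟨?_, ?_⟩
  · filter_upwards [hf.1, hg.1] with t h1 h2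
    refine ⟨h1.1.fun_mul h2.1, ((h1.2.fun_mul h2.1).fun_add (h1.1.fun_mul h2.2)).congr_deriv ?_⟩
    ring
  · filter_upwards [hf.1, hg.1, hf.2, hg.2] with t h1 h2 h3 h4
    have a1 := h1.1.continuousAt
    have a2 := h1.2.continuousAt
    have b1 := h2.1.continuousAt
    have b2 := h2.2.continuousAt
    fun_prop

theorem const_mul (hf : HasDeriv2At f f' f'' x) (a : ℂ) :
    HasDeriv2At (fun t => a * f t) (fun t => a * f' t) (fun t => a * f'' t) x := by
  refine ⟨?_, ?_⟩
  · filter_upwards [hf.1] with t h1 using ⟨h1.1.const_mul a, h1.2.const_mul a⟩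
  · filter_upwards [hf.2] with t h1 using continuousAt_const.mul h1

theorem add (hf : HasDeriv2At f f' f'' x) (hg : HasDeriv2At g g' g'' x) :
    HasDeriv2At (fun t => f t + g t) (fun t => f' t + g' t) (fun t => f'' t + g'' t) x := by
  refine ⟨?_, ?_⟩
  · filter_upwards [hf.1, hg.1] with t h1 h2 using ⟨h1.1.fun_add h2.1, h1.2.fun_add h2.2⟩
  · filter_upwards [hf.2, hg.2] with t h1 h2 using h1.add h2

theorem comp_affine {k l : ℝ} (hf : HasDeriv2At f f' f'' (k * x + l)) :
    HasDeriv2At (fun t => f (k * t + l)) (fun t => k * f' (k * t + l))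
      (fun t => (k : ℂ) ^ 2 * f'' (k * t + l)) x := by
  have hc : Continuous fun t : ℝ => k * t + l := by fun_prop
  have hd : ∀ t : ℝ, HasDerivAt (fun t : ℝ => k * t + l) k t := fun t => by
    simpa using ((hasDerivAt_id t).const_mul k).add_const l
  have key : ∀ {h : ℝ → ℂ} {h' : ℂ} {t : ℝ}, HasDerivAt h h' (k * t + l) →
      HasDerivAt (fun t => h (k * t + l)) (k * h') t := fun {h h' t} hh => by
    have h1 := HasDerivAt.scomp t hh (hd t)
    rw [Complex.real_smul] at h1
    exact h1
  have ht : Tendsto (fun t : ℝ => k * t + l) (𝓝 x) (𝓝 (k * x + l)) := hc.tendsto x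
  refine ⟨?_, ?_⟩
  · filter_upwards [ht.eventually hf.1] with t h
    refine ⟨key h.1, ((key h.2).const_mul (k : ℂ)).congr_deriv (by ring)⟩
  · filter_upwards [ht.eventually hf.2] with t h
    exact continuousAt_const.mul (ContinuousAt.comp' h hc.continuousAt)

end HasDeriv2At

theorem hasDerivAt_ofReal_cpow {x : ℝ} (hx : x ≠ 0) (r : ℂ) :
    HasDerivAt (fun t : ℝ => (t : ℂ) ^ r) (r * (x : ℂ) ^ (r - 1)) x := by
  by_cases hr : r = 0
  · simpa [hr] using hasDerivAt_const x (1 : ℂ)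
  · exact hasDerivAt_ofReal_cpow_const hx hr

theorem hasDeriv2At_ofReal_cpow {x : ℝ} (hx : x ≠ 0) (r : ℂ) :
    HasDeriv2At (fun t : ℝ => (t : ℂ) ^ r) (fun t : ℝ => r * (t : ℂ) ^ (r - 1))
      (fun t : ℝ => r * ((r - 1) * (t : ℂ) ^ (r - 1 - 1))) x := by
  refine ⟨?_, ?_⟩
  · filter_upwards [eventually_ne_nhds hx] with t ht
    exact ⟨hasDerivAt_ofReal_cpow ht r, (hasDerivAt_ofReal_cpow ht (r - 1)).const_mul r⟩
  · filter_upwards [eventually_ne_nhds hx] with t ht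
    exact ((hasDerivAt_ofReal_cpow ht (r - 1 - 1)).continuousAt.const_mul (r - 1)).const_mul r

/-- Variation of parameters. -/
theorem solvesAt_variation_of_parameters {y₁ y₁' y₁'' y₂ y₂' y₂'' g G₁ G₂ : ℝ → ℂ} {x : ℝ}
    {k₂ k₁ k₀ c : ℝ} (h₁ : HasDeriv2At y₁ y₁' y₁'' x) (h₂ : HasDeriv2At y₂ y₂' y₂'' x)
    (hG₁ : ∀ᶠ t in 𝓝 x, HasDerivAt G₁ (y₁ t * g t) t)
    (hG₂ : ∀ᶠ t in 𝓝 x, HasDerivAt G₂ (y₂ t * g t) t) (hg : ∀ᶠ t in 𝓝 x, ContinuousAt g t)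
    (o₁ : (k₂ : ℂ) * y₁'' x + k₁ * y₁' x + k₀ * y₁ x = 0)
    (o₂ : (k₂ : ℂ) * y₂'' x + k₁ * y₂' x + k₀ * y₂ x = 0)
    (hc : (k₂ : ℂ) * (g x * (y₁ x * y₂' x - y₂ x * y₁' x)) = -c) :
    SolvesAt k₂ k₁ k₀ c (fun t => y₁ t * G₂ t - y₂ t * G₁ t) x := by
  -- In the first derivative the contributions `y₁ (y₂ g)` and `-y₂ (y₁ g)` of the antiderivatives
  -- cancel; in the second they leave `-g` times the Wronskian.
  have key : HasDeriv2At (fun t => y₁ t * G₂ t - y₂ t * G₁ t) (fun t => y₁' t * G₂ t - y₂' t * G₁ t)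
      (fun t => y₁'' t * G₂ t - y₂'' t * G₁ t - g t * (y₁ t * y₂' t - y₂ t * y₁' t)) x := by
    refine ⟨?_, ?_⟩
    · filter_upwards [h₁.1, h₂.1, hG₁, hG₂] with t a b c d
      exact ⟨((a.1.fun_mul d).fun_sub (b.1.fun_mul c)).congr_deriv (by ring),
        ((a.2.fun_mul d).fun_sub (b.2.fun_mul c)).congr_deriv (by ring)⟩
    · filter_upwards [h₁.1, h₂.1, hG₁, hG₂, h₁.2, h₂.2, hg] with t a b c d e f hg
      have a1 := a.1.continuousAt
      have a2 := a.2.continuousAt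
      have b1 := b.1.continuousAt
      have b2 := b.2.continuousAt
      have c1 := c.continuousAt
      have d1 := d.continuousAt
      fun_prop
  refine ⟨key.contDiffAt, ?_⟩
  rw [key.deriv_deriv_eq, key.deriv_eq]
  linear_combination G₂ x * o₁ - G₁ x * o₂ - hc

/-- The antiderivative of `t ^ (s - 1) * g t` when `t f' + s f = s g`. -/
theorem hasDerivAt_cpow_mul {f : ℝ → ℂ} {f' g s : ℂ} {x : ℝ} (hx : x ≠ 0) (hs : s ≠ 0)
    (hf : HasDerivAt f f' x) (h : x * f' + s * f x = s * g) :
    HasDerivAt (fun t : ℝ => (t : ℂ) ^ s * (1 / s) * f t) ((x : ℂ) ^ (s - 1) * g) x := by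
  have hx' : (x : ℂ) ≠ 0 := by exact_mod_cast hx
  refine ((((hasDerivAt_ofReal_cpow hx s).mul_const (1 / s)).fun_mul hf)).congr_deriv ?_
  have h1 : (x : ℂ) ^ s = (x : ℂ) ^ (s - 1) * x := by
    rw [Complex.cpow_sub _ _ hx', Complex.cpow_one, div_mul_cancel₀ _ hx']
  rw [h1]
  field_simp
  linear_combination (x : ℂ) ^ (s - 1) * h

/-! ### The hypergeometric functions on the real line -/

theorem ContinuesTo.hasDerivAt {F : ℂ → ℂ} {f : ℝ → ℂ} (hF : ContinuesTo F f) {x : ℝ}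
    (hx : x ≠ 1) : HasDerivAt f (deriv f x) x := by
  obtain ⟨f', -, h⟩ := hF.exists_deriv
  exact (h x hx).differentiableAt.hasDerivAt

theorem ContinuesTo.deriv {F : ℂ → ℂ} {f : ℝ → ℂ} (hF : ContinuesTo F f) :
    ContinuesTo (deriv F) (deriv f) := by
  obtain ⟨f', ⟨Φ, h1, h2, h3⟩, h⟩ := hF.exists_deriv
  exact ⟨Φ, h1, h2, fun x hx => by rw [(h x hx).deriv, h3 x hx]⟩

theorem ContinuesTo.hasDeriv2At {F : ℂ → ℂ} {f : ℝ → ℂ} (hF : ContinuesTo F f) {x : ℝ}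
    (hx : x ≠ 1) : HasDeriv2At f (_root_.deriv f) (_root_.deriv (_root_.deriv f)) x := by
  refine ⟨?_, ?_⟩ <;> filter_upwards [eventually_ne_nhds hx] with t ht
  · exact ⟨hF.hasDerivAt ht, hF.deriv.hasDerivAt ht⟩
  · exact (hF.deriv.deriv.hasDerivAt ht).continuousAt

theorem ContinuesTo.eq_zero {F : ℂ → ℂ} {f : ℝ → ℂ} (hF : ContinuesTo F f)
    (h : ∀ᶠ z in 𝓝 0, F z = 0) {x : ℝ} (hx : x ≠ 1) : f x = 0 :=
  hF.eq (continuesTo_const 0) h hx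

/-- Valid for all parameters: the two series coincide, hence so do the predicates from which the
continuation is chosen. -/
theorem hyp2F1_comm (a b c z : ℂ) : hyp2F1 a b c z = hyp2F1 b a c z := by
  have h : hypSeries [a, b] [c] = hypSeries [b, a] [c] := by
    rw [hypSeries_two_one, hypSeries_two_one]
    congr 1
    funext n
    simp only [gaussCoeff, mul_comm]
  have h2 : IsHypContinuation [a, b] [c] = IsHypContinuation [b, a] [c] := by
    funext f
    simp only [IsHypContinuation, h]
  simp only [hyp2F1, hypCont, h2]

theorem hyp2F1_hasDeriv2At {c : ℂ} (hc : NotNonposInt c) {x : ℝ} (hx : x ≠ 1)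
    (a b : ℂ) : HasDeriv2At (fun t : ℝ => hyp2F1 a b c t)
    (deriv fun t : ℝ => hyp2F1 a b c t) (deriv (deriv fun t : ℝ => hyp2F1 a b c t)) x :=
  (continuesTo_hyp2F1 hc a b).hasDeriv2At hx

/-- Continuations are closed under products, sums and derivatives, so the left side continues a germ
that vanishes. -/
theorem hyp2F1_ode {c : ℂ} (hc : NotNonposInt c) {x : ℝ} (hx : x ≠ 1)
    (a b : ℂ) :
    (x : ℂ) * (1 - x) * deriv (deriv fun t : ℝ => hyp2F1 a b c t) x +
      (c - (a + b + 1) * x) * deriv (fun t : ℝ => hyp2F1 a b c t) x - a * b * hyp2F1 a b c x = 0 := by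
  have h := continuesTo_hyp2F1 hc a b
  exact (((((continuesTo_id.mul ((continuesTo_const 1).sub continuesTo_id)).mul h.deriv.deriv).add
    (((continuesTo_const c).sub (continuesTo_id.const_mul (a + b + 1))).mul h.deriv)).sub
    (h.const_mul (a * b))).eq_zero
    (eventually_norm_lt_one.mono fun z hz => gauss_ode hc a b hz) hx)

theorem hyp2F1_raise {c : ℂ} (hc : NotNonposInt c) {x : ℝ} (hx : x ≠ 1)
    (a b : ℂ) :
    (x : ℂ) * deriv (fun t : ℝ => hyp2F1 a b c t) x + a * hyp2F1 a b c x =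
      a * hyp2F1 (a + 1) b c x := by
  have h := continuesTo_hyp2F1 hc a b
  exact ((continuesTo_id.mul h.deriv).add (h.const_mul a)).eq
    ((continuesTo_hyp2F1 hc (a + 1) b).const_mul a)
    (eventually_norm_lt_one.mono fun z hz => gauss_raise a b c hz) hx

theorem hyp2F1_euler {c : ℂ} (hc : NotNonposInt c) {x : ℝ} (hx : x ≠ 1)
    (a b : ℂ) :
    (1 - (x : ℂ)) ^ (a + b - c) * hyp2F1 a b c x = hyp2F1 (c - a) (c - b) c x :=
  ((continuesTo_one_sub_cpow (a + b - c)).mul (continuesTo_hyp2F1 hc a b)).eq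
    (continuesTo_hyp2F1 hc (c - a) (c - b)) (eventually_gauss_euler hc a b) hx

theorem hyp2F1_wronskian {c : ℂ} (hc : NotNonposInt c) {x : ℝ} (hx : x ≠ 1)
    (a b : ℂ) (hc' : NotNonposInt (2 - c)) :
    hyp2F1 a b c x * ((1 - c) * hyp2F1 (a - c + 1) (b - c + 1) (2 - c) x +
        x * deriv (fun t : ℝ => hyp2F1 (a - c + 1) (b - c + 1) (2 - c) t) x) -
      x * hyp2F1 (a - c + 1) (b - c + 1) (2 - c) x * deriv (fun t : ℝ => hyp2F1 a b c t) x =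
      (1 - c) * (1 - (x : ℂ)) ^ (c - (a + b + 1)) := by
  have h := continuesTo_hyp2F1 hc a b
  have h' := continuesTo_hyp2F1 hc' (a - c + 1) (b - c + 1)
  exact ((h.mul ((h'.const_mul (1 - c)).add (continuesTo_id.mul h'.deriv))).sub
    ((continuesTo_id.mul h').mul h.deriv)).eq
    ((continuesTo_one_sub_cpow (c - (a + b + 1))).const_mul (1 - c))
    (eventually_gauss_wronskian hc hc' a b) hx

theorem hasDerivAt_cpow_mul_hyp2F1 {c : ℂ} (hc : NotNonposInt c) {x : ℝ} (hx : x ≠ 1)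
    (b : ℂ) {s : ℂ} (hs : s ≠ 0) (hx0 : x ≠ 0) :
    HasDerivAt (fun t : ℝ => (t : ℂ) ^ s * (1 / s) * hyp2F1 s b c t)
      ((x : ℂ) ^ (s - 1) * hyp2F1 (s + 1) b c x) x :=
  hasDerivAt_cpow_mul hx0 hs ((continuesTo_hyp2F1 hc s b).hasDerivAt hx)
    (hyp2F1_raise hc hx s b)

theorem hasDerivAt_cpow_mul_hyp3F2 {c : ℂ} (hc : NotNonposInt c) {x : ℝ} (hx : x ≠ 1)
    (a b : ℂ) {s : ℂ} (hs : NotNonposInt s) (hx0 : x ≠ 0) :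
    HasDerivAt (fun t : ℝ => (t : ℂ) ^ s * (1 / s) * hyp3F2 a b s c (s + 1) t)
      ((x : ℂ) ^ (s - 1) * hyp2F1 a b c x) x := by
  have h := continuesTo_hyp3F2 hc hs a b
  have h0 : s ≠ 0 := by simpa using hs 0
  refine hasDerivAt_cpow_mul hx0 h0 (h.hasDerivAt hx) ?_
  exact ((continuesTo_id.mul h.deriv).add (h.const_mul s)).eq
    ((continuesTo_hyp2F1 hc a b).const_mul s)
    (eventually_norm_lt_one.mono fun z hz => gauss_integral hs a b c hz) hx

theorem HasDeriv2At.wronskian_eventuallyEq {y₁ y₁' y₁'' y₂ y₂' y₂'' : ℝ → ℂ} {x : ℝ}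
    (h₁ : HasDeriv2At y₁ y₁' y₁'' x) (h₂ : HasDeriv2At y₂ y₂' y₂'' x) :
    wronskian y₁ y₂ =ᶠ[𝓝 x] fun t => y₁ t * y₂' t - y₂ t * y₁' t := by
  filter_upwards [h₁.1, h₂.1] with t a b
  rw [wronskian, a.1.deriv, b.1.deriv]

/-- Variation of parameters with `g = q / (k W)`, for which `-k g W = -q`. Continuity of `W` near
`x` is needed to make the second derivative of the source term continuous. -/
theorem solvesAt_source_term {y₁ y₁' y₁'' y₂ y₂' y₂'' G₁ G₂ q : ℝ → ℂ} {k : ℝ → ℝ} {x : ℝ}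
    {k₁ k₀ c : ℝ} (h₁ : HasDeriv2At y₁ y₁' y₁'' x) (h₂ : HasDeriv2At y₂ y₂' y₂'' x)
    (hq : ∀ᶠ t in 𝓝 x, ContinuousAt q t) (hk : ∀ᶠ t in 𝓝 x, ContinuousAt k t) (hk0 : k x ≠ 0)
    (hW : wronskian y₁ y₂ x ≠ 0)
    (hG₁ : ∀ᶠ t in 𝓝 x, HasDerivAt G₁ (y₁ t * q t / (k t * wronskian y₁ y₂ t)) t)
    (hG₂ : ∀ᶠ t in 𝓝 x, HasDerivAt G₂ (y₂ t * q t / (k t * wronskian y₁ y₂ t)) t)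
    (o₁ : -(k x : ℂ) * y₁'' x + k₁ * y₁' x + k₀ * y₁ x = 0)
    (o₂ : -(k x : ℂ) * y₂'' x + k₁ * y₂' x + k₀ * y₂ x = 0) (hc : q x = c) :
    SolvesAt (-k x) k₁ k₀ c (fun t => y₁ t * G₂ t - y₂ t * G₁ t) x := by
  have hWe := h₁.wronskian_eventuallyEq h₂
  have hWc : ∀ᶠ t in 𝓝 x, ContinuousAt (wronskian y₁ y₂) t := by
    filter_upwards [h₁.1, h₂.1, hWe.eventually_nhds] with t a b e
    have a1 := a.1.continuousAt
    have a2 := a.2.continuousAt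
    have b1 := b.1.continuousAt
    have b2 := b.2.continuousAt
    have h : ContinuousAt (fun t => y₁ t * y₂' t - y₂ t * y₁' t) t := by fun_prop
    exact h.congr (Filter.EventuallyEq.symm e)
  have hk0' : (k x : ℂ) ≠ 0 := by exact_mod_cast hk0
  refine solvesAt_variation_of_parameters (g := fun t => q t / (k t * wronskian y₁ y₂ t)) h₁ h₂
    (hG₁.mono fun t h => by rwa [mul_div_assoc] at h)
    (hG₂.mono fun t h => by rwa [mul_div_assoc] at h) ?_ (by push_cast; exact o₁)
    (by push_cast; exact o₂) ?_
  · filter_upwards [hq, hk, hWc, hk.self_of_nhds.eventually_ne hk0,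
      hWc.self_of_nhds.eventually_ne hW] with t a b c d e
    have d' : (k t : ℂ) ≠ 0 := by exact_mod_cast d
    refine a.div ((Complex.continuous_ofReal.continuousAt.comp' b).mul c) (mul_ne_zero d' e)
  · have hWx : wronskian y₁ y₂ x = y₁ x * y₂' x - y₂ x * y₁' x := hWe.self_of_nhds
    rw [hc, ← hWx]
    push_cast
    field_simp

/-! ### Variance linear in strike: exponents, fundamental solutions and their Wronskian. -/

namespace Segment

variable {M : Segment}

theorem b₁_pos (hp : 0 < M.p) (hrq : M.q < M.r) : 0 < M.b₁ := mul_pos hp (sub_pos.2 hrq)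

theorem b₀_pos (hp : 0 < M.p) (hq : 0 < M.q) : 0 < M.b₀ := by
  have := mul_pos hp hq
  rw [b₀]
  linarith

/-- The indicial equation at the origin of `-v x² V'' + b₁ x V' + b₀ V = 0`. It holds for either
sign of the discriminant, since only the square of the root enters. -/
theorem m_quadratic (hb : M.b₂ ≠ 0) :
    (M.b₂ : ℂ) * M.m ^ 2 - (M.b₂ + M.b₁) * M.m - M.b₀ = 0 := by
  have hb' : (M.b₂ : ℂ) ≠ 0 := by exact_mod_cast hb
  have h := Complex.cpow_nat_inv_pow ((4 * M.b₂ * M.b₀ + (M.b₂ + M.b₁) ^ 2 : ℝ) : ℂ) two_ne_zero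
  rw [show (((2 : ℕ) : ℂ)⁻¹) = 1 / 2 by norm_num] at h
  rw [m]
  set R := ((4 * M.b₂ * M.b₀ + (M.b₂ + M.b₁) ^ 2 : ℝ) : ℂ) ^ (1 / 2 : ℂ)
  push_cast at h ⊢
  field_simp
  linear_combination h

theorem b₂_mul_c (hb : M.b₂ ≠ 0) : (M.b₂ : ℂ) * M.c = 2 * M.b₂ * M.m - M.b₁ := by
  have hb' : (M.b₂ : ℂ) ≠ 0 := by exact_mod_cast hb
  rw [c]
  field_simp

theorem m_ne_zero (hp : 0 < M.p) (hq : 0 < M.q) (hb : M.b₂ ≠ 0) : M.m ≠ 0 := fun h => by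
  have h1 := m_quadratic hb
  have h2 : (M.b₀ : ℂ) ≠ 0 := by exact_mod_cast (b₀_pos hp hq).ne'
  rw [h] at h1
  exact h2 (by linear_combination -h1)

theorem m_ne_one (hp : 0 < M.p) (hq : 0 < M.q) (hrq : M.q < M.r) (hb : M.b₂ ≠ 0) :
    M.m - 1 ≠ 0 := fun h => by
  have h1 := m_quadratic hb
  have h2 : ((M.b₀ + M.b₁ : ℝ) : ℂ) ≠ 0 := by
    exact_mod_cast (add_pos (b₀_pos hp hq) (b₁_pos hp hrq)).ne'
  rw [sub_eq_zero.1 h] at h1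
  push_cast at h2
  exact h2 (by linear_combination -h1)

/-- The other indicial root is `m + 1 - c`, so `c = m` would make it `1`. The quadratic takes the
value `-(b₀ + b₁)` at `1`, and `-b₀` at `0`; both are negative. -/
theorem c_sub_m_ne_zero (hp : 0 < M.p) (hq : 0 < M.q) (hrq : M.q < M.r) (hb : M.b₂ ≠ 0) :
    M.c - M.m ≠ 0 := fun h => by
  have h1 := m_quadratic hb
  have h3 := b₂_mul_c hb
  have h2 : ((M.b₀ + M.b₁ : ℝ) : ℂ) ≠ 0 := by
    exact_mod_cast (add_pos (b₀_pos hp hq) (b₁_pos hp hrq)).ne'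
  push_cast at h2
  refine h2 ?_
  linear_combination (M.b₂ * (M.m - 1) : ℂ) * h - h1 - (M.m - 1) * h3

theorem c_sub_m_ne_one (hp : 0 < M.p) (hq : 0 < M.q) (hb : M.b₂ ≠ 0) :
    M.c - M.m - 1 ≠ 0 := fun h => by
  have h1 := m_quadratic hb
  have h3 := b₂_mul_c hb
  have h2 : (M.b₀ : ℂ) ≠ 0 := by exact_mod_cast (b₀_pos hp hq).ne'
  refine h2 ?_
  linear_combination (M.b₂ * M.m : ℂ) * h - h1 - M.m * h3

/-- A solution in the variable `z` for an exponent `μ` at the origin. -/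
theorem strike_solution {μ d : ℂ}
    (hμ : (M.b₂ : ℂ) * μ ^ 2 - (M.b₂ + M.b₁) * μ - M.b₀ = 0) (hd : M.b₂ * d = 2 * M.b₂ * μ - M.b₁)
    (hd0 : NotNonposInt d) {z : ℝ} (hz0 : z ≠ 0) (hz1 : z ≠ 1) :
    ∃ y' y'' : ℝ → ℂ, HasDeriv2At (fun t : ℝ => (t : ℂ) ^ μ * hyp2F1 (μ - 1) μ d t) y' y'' z ∧
      y' z = (z : ℂ) ^ μ / z * (μ * hyp2F1 (μ - 1) μ d z +
        z * deriv (fun t : ℝ => hyp2F1 (μ - 1) μ d t) z) ∧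
      -((M.b₂ * (1 - z) * z ^ 2 : ℝ) : ℂ) * y'' z + (M.b₁ * z : ℝ) * y' z +
        M.b₀ * ((z : ℂ) ^ μ * hyp2F1 (μ - 1) μ d z) = 0 := by
  have hz0' : (z : ℂ) ≠ 0 := by exact_mod_cast hz0
  refine ⟨_, _, (hasDeriv2At_ofReal_cpow hz0 μ).mul (hyp2F1_hasDeriv2At hd0 hz1 (μ - 1) μ), ?_, ?_⟩
  · simp only [Complex.cpow_sub _ _ hz0', Complex.cpow_one]
    field_simp
  · have ho := hyp2F1_ode hd0 hz1 (μ - 1) μ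
    simp only [Complex.cpow_sub _ _ hz0', Complex.cpow_one]
    push_cast
    field_simp
    set F := hyp2F1 (μ - 1) μ d z
    set F' := deriv (fun t : ℝ => hyp2F1 (μ - 1) μ d t) z
    -- Without the factor `z ^ μ`, the operator is `-b₂ z` times Gauss' operator, up to a multiple
    -- of `F` killed by the indicial equation and a multiple of `z F'` killed by the choice of `d`.
    linear_combination (z : ℂ) ^ μ * ((-M.b₂ * z : ℂ) * ho - F * hμ + z * F' * hd)

end Segment

theorem notNonposInt_of_forall_ne {c : ℂ} (hc : ∀ k : ℤ, c ≠ k) : NotNonposInt c := fun n h =>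
  hc (-n) (by push_cast; exact h)

theorem notNonposInt_two_sub {c : ℂ} (hc : ∀ k : ℤ, c ≠ k) : NotNonposInt (2 - c) := fun n h =>
  hc (2 + n) (by push_cast; linear_combination -h)

namespace Segment

variable {M : Segment}

theorem zStrike_eq_affine (x : ℝ) : M.zStrike x = -M.a₂ / M.b₂ * x + 0 := by
  rw [zStrike]
  ring

theorem _root_.HasDeriv2At.comp_zStrike {Y Y' Y'' : ℝ → ℂ} {x : ℝ}
    (h : HasDeriv2At Y Y' Y'' (M.zStrike x)) :
    HasDeriv2At (fun t => Y (M.zStrike t))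
      (fun t => ((-M.a₂ / M.b₂ : ℝ) : ℂ) * Y' (M.zStrike t))
      (fun t => ((-M.a₂ / M.b₂ : ℝ) : ℂ) ^ 2 * Y'' (M.zStrike t)) x := by
  rw [zStrike_eq_affine] at h
  simpa only [← zStrike_eq_affine (M := M)] using h.comp_affine

theorem v_eq (hb : M.b₂ ≠ 0) (x : ℝ) : M.v x = M.b₂ * (1 - M.zStrike x) := by
  rw [v, zStrike]
  field_simp
  ring

theorem zStrike_ne_zero (ha : M.a₂ ≠ 0) (hb : M.b₂ ≠ 0) {x : ℝ} (hx : 0 < x) :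
    M.zStrike x ≠ 0 := by
  rw [zStrike]
  exact div_ne_zero (mul_ne_zero (neg_ne_zero.2 ha) hx.ne') hb

/-- Positivity of `v = b₂ (1 - z)` means `z < 1` for `b₂ > 0`, but `z > 1` for `b₂ < 0`. In the
second case the functions are evaluated on the cut. -/
theorem zStrike_ne_one (hb : M.b₂ ≠ 0) {x : ℝ} (hv : 0 < M.v x) : M.zStrike x ≠ 1 := fun h => by
  rw [v_eq hb, h] at hv
  simp at hv

/-- The second solution of the hypergeometric equation, as it is without the power of `z`. -/
theorem Y₂_eq {z : ℝ} (hz : z ≠ 0) : M.Y₂ z =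
    (z : ℂ) ^ (M.m + 1 - M.c) * hyp2F1 (M.m + 1 - M.c - 1) (M.m + 1 - M.c) (2 - M.c) z := by
  have hz' : (z : ℂ) ≠ 0 := by exact_mod_cast hz
  rw [Y₂, ← mul_assoc, ← Complex.cpow_add _ _ hz', show M.m + (1 - M.c) = M.m + 1 - M.c by ring,
    show M.m + 1 - M.c - 1 = M.m - M.c by ring]

theorem Y₁_solution (hb : M.b₂ ≠ 0) (hc : ∀ k : ℤ, M.c ≠ k) {z : ℝ} (hz0 : z ≠ 0) (hz1 : z ≠ 1) :
    ∃ y' y'' : ℝ → ℂ, HasDeriv2At M.Y₁ y' y'' z ∧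
      y' z = (z : ℂ) ^ M.m / z * (M.m * hyp2F1 (M.m - 1) M.m M.c z +
        z * deriv (fun t : ℝ => hyp2F1 (M.m - 1) M.m M.c t) z) ∧
      -((M.b₂ * (1 - z) * z ^ 2 : ℝ) : ℂ) * y'' z + (M.b₁ * z : ℝ) * y' z + M.b₀ * M.Y₁ z = 0 :=
  strike_solution (m_quadratic hb) (b₂_mul_c hb) (notNonposInt_of_forall_ne hc) hz0 hz1

/-- The same solution lemma at the second indicial root `m + 1 - c`, whose lower parameter is `2 -
c`. -/
theorem Y₂_solution (hb : M.b₂ ≠ 0) (hc : ∀ k : ℤ, M.c ≠ k) {z : ℝ} (hz0 : z ≠ 0) (hz1 : z ≠ 1) :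
    ∃ y' y'' : ℝ → ℂ, HasDeriv2At M.Y₂ y' y'' z ∧
      y' z = (z : ℂ) ^ M.m * (z : ℂ) ^ (1 - M.c) / z *
        ((M.m + 1 - M.c) * hyp2F1 (M.m - M.c) (M.m + 1 - M.c) (2 - M.c) z +
          z * deriv (fun t : ℝ => hyp2F1 (M.m - M.c) (M.m + 1 - M.c) (2 - M.c) t) z) ∧
      -((M.b₂ * (1 - z) * z ^ 2 : ℝ) : ℂ) * y'' z + (M.b₁ * z : ℝ) * y' z + M.b₀ * M.Y₂ z = 0 := by
  have h1 := m_quadratic hb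
  have h2 := b₂_mul_c hb
  have hz' : (z : ℂ) ≠ 0 := by exact_mod_cast hz0
  obtain ⟨y', y'', h3, h4, h5⟩ := strike_solution (M := M) (μ := M.m + 1 - M.c) (d := 2 - M.c)
    (by linear_combination h1 + (M.c - 1) * h2)
    (by linear_combination h2) (notNonposInt_two_sub hc) hz0 hz1
  rw [← Y₂_eq hz0] at h5
  refine ⟨y', y'', h3.congr ?_, ?_, h5⟩
  · filter_upwards [eventually_ne_nhds hz0] with t ht using Y₂_eq ht
  · rw [h4, ← Complex.cpow_add _ _ hz', show M.m + (1 - M.c) = M.m + 1 - M.c by ring,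
      show M.m + 1 - M.c - 1 = M.m - M.c by ring]

/-- The Wronskian in the variable `z`, up to the factor `-a₂ / b₂`. -/
theorem wronskian_strike (ha : M.a₂ ≠ 0) (hb : M.b₂ ≠ 0) (hc : ∀ k : ℤ, M.c ≠ k) {x : ℝ}
    (hx : 0 < x) (hv : 0 < M.v x) :
    wronskian M.y₁ M.y₂ x = -(M.a₂ : ℂ) / M.b₂ * ((1 - M.c) *
      ((M.zStrike x : ℂ) ^ M.m * (M.zStrike x : ℂ) ^ M.m / (M.zStrike x : ℂ) ^ M.c) *
      (1 - (M.zStrike x : ℂ)) ^ (M.c - 2 * M.m)) := by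
  have hz0 := zStrike_ne_zero ha hb hx
  have hz1 := zStrike_ne_one hb hv
  obtain ⟨y', y'', h1, h2, -⟩ := Y₁_solution hb hc hz0 hz1
  obtain ⟨w', w'', g1, g2, -⟩ := Y₂_solution hb hc hz0 hz1
  have hW : wronskian M.y₁ M.y₂ x = M.y₁ x * _ - M.y₂ x * _ :=
    (h1.comp_zStrike.wronskian_eventuallyEq g1.comp_zStrike).self_of_nhds
  rw [hW, h2, g2]
  -- For `a = m - 1`, `b = m` the exponent `c - (a + b + 1)` is `c - 2m`.
  have key := hyp2F1_wronskian (notNonposInt_of_forall_ne hc) hz1 (M.m - 1) M.m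
    (notNonposInt_two_sub hc)
  rw [show M.m - 1 - M.c + 1 = M.m - M.c by ring, show M.m - M.c + 1 = M.m + 1 - M.c by ring,
    show M.c - (M.m - 1 + M.m + 1) = M.c - 2 * M.m by ring] at key
  have hz' : (M.zStrike x : ℂ) ≠ 0 := by exact_mod_cast hz0
  simp only [y₁, y₂, Y₁, Y₂]
  set z := M.zStrike x
  have hzc : (z : ℂ) ^ M.c ≠ 0 := by simp [Complex.cpow_eq_zero_iff, hz']
  rw [Complex.cpow_sub _ _ hz', Complex.cpow_one, mul_assoc (1 - M.c), mul_left_comm (1 - M.c),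
    ← key]
  push_cast
  field_simp
  ring

end Segment

/-! ### The source integrals in the strike variable. -/

namespace Segment

variable {M : Segment}

theorem wronskian_strike_ne_zero (ha : M.a₂ ≠ 0) (hb : M.b₂ ≠ 0) (hc : ∀ k : ℤ, M.c ≠ k) {x : ℝ}
    (hx : 0 < x) (hv : 0 < M.v x) : wronskian M.y₁ M.y₂ x ≠ 0 := by
  have hz0 : (M.zStrike x : ℂ) ≠ 0 := by exact_mod_cast zStrike_ne_zero ha hb hx
  have hz1 : 1 - (M.zStrike x : ℂ) ≠ 0 :=
    sub_ne_zero.2 (by exact_mod_cast (zStrike_ne_one hb hv).symm)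
  have ha' : (M.a₂ : ℂ) ≠ 0 := by exact_mod_cast ha
  have hb' : (M.b₂ : ℂ) ≠ 0 := by exact_mod_cast hb
  have hc1 : 1 - M.c ≠ 0 := sub_ne_zero.2 fun h => hc 1 (by rw [← h]; simp)
  have hp : ∀ {u : ℂ} (s : ℂ), u ≠ 0 → u ^ s ≠ 0 := fun s hu => by
    simp [Complex.cpow_eq_zero_iff, hu]
  rw [wronskian_strike ha hb hc hx hv]
  exact mul_ne_zero (div_ne_zero (neg_ne_zero.2 ha') hb') (mul_ne_zero (mul_ne_zero hc1
    (div_ne_zero (mul_ne_zero (hp _ hz0) (hp _ hz0)) (hp _ hz0))) (hp _ hz1))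

/-- The factor `1 / ((1 - z) W)` carries `(1 - z) ^ (2m - c - 1)`, which is precisely the power in
Euler's transformation of `F(m - 1, m; c)`. Only a power of `z` and one Gauss function remain. -/
theorem strike_integrand₁ (ha : M.a₂ ≠ 0) (hb : M.b₂ ≠ 0) (hc : ∀ k : ℤ, M.c ≠ k) {x : ℝ}
    (hx : 0 < x) (hv : 0 < M.v x) {z : ℝ} (hz : z = M.zStrike x) :
    M.Y₁ z / ((1 - z) * z ^ 2 * wronskian M.y₁ M.y₂ x) = M.b₂ / M.a₂ * (1 / (M.c - 1)) *
      ((z : ℂ) ^ (M.c - M.m - 1 - 1) * hyp2F1 (M.c - M.m) (M.c - M.m + 1) M.c z) := by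
  rw [wronskian_strike ha hb hc hx hv, ← hz]
  have hz0 : (z : ℂ) ≠ 0 := by rw [hz]; exact_mod_cast zStrike_ne_zero ha hb hx
  have hzr : z ≠ 1 := by rw [hz]; exact zStrike_ne_one hb hv
  have hz1 : 1 - (z : ℂ) ≠ 0 := sub_ne_zero.2 (by exact_mod_cast hzr.symm)
  have ha' : (M.a₂ : ℂ) ≠ 0 := by exact_mod_cast ha
  have hb' : (M.b₂ : ℂ) ≠ 0 := by exact_mod_cast hb
  have hc1 : 1 - M.c ≠ 0 := sub_ne_zero.2 fun h => hc 1 (by rw [← h]; simp)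
  have hc1' : M.c - 1 ≠ 0 := by rw [← neg_sub]; exact neg_ne_zero.2 hc1
  have hp : ∀ {u : ℂ} (s : ℂ), u ≠ 0 → u ^ s ≠ 0 := fun s hu => by
    simp [Complex.cpow_eq_zero_iff, hu]
  have he := hyp2F1_euler (notNonposInt_of_forall_ne hc) hzr (M.m - 1) M.m
  rw [show M.c - (M.m - 1) = M.c - M.m + 1 by ring,
    show M.m - 1 + M.m - M.c = -(M.c - 2 * M.m) - 1 by ring, hyp2F1_comm (M.c - M.m + 1),
    Complex.cpow_sub _ _ hz1, Complex.cpow_neg, Complex.cpow_one] at he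
  rw [← he, Complex.cpow_sub _ _ hz0, Complex.cpow_sub _ _ hz0, Complex.cpow_sub _ _ hz0,
    Complex.cpow_one, Y₁]
  have h1 := hp M.m hz0
  have h2 := hp M.c hz0
  have h3 := hp (M.c - 2 * M.m) hz1
  field_simp
  ring

theorem strike_integrand₂ (ha : M.a₂ ≠ 0) (hb : M.b₂ ≠ 0) (hc : ∀ k : ℤ, M.c ≠ k) {x : ℝ}
    (hx : 0 < x) (hv : 0 < M.v x) {z : ℝ} (hz : z = M.zStrike x) :
    M.Y₂ z / ((1 - z) * z ^ 2 * wronskian M.y₁ M.y₂ x) = M.b₂ / M.a₂ * (1 / (M.c - 1)) *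
      ((z : ℂ) ^ (-M.m - 1) * hyp2F1 (1 - M.m) (2 - M.m) (2 - M.c) z) := by
  rw [wronskian_strike ha hb hc hx hv, ← hz]
  have hz0 : (z : ℂ) ≠ 0 := by rw [hz]; exact_mod_cast zStrike_ne_zero ha hb hx
  have hzr : z ≠ 1 := by rw [hz]; exact zStrike_ne_one hb hv
  have hz1 : 1 - (z : ℂ) ≠ 0 := sub_ne_zero.2 (by exact_mod_cast hzr.symm)
  have ha' : (M.a₂ : ℂ) ≠ 0 := by exact_mod_cast ha
  have hb' : (M.b₂ : ℂ) ≠ 0 := by exact_mod_cast hb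
  have hc1 : 1 - M.c ≠ 0 := sub_ne_zero.2 fun h => hc 1 (by rw [← h]; simp)
  have hc1' : M.c - 1 ≠ 0 := by rw [← neg_sub]; exact neg_ne_zero.2 hc1
  have hp : ∀ {u : ℂ} (s : ℂ), u ≠ 0 → u ^ s ≠ 0 := fun s hu => by
    simp [Complex.cpow_eq_zero_iff, hu]
  have he := hyp2F1_euler (notNonposInt_two_sub hc) hzr (M.m - M.c) (M.m + 1 - M.c)
  rw [show 2 - M.c - (M.m - M.c) = 2 - M.m by ring,
    show 2 - M.c - (M.m + 1 - M.c) = 1 - M.m by ring,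
    show M.m - M.c + (M.m + 1 - M.c) - (2 - M.c) = -(M.c - 2 * M.m) - 1 by ring,
    hyp2F1_comm (2 - M.m), Complex.cpow_sub _ _ hz1, Complex.cpow_neg, Complex.cpow_one] at he
  rw [← he, Complex.cpow_sub (-M.m) _ hz0, Complex.cpow_neg, Complex.cpow_one, Y₂,
    Complex.cpow_sub 1 _ hz0, Complex.cpow_one]
  have h1 := hp M.m hz0
  have h2 := hp M.c hz0
  have h3 := hp (M.c - 2 * M.m) hz1
  field_simp
  ring

theorem Gamma_c_sub_one_div (hc : ∀ k : ℤ, M.c ≠ k) :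
    Complex.Gamma (M.c - 1) / Complex.Gamma M.c = 1 / (M.c - 1) := by
  have h1 : M.c - 1 ≠ 0 := sub_ne_zero.2 fun h => hc 1 (by rw [h]; simp)
  have h2 : Complex.Gamma (M.c - 1) ≠ 0 := Complex.Gamma_ne_zero fun n h =>
    hc (1 - n) (by push_cast; linear_combination h)
  have h3 := Complex.Gamma_add_one (M.c - 1) h1
  rw [sub_add_cancel] at h3
  rw [h3]
  field_simp

theorem Gamma_one_sub_c_div (hc : ∀ k : ℤ, M.c ≠ k) :
    Complex.Gamma (1 - M.c) / Complex.Gamma (2 - M.c) = -(1 / (M.c - 1)) := by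
  have h1 : 1 - M.c ≠ 0 := sub_ne_zero.2 fun h => hc 1 (by rw [← h]; simp)
  have h1' : M.c - 1 ≠ 0 := by rw [← neg_sub]; exact neg_ne_zero.2 h1
  have h2 : Complex.Gamma (1 - M.c) ≠ 0 := Complex.Gamma_ne_zero fun n h =>
    hc (1 + n) (by push_cast; linear_combination -h)
  have h3 := Complex.Gamma_add_one (1 - M.c) h1
  rw [show 1 - M.c + 1 = 2 - M.c by ring] at h3
  rw [h3]
  field_simp
  ring

/-- This and the next five lemmas bring each closed form to `z ^ s / s` times a hypergeometric
function whose parameter `s` is to be raised or integrated, up to a common constant. -/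
theorem I₀_eq (hc : ∀ k : ℤ, M.c ≠ k) (γ t : ℝ) : M.I₀ γ t = γ * (M.b₂ / M.a₂ * (1 / (M.c - 1)) *
    ((t : ℂ) ^ (M.c - M.m - 1) * (1 / (M.c - M.m - 1)) *
      hyp2F1 (M.c - M.m - 1) (M.c - M.m + 1) M.c t)) := by
  rw [← Gamma_c_sub_one_div hc, I₀, A₁, one_div, one_div, mul_inv]
  ring

theorem I₁_eq (hc : ∀ k : ℤ, M.c ≠ k) (γ : ℝ) {t : ℝ} (ht : t ≠ 0) :
    M.I₁ γ t = γ * (M.b₂ / M.a₂ * (1 / (M.c - 1)) *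
      ((t : ℂ) ^ (M.c - M.m) * (1 / (M.c - M.m)) * hyp2F1 (M.c - M.m) (M.c - M.m) M.c t)) := by
  have ht' : (t : ℂ) ≠ 0 := by exact_mod_cast ht
  rw [← Gamma_c_sub_one_div hc, I₁, A₁, Complex.cpow_sub _ 1 ht', Complex.cpow_one]
  field_simp

theorem I₂_eq (hc : ∀ k : ℤ, M.c ≠ k) (γ : ℝ) {t : ℝ} (ht : t ≠ 0) :
    M.I₂ γ t = γ * (M.b₂ / M.a₂ * (1 / (M.c - 1)) *
      ((t : ℂ) ^ (M.c - M.m + 1) * (1 / (M.c - M.m + 1)) *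
        hyp3F2 (M.c - M.m) (M.c - M.m + 1) (M.c - M.m + 1) M.c (M.c - M.m + 1 + 1) t)) := by
  have ht' : (t : ℂ) ≠ 0 := by exact_mod_cast ht
  rw [← Gamma_c_sub_one_div hc, I₂, A₁, Complex.cpow_sub _ 1 ht', Complex.cpow_add _ 1 ht',
    Complex.cpow_one, show 2 + M.c - M.m = M.c - M.m + 1 + 1 by ring]
  field_simp

theorem calI₀_eq (hc : ∀ k : ℤ, M.c ≠ k) (γ t : ℝ) :
    M.calI₀ γ t = γ * (M.b₂ / M.a₂ * (1 / (M.c - 1)) *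
      ((t : ℂ) ^ (-M.m) * (1 / (-M.m)) * hyp2F1 (-M.m) (2 - M.m) (2 - M.c) t)) := by
  rw [calI₀, A₂, Gamma_one_sub_c_div hc, hyp2F1_comm (2 - M.m), one_div (-M.m), inv_neg]
  ring

theorem calI₁_eq (hc : ∀ k : ℤ, M.c ≠ k) (γ : ℝ) {t : ℝ} (ht : t ≠ 0) :
    M.calI₁ γ t = γ * (M.b₂ / M.a₂ * (1 / (M.c - 1)) *
      ((t : ℂ) ^ (1 - M.m) * (1 / (1 - M.m)) * hyp2F1 (1 - M.m) (1 - M.m) (2 - M.c) t)) := by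
  have ht' : (t : ℂ) ≠ 0 := by exact_mod_cast ht
  rw [calI₁, A₂, Gamma_one_sub_c_div hc, show (1 : ℂ) - M.m = -M.m + 1 by ring,
    Complex.cpow_add _ 1 ht', Complex.cpow_one, show M.m - 1 = -(-M.m + 1) by ring, one_div (-(_)),
    inv_neg]
  ring

theorem calI₂_eq (hc : ∀ k : ℤ, M.c ≠ k) (γ : ℝ) {t : ℝ} (ht : t ≠ 0) :
    M.calI₂ γ t = γ * (M.b₂ / M.a₂ * (1 / (M.c - 1)) *
      ((t : ℂ) ^ (2 - M.m) * (1 / (2 - M.m)) *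
        hyp3F2 (1 - M.m) (2 - M.m) (2 - M.m) (2 - M.c) (2 - M.m + 1) t)) := by
  have ht' : (t : ℂ) ≠ 0 := by exact_mod_cast ht
  have h2 : (t : ℂ) ^ (2 - M.m) = (t : ℂ) ^ 2 * (t : ℂ) ^ (-M.m) := by
    rw [sub_eq_add_neg, Complex.cpow_add _ _ ht', Complex.cpow_ofNat]
  rw [calI₂, A₂, Gamma_one_sub_c_div hc, h2, show 3 - M.m = 2 - M.m + 1 by ring,
    show M.m - 2 = -(2 - M.m) by ring, one_div (-(_)), inv_neg]
  ring

/-- After Euler's transformation the integrands for `y₁` are `z ^ (s - 1) F(c - m, c - m + 1; c)`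
with `s = c - m - 1`, `c - m`, `c - m + 1`. In the first two cases one upper parameter equals `s +
1`, and raising does the integration. In the third none does, which is why a `₃F₂` appears. For `y₂`
the exponents are `-m`, `1 - m`, `2 - m`. -/
theorem strike_integrals (hp : 0 < M.p) (hq : 0 < M.q) (hrq : M.q < M.r) (ha : M.a₂ ≠ 0)
    (hb : M.b₂ ≠ 0) (hc : ∀ k : ℤ, M.c ≠ k) (hm : NotNonposInt (2 - M.m))
    (hcm : NotNonposInt (M.c - M.m + 1)) {x : ℝ} (hx : 0 < x) (hv : 0 < M.v x) (γ₀ γ₁ γ₂ : ℝ)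
    {z : ℝ} (hz : z = M.zStrike x) :
    HasDerivAt (M.I₀ γ₀) (γ₀ * (M.Y₁ z / ((1 - z) * z ^ 2 * wronskian M.y₁ M.y₂ x))) z ∧
    HasDerivAt (M.I₁ γ₁) (γ₁ * (z * M.Y₁ z / ((1 - z) * z ^ 2 * wronskian M.y₁ M.y₂ x))) z ∧
    HasDerivAt (M.I₂ γ₂) (γ₂ * (z ^ 2 * M.Y₁ z / ((1 - z) * z ^ 2 * wronskian M.y₁ M.y₂ x))) z ∧
    HasDerivAt (M.calI₀ γ₀) (γ₀ * (M.Y₂ z / ((1 - z) * z ^ 2 * wronskian M.y₁ M.y₂ x))) z ∧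
    HasDerivAt (M.calI₁ γ₁) (γ₁ * (z * M.Y₂ z / ((1 - z) * z ^ 2 * wronskian M.y₁ M.y₂ x))) z ∧
    HasDerivAt (M.calI₂ γ₂)
      (γ₂ * (z ^ 2 * M.Y₂ z / ((1 - z) * z ^ 2 * wronskian M.y₁ M.y₂ x))) z := by
  have hzr : z ≠ 0 := by rw [hz]; exact zStrike_ne_zero ha hb hx
  have hz0 : (z : ℂ) ≠ 0 := by exact_mod_cast hzr
  have hz1 : z ≠ 1 := by rw [hz]; exact zStrike_ne_one hb hv
  have hcn := notNonposInt_of_forall_ne hc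
  have hcn' := notNonposInt_two_sub hc
  have e1 : ∀ s : ℂ, (z : ℂ) * (z : ℂ) ^ (s - 1) = (z : ℂ) ^ s := fun s => by
    rw [Complex.cpow_sub _ _ hz0, Complex.cpow_one]
    field_simp
  rw [mul_div_assoc, mul_div_assoc, mul_div_assoc, mul_div_assoc,
    strike_integrand₁ ha hb hc hx hv hz, strike_integrand₂ ha hb hc hx hv hz]
  have hev := eventually_ne_nhds hzr
  refine ⟨?_, ?_, ?_, ?_, ?_, ?_⟩
  · have h := hasDerivAt_cpow_mul_hyp2F1 hcn hz1 (M.c - M.m + 1) (c_sub_m_ne_one hp hq hb) hzr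
    rw [sub_add_cancel] at h
    exact ((h.const_mul _).const_mul _).congr_of_eventuallyEq (.of_forall fun t => I₀_eq hc γ₀ t)
  · have h := hasDerivAt_cpow_mul_hyp2F1 hcn hz1 (M.c - M.m) (c_sub_m_ne_zero hp hq hrq hb) hzr
    refine (((h.const_mul _).const_mul _).congr_of_eventuallyEq
      (hev.mono fun t ht => I₁_eq hc γ₁ ht)).congr_deriv ?_
    rw [hyp2F1_comm (M.c - M.m + 1), ← e1 (M.c - M.m - 1)]
    ring
  · have h := hasDerivAt_cpow_mul_hyp3F2 hcn hz1 (M.c - M.m) (M.c - M.m + 1) hcm hzr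
    refine (((h.const_mul _).const_mul _).congr_of_eventuallyEq
      (hev.mono fun t ht => I₂_eq hc γ₂ ht)).congr_deriv ?_
    rw [show M.c - M.m + 1 - 1 = M.c - M.m by ring, ← e1 (M.c - M.m), ← e1 (M.c - M.m - 1)]
    ring
  · have h := hasDerivAt_cpow_mul_hyp2F1 hcn' hz1 (2 - M.m) (neg_ne_zero.2 (m_ne_zero hp hq hb)) hzr
    rw [show -M.m + 1 = 1 - M.m by ring] at h
    exact ((h.const_mul _).const_mul _).congr_of_eventuallyEq (.of_forall fun t => calI₀_eq hc γ₀ t)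
  · have hm1 : 1 - M.m ≠ 0 := by
      rw [← neg_sub]
      exact neg_ne_zero.2 (m_ne_one hp hq hrq hb)
    have h := hasDerivAt_cpow_mul_hyp2F1 hcn' hz1 (1 - M.m) hm1 hzr
    refine (((h.const_mul _).const_mul _).congr_of_eventuallyEq
      (hev.mono fun t ht => calI₁_eq hc γ₁ ht)).congr_deriv ?_
    rw [show 1 - M.m + 1 = 2 - M.m by ring, hyp2F1_comm (2 - M.m),
      show 1 - M.m - 1 = -M.m by ring, ← e1 (-M.m)]
    ring
  · have h := hasDerivAt_cpow_mul_hyp3F2 hcn' hz1 (1 - M.m) (2 - M.m) hm hzr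
    refine (((h.const_mul _).const_mul _).congr_of_eventuallyEq
      (hev.mono fun t ht => calI₂_eq hc γ₂ ht)).congr_deriv ?_
    rw [show 2 - M.m - 1 = -M.m + 1 by ring, ← e1 (-M.m + 1), add_sub_cancel_right, ← e1 (-M.m)]
    ring

theorem strike_source (hp : 0 < M.p) (hq : 0 < M.q) (hrq : M.q < M.r) (ha : M.a₂ ≠ 0)
    (hb : M.b₂ ≠ 0) (hc : ∀ k : ℤ, M.c ≠ k) (hm : NotNonposInt (2 - M.m))
    (hcm : NotNonposInt (M.c - M.m + 1)) {x : ℝ} (hx : 0 < x) (hv : 0 < M.v x) (γ₀ γ₁ γ₂ : ℝ) :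
    HasDerivAt (M.strikeSource₁ γ₀ γ₁ γ₂)
      (M.y₁ x * (γ₀ + γ₁ * M.zStrike x + γ₂ * M.zStrike x ^ 2 : ℝ) /
        ((M.v x * x ^ 2 : ℝ) * wronskian M.y₁ M.y₂ x)) x ∧
    HasDerivAt (M.strikeSource₂ γ₀ γ₁ γ₂)
      (M.y₂ x * (γ₀ + γ₁ * M.zStrike x + γ₂ * M.zStrike x ^ 2 : ℝ) /
        ((M.v x * x ^ 2 : ℝ) * wronskian M.y₁ M.y₂ x)) x := by
  obtain ⟨h0, h1, h2, g0, g1, g2⟩ :=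
    strike_integrals hp hq hrq ha hb hc hm hcm hx hv γ₀ γ₁ γ₂ rfl
  have hW := wronskian_strike_ne_zero ha hb hc hx hv
  have hd : HasDerivAt M.zStrike (-M.a₂ / M.b₂) x := by
    have h := ((hasDerivAt_id x).const_mul (-M.a₂)).div_const M.b₂
    rw [mul_one] at h
    exact h
  have key : ∀ {h : ℝ → ℂ} {h' : ℂ}, HasDerivAt h h' (M.zStrike x) →
      HasDerivAt (fun t => h (M.zStrike t)) (((-M.a₂ / M.b₂ : ℝ) : ℂ) * h') x := fun {h h'} hh => by
    have h1 := HasDerivAt.scomp x hh hd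
    rw [Complex.real_smul] at h1
    exact h1
  have hx' : (x : ℂ) ≠ 0 := by exact_mod_cast hx.ne'
  have ha' : (M.a₂ : ℂ) ≠ 0 := by exact_mod_cast ha
  have hb' : (M.b₂ : ℂ) ≠ 0 := by exact_mod_cast hb
  have hz1 : 1 - (M.zStrike x : ℂ) ≠ 0 :=
    sub_ne_zero.2 (by exact_mod_cast (zStrike_ne_one hb hv).symm)
  have hz0 : (M.zStrike x : ℂ) ≠ 0 := by exact_mod_cast zStrike_ne_zero ha hb hx
  have hzx : (M.b₂ : ℂ) * M.zStrike x = -(M.a₂ * x) := by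
    rw [zStrike]
    push_cast
    field_simp
  have hx2 : (x : ℂ) = -(M.b₂ * M.zStrike x) / M.a₂ := by
    rw [hzx]
    field_simp
  -- The prefactor `-a₂ / b₂ ^ 2` times `dz/dx = -a₂ / b₂` is `a₂ ^ 2 / b₂ ^ 3`, and `v x ^ 2 = (b₂
  -- ^ 3 / a₂ ^ 2) (1 - z) z ^ 2`.
  refine ⟨((((key h0).fun_add (key h1)).fun_add (key h2)).const_mul _).congr_deriv ?_,
    ((((key g0).fun_add (key g1)).fun_add (key g2)).const_mul _).congr_deriv ?_⟩
  · rw [show M.y₁ x = M.Y₁ (M.zStrike x) from rfl, v_eq hb]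
    push_cast
    rw [hx2]
    field_simp
    try ring
  · rw [show M.y₂ x = M.Y₂ (M.zStrike x) from rfl, v_eq hb]
    push_cast
    rw [hx2]
    field_simp
    try ring

end Segment

theorem coveredPut_eq {M : Segment} (ha : M.a₂ ≠ 0) (hb : M.b₂ ≠ 0) {S A B x₁ x₃ P₁ P₃ x θ : ℝ}
    (hS : 0 < S) (hθ : θ = 1 ∧ B ≤ A * x ∨ θ = 0 ∧ A * x ≤ B) :
    coveredPut S A B x₁ x₃ P₁ P₃ x = quadCoeff₀ x₁ x₃ P₁ P₃ + θ * (B * S) +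
      θ * (M.b₂ / M.a₂ * A * S) * M.zStrike x +
      quadCoeff₂ x₁ x₃ P₁ P₃ * (M.b₂ ^ 2 / M.a₂ ^ 2) * M.zStrike x ^ 2 := by
  have h1 : M.b₂ / M.a₂ * A * S * M.zStrike x = -(A * (S * x)) := by
    rw [Segment.zStrike]
    field_simp
  have h2 : M.b₂ ^ 2 / M.a₂ ^ 2 * M.zStrike x ^ 2 = x ^ 2 := by
    rw [Segment.zStrike]
    field_simp
  have h3 : max (A * (S * x) - B * S) 0 = θ * (A * (S * x) - B * S) := by
    rcases hθ with ⟨rfl, h⟩ | ⟨rfl, h⟩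
    · rw [one_mul, max_eq_left]
      nlinarith
    · rw [zero_mul, max_eq_right]
      nlinarith
  rw [coveredPut, h3]
  linear_combination -θ * h1 - quadCoeff₂ x₁ x₃ P₁ P₃ * h2

namespace Segment

variable {M : Segment}

theorem strike_source_solvesAt (hp : 0 < M.p) (hq : 0 < M.q) (hrq : M.q < M.r) (ha : M.a₂ ≠ 0)
    (hb : M.b₂ ≠ 0) (hc : ∀ k : ℤ, M.c ≠ k) (hm : NotNonposInt (2 - M.m))
    (hcm : NotNonposInt (M.c - M.m + 1)) {x : ℝ} (hx : 0 < x) (hv : 0 < M.v x) (γ₀ γ₁ γ₂ : ℝ) :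
    SolvesAt (-(M.v x * x ^ 2)) (M.b₁ * x) M.b₀ (γ₀ + γ₁ * M.zStrike x + γ₂ * M.zStrike x ^ 2)
      (fun t => -M.y₂ t * M.strikeSource₁ γ₀ γ₁ γ₂ t + M.y₁ t * M.strikeSource₂ γ₀ γ₁ γ₂ t) x := by
  have hz0 := zStrike_ne_zero ha hb hx
  have hz1 := zStrike_ne_one hb hv
  obtain ⟨y', y'', h1, -, h2⟩ := Y₁_solution hb hc hz0 hz1
  obtain ⟨w', w'', g1, -, g2⟩ := Y₂_solution hb hc hz0 hz1
  have hvc : Continuous M.v := by unfold v; fun_prop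
  have hzc : Continuous M.zStrike := by unfold zStrike; fun_prop
  have hev : ∀ᶠ t in 𝓝 x, 0 < t ∧ 0 < M.v t :=
    (eventually_gt_nhds hx).and (hvc.continuousAt.eventually (eventually_gt_nhds hv))
  have ha' : (M.a₂ : ℂ) ≠ 0 := by exact_mod_cast ha
  have hb' : (M.b₂ : ℂ) ≠ 0 := by exact_mod_cast hb
  have hzx : -(M.a₂ : ℂ) / M.b₂ * x = M.zStrike x := by
    rw [zStrike]
    push_cast
    ring
  -- The operators `x d/dx` and `x² d²/dx²` are invariant under scaling, so passing from `z` to `x`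
  -- only rewrites `b₂ (1 - z)` as `v`.
  have hode : ∀ a b c : ℂ, -((M.b₂ * (1 - M.zStrike x) * M.zStrike x ^ 2 : ℝ) : ℂ) * a +
      (M.b₁ * M.zStrike x : ℝ) * b + M.b₀ * c = 0 →
      -((M.v x * x ^ 2 : ℝ) : ℂ) * (((-M.a₂ / M.b₂ : ℝ) : ℂ) ^ 2 * a) +
        (M.b₁ * x : ℝ) * (((-M.a₂ / M.b₂ : ℝ) : ℂ) * b) + M.b₀ * c = 0 := by
    intro a b c h
    rw [v_eq hb]
    push_cast at h ⊢
    rw [← hzx] at h ⊢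
    linear_combination h
  have key := solvesAt_source_term (k := fun t => M.v t * t ^ 2)
    (q := fun t => ((γ₀ + γ₁ * M.zStrike t + γ₂ * M.zStrike t ^ 2 : ℝ) : ℂ))
    (G₁ := M.strikeSource₁ γ₀ γ₁ γ₂) (G₂ := M.strikeSource₂ γ₀ γ₁ γ₂)
    (k₁ := M.b₁ * x) (k₀ := M.b₀)
    h1.comp_zStrike g1.comp_zStrike
    (.of_forall fun t => (by fun_prop : Continuous fun t =>
      ((γ₀ + γ₁ * M.zStrike t + γ₂ * M.zStrike t ^ 2 : ℝ) : ℂ)).continuousAt)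
    (.of_forall fun t => (by fun_prop : Continuous fun t => M.v t * t ^ 2).continuousAt)
    (mul_pos hv (pow_pos hx 2)).ne' (wronskian_strike_ne_zero ha hb hc hx hv)
    (hev.mono fun t ht => (strike_source hp hq hrq ha hb hc hm hcm ht.1 ht.2 γ₀ γ₁ γ₂).1)
    (hev.mono fun t ht => (strike_source hp hq hrq ha hb hc hm hcm ht.1 ht.2 γ₀ γ₁ γ₂).2)
    (hode _ _ _ h2) (hode _ _ _ g2) rfl
  have hfun : (fun t => -M.y₂ t * M.strikeSource₁ γ₀ γ₁ γ₂ t + M.y₁ t * M.strikeSource₂ γ₀ γ₁ γ₂ t) =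
      fun t => M.Y₁ (M.zStrike t) * M.strikeSource₂ γ₀ γ₁ γ₂ t -
        M.Y₂ (M.zStrike t) * M.strikeSource₁ γ₀ γ₁ γ₂ t := by
    funext t
    rw [y₁, y₂]
    ring
  rw [hfun]
  exact key

end Segment

/-! ### Kummer's functions -/

/-- The coefficients of Kummer's series. -/
noncomputable def kummerCoeff (a b : ℂ) (n : ℕ) : ℂ := rising a n / (rising b n * n !)

theorem kummerM_eq_powSum (a b : ℂ) : kummerM a b = powSum (kummerCoeff a b) := by
  funext z
  simp [kummerM, hypSeries, powSum, kummerCoeff]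

theorem coeffBounded_kummer (a b : ℂ) (R : ℝ) : CoeffBounded (kummerCoeff a b) R := by
  have h := (coeffBounded_inv_factorial R).mul (coeffBounded_rising_div a b)
  have e : (fun n : ℕ => 1 / (n ! : ℂ) * (rising a n / rising b n)) = kummerCoeff a b := by
    funext n
    rw [kummerCoeff, div_mul_div_comm, one_mul, mul_comm (n ! : ℂ)]
  rwa [e] at h

theorem kummerCoeff_succ {b : ℂ} (hb : NotNonposInt b) (a : ℂ) (n : ℕ) :
    (b + n) * ((n + 1) * kummerCoeff a b (n + 1)) = (a + n) * kummerCoeff a b n := by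
  have h1 : b + n ≠ 0 := fun h => hb n (eq_neg_of_add_eq_zero_left h)
  have h2 : rising b n ≠ 0 := rising_ne_zero hb n
  have h3 : (n ! : ℂ) ≠ 0 := by exact_mod_cast n.factorial_ne_zero
  have h4 : (n + 1 : ℂ) ≠ 0 := by exact_mod_cast n.succ_ne_zero
  simp only [kummerCoeff, rising_succ, Nat.factorial_succ]
  push_cast
  field_simp

theorem norm_lt_add_one (z : ℂ) : ‖z‖ < ‖z‖ + 1 := lt_add_one _

theorem analyticAt_kummerM (a b z : ℂ) : AnalyticAt ℂ (kummerM a b) z := by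
  rw [kummerM_eq_powSum]
  exact (coeffBounded_kummer a b _).analyticAt (norm_lt_add_one z)

theorem hasDerivAt_kummerM (a b z : ℂ) : HasDerivAt (kummerM a b) (deriv (kummerM a b) z) z :=
  (analyticAt_kummerM a b z).differentiableAt.hasDerivAt

theorem hasDerivAt_deriv_kummerM (a b z : ℂ) :
    HasDerivAt (deriv (kummerM a b)) (deriv (deriv (kummerM a b)) z) z :=
  (analyticAt_kummerM a b z).deriv.differentiableAt.hasDerivAt

theorem kummerM_zero (a b : ℂ) : kummerM a b 0 = 1 := by
  rw [kummerM_eq_powSum, powSum_zero]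
  simp [kummerCoeff, rising_zero]

theorem kummer_ode {b : ℂ} (hb : NotNonposInt b) (a z : ℂ) :
    z * deriv (deriv (kummerM a b)) z + (b - z) * deriv (kummerM a b) z - a * kummerM a b z = 0 := by
  rw [kummerM_eq_powSum]
  have hz := norm_lt_add_one z
  have hu := coeffBounded_kummer a b (‖z‖ + 1)
  set u := kummerCoeff a b with hu_def
  have e1 := hu.mul_deriv_deriv_powSum hz
  have e3 := hu.deriv_powSum hz
  have e4 := hu.mul_deriv_powSum hz
  have s1 := (hu.deriv_coeff.natCast_mul).hasSum hz
  have s3 := hu.deriv_coeff.hasSum hz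
  have s4 := hu.natCast_mul.hasSum hz
  have s5 := hu.hasSum hz
  have key := (((s1.add (s3.mul_left b)).sub s4).sub (s5.mul_left a))
  have hz0 : ∀ n : ℕ, (n : ℂ) * ((n + 1) * u (n + 1)) * z ^ n +
      b * ((n + 1) * u (n + 1) * z ^ n) - n * u n * z ^ n - a * (u n * z ^ n) = 0 := fun n => by
    linear_combination z ^ n * kummerCoeff_succ hb a n
  simp only [hz0] at key
  have h0 := key.unique hasSum_zero
  rw [← e1, ← e3, ← e4] at h0
  linear_combination h0

/-- Kummer's transformation. -/
theorem exp_neg_mul_kummerM {b : ℂ} (hb : NotNonposInt b) (a z : ℂ) :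
    Complex.exp (-z) * kummerM a b z = kummerM (b - a) b (-z) := by
  have hneg : ∀ z : ℂ, HasDerivAt (fun z : ℂ => -z) (-1) z := fun z => hasDerivAt_neg z
  have hexp : ∀ z : ℂ, HasDerivAt (fun z => Complex.exp (-z)) (-Complex.exp (-z)) z := fun z => by
    simpa using (hneg z).cexp
  set y : ℂ → ℂ := fun z => Complex.exp (-z) * kummerM a b z - kummerM (b - a) b (-z) with hy
  have h1 : ∀ z, HasDerivAt y (Complex.exp (-z) * (deriv (kummerM a b) z - kummerM a b z) +
      deriv (kummerM (b - a) b) (-z)) z := fun z => by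
    have e := ((hexp z).fun_mul (hasDerivAt_kummerM a b z)).fun_sub
      ((hasDerivAt_kummerM (b - a) b (-z)).comp z (hneg z))
    exact e.congr_deriv (by ring)
  have h2 : ∀ z, HasDerivAt (deriv y) (Complex.exp (-z) * (deriv (deriv (kummerM a b)) z -
      2 * deriv (kummerM a b) z + kummerM a b z) - deriv (deriv (kummerM (b - a) b)) (-z)) z :=
    fun z => by
      rw [funext fun z => (h1 z).deriv]
      have e := ((hexp z).fun_mul ((hasDerivAt_deriv_kummerM a b z).fun_sub
        (hasDerivAt_kummerM a b z))).fun_add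
        ((hasDerivAt_deriv_kummerM (b - a) b (-z)).comp z (hneg z))
      exact e.congr_deriv (by ring)
  have hyd : Differentiable ℂ y := fun z => (h1 z).differentiableAt
  have hya : ∀ z, AnalyticAt ℂ y z := fun z => hyd.analyticAt z
  have h0 : ∀ᶠ z in 𝓝 0, y z = 0 := by
    -- Both sides satisfy `z y'' + (b + z) y' + (b - a) y = 0` and equal `1` at the origin. As `y`
    -- is entire, its vanishing near `0` extends to the plane.
    refine eventually_eq_zero_of_regular_singular (p := fun z => b + z) (q := fun _ => b - a)
      (hya 0) (by fun_prop) (by fun_prop) (.of_forall fun z => ?_) (by simpa using hb) ?_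
    · have o1 := kummer_ode hb a z
      have o2 := kummer_ode hb (b - a) (-z)
      rw [(h2 z).deriv, (h1 z).deriv]
      simp only [hy]
      linear_combination Complex.exp (-z) * o1 + o2
    · simp [hy, kummerM_zero]
  have h3 : y = fun _ => 0 := AnalyticOnNhd.eq_of_eventuallyEq (z₀ := 0) (fun z _ => hya z)
    (fun z _ => analyticAt_const) h0
  have h4 := congrFun h3 z
  simp only [hy] at h4
  exact sub_eq_zero.1 h4

/-- The Wronskian of Kummer's solutions at the origin. -/
theorem kummer_wronskian {b : ℂ} (hb : NotNonposInt b) (hb' : NotNonposInt (2 - b)) (a z : ℂ) :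
    kummerM a b z * ((1 - b) * kummerM (1 + a - b) (2 - b) z +
        z * deriv (kummerM (1 + a - b) (2 - b)) z) -
      z * kummerM (1 + a - b) (2 - b) z * deriv (kummerM a b) z = (1 - b) * Complex.exp z := by
  have hneg : ∀ z : ℂ, HasDerivAt (fun z : ℂ => -z) (-1) z := fun z => hasDerivAt_neg z
  have hexp : ∀ z : ℂ, HasDerivAt (fun z => Complex.exp (-z)) (-Complex.exp (-z)) z := fun z => by
    simpa using (hneg z).cexp
  set F := kummerM a b with hF
  set E := kummerM (1 + a - b) (2 - b) with hE
  -- Abel's formula again: the Wronskian without its factor `z ^ (-b)` is a multiple of `exp z`.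
  set Q : ℂ → ℂ := fun z => Complex.exp (-z) *
    (F z * ((1 - b) * E z + z * deriv E z) - z * E z * deriv F z) with hQ
  have hQd : ∀ z, HasDerivAt Q 0 z := by
    intro z
    have f1 := hasDerivAt_kummerM a b z
    have f2 := hasDerivAt_deriv_kummerM a b z
    have e1 := hasDerivAt_kummerM (1 + a - b) (2 - b) z
    have e2 := hasDerivAt_deriv_kummerM (1 + a - b) (2 - b) z
    have hid : HasDerivAt (fun z : ℂ => z) 1 z := hasDerivAt_id z
    refine ((hexp z).fun_mul ((f1.fun_mul ((e1.const_mul (1 - b)).fun_add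
      (hid.fun_mul e2))).fun_sub ((hid.fun_mul e1).fun_mul f2))).congr_deriv ?_
    have o1 := kummer_ode hb a z
    have o2 := kummer_ode hb' (1 + a - b) z
    rw [← hF] at o1 ⊢
    rw [← hE] at o2 ⊢
    linear_combination Complex.exp (-z) * (F z * o2 - E z * o1)
  have hconst := is_const_of_deriv_eq_zero (fun z => (hQd z).differentiableAt)
    (fun z => (hQd z).deriv) z 0
  have hQ0 : Q 0 = 1 - b := by simp [hQ, hF, hE, kummerM_zero]
  rw [hQ0] at hconst
  simp only [hQ] at hconst
  have h2 : Complex.exp z * Complex.exp (-z) = 1 := by rw [← Complex.exp_add]; simp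
  linear_combination Complex.exp z * hconst -
    (F z * ((1 - b) * E z + z * deriv E z) - z * E z * deriv F z) * h2

theorem hasDeriv2At_kummerM (a b : ℂ) (x : ℝ) :
    HasDeriv2At (fun t : ℝ => kummerM a b t) (fun t : ℝ => deriv (kummerM a b) t)
      (fun t : ℝ => deriv (deriv (kummerM a b)) t) x := by
  refine ⟨.of_forall fun t => ⟨(hasDerivAt_kummerM a b t).comp_ofReal,
    (hasDerivAt_deriv_kummerM a b t).comp_ofReal⟩, .of_forall fun t => ?_⟩
  exact ((analyticAt_kummerM a b t).deriv.deriv.differentiableAt.hasDerivAt.comp_ofReal).continuousAt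

/-- The factor of `M(a, b, z)` in `U(a, b, z)`. -/
noncomputable def kummerUCoeff₁ (a b : ℂ) : ℂ :=
  Real.pi / Complex.sin (Real.pi * b) / (Complex.Gamma (1 + a - b) * Complex.Gamma b)

/-- The factor of `z ^ (1 - b) * M(1 + a - b, 2 - b, z)` in `U(a, b, z)`. -/
noncomputable def kummerUCoeff₂ (a b : ℂ) : ℂ :=
  -(Real.pi / Complex.sin (Real.pi * b) / (Complex.Gamma a * Complex.Gamma (2 - b)))

theorem kummerU_eq (a b z : ℂ) : kummerU a b z = kummerUCoeff₁ a b * kummerM a b z +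
    kummerUCoeff₂ a b * (z ^ (1 - b) * kummerM (1 + a - b) (2 - b) z) := by
  rw [kummerU, kummerUCoeff₁, kummerUCoeff₂]
  ring

/-- Kummer's transformation of each part expands the second solution in the same two series as `U(a,
b, z)`. Apart from the constants, only the branch of `(-z) ^ (1 - b)` differs. -/
theorem exp_mul_kummerU {b : ℂ} (hb : NotNonposInt b) (hb' : NotNonposInt (2 - b)) (a z : ℂ) :
    Complex.exp z * kummerU (b - a) b (-z) = kummerUCoeff₁ (b - a) b * kummerM a b z +
      kummerUCoeff₂ (b - a) b * ((-z) ^ (1 - b) * kummerM (1 + a - b) (2 - b) z) := by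
  have h1 := exp_neg_mul_kummerM hb a z
  have h2 := exp_neg_mul_kummerM hb' (1 + a - b) z
  have h3 : Complex.exp z * Complex.exp (-z) = 1 := by rw [← Complex.exp_add]; simp
  rw [kummerU_eq, ← h1, show 1 + (b - a) - b = 2 - b - (1 + a - b) by ring, ← h2]
  linear_combination (kummerUCoeff₁ (b - a) b * kummerM a b z +
      kummerUCoeff₂ (b - a) b * ((-z) ^ (1 - b) * kummerM (1 + a - b) (2 - b) z)) * h3

/-- `σ` is the sign of `x`. -/
def IsSignOf (σ x : ℝ) : Prop := σ = 1 ∧ 0 < x ∨ σ = -1 ∧ x < 0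

theorem IsSignOf.ne_zero {σ x : ℝ} (h : IsSignOf σ x) : x ≠ 0 := by
  rcases h with ⟨-, h⟩ | ⟨-, h⟩
  exacts [h.ne', h.ne]

theorem IsSignOf.eventually {σ x : ℝ} (h : IsSignOf σ x) : ∀ᶠ t in 𝓝 x, IsSignOf σ t := by
  rcases h with ⟨h1, h⟩ | ⟨h1, h⟩
  · filter_upwards [eventually_gt_nhds h] with t ht using Or.inl ⟨h1, ht⟩
  · filter_upwards [eventually_lt_nhds h] with t ht using Or.inr ⟨h1, ht⟩

/-- Principal arguments: `-x` has argument `π` for `x > 0`, and `x` has argument `π` for `x < 0`.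
Negation thus turns the argument by `σ π`. -/
theorem neg_cpow_of_isSignOf {σ x : ℝ} (h : IsSignOf σ x) (s : ℂ) :
    (-(x : ℂ)) ^ s = Complex.exp (σ * (Real.pi * Complex.I * s)) * (x : ℂ) ^ s := by
  rcases h with ⟨rfl, h⟩ | ⟨rfl, h⟩
  · have := Complex.ofReal_cpow_of_nonpos (neg_nonpos.2 h.le) s
    push_cast at this ⊢
    rw [this, neg_neg]
    ring_nf
  · rw [Complex.ofReal_cpow_of_nonpos h.le s]
    have h3 : Complex.exp (((-1 : ℝ) : ℂ) * (Real.pi * Complex.I * s)) *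
        Complex.exp (Real.pi * Complex.I * s) = 1 := by rw [← Complex.exp_add]; simp
    linear_combination (-(-(x : ℂ)) ^ s) * h3

theorem inv_Gamma_mul_Gamma_one_sub (x : ℂ) :
    (Complex.Gamma x * Complex.Gamma (1 - x))⁻¹ = Complex.sin (Real.pi * x) / Real.pi := by
  rw [Complex.Gamma_mul_Gamma_one_sub, inv_div]

theorem sin_pi_mul_ne_zero_of_forall_ne {b : ℂ} (hb : ∀ k : ℤ, b ≠ k) : Complex.sin (Real.pi * b) ≠ 0 := by
  have hpi : (Real.pi : ℂ) ≠ 0 := by exact_mod_cast Real.pi_ne_zero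
  rw [Complex.sin_ne_zero_iff]
  intro k h
  exact hb k (mul_left_cancel₀ hpi (by rw [h]; ring))

/-- The connection constant in the Wronskian of the two functions `U`. -/
theorem kummerUCoeff_wronskian {b : ℂ} (hb : ∀ k : ℤ, b ≠ k) (a : ℂ) {σ : ℝ}
    (hσ : σ = 1 ∨ σ = -1) :
    (1 - b) * (kummerUCoeff₁ a b * (kummerUCoeff₂ (b - a) b *
        Complex.exp (σ * (Real.pi * Complex.I * (1 - b)))) -
      kummerUCoeff₂ a b * kummerUCoeff₁ (b - a) b) =
    Complex.exp (-σ * (Real.pi * Complex.I * (b - a))) := by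
  have hpi : (Real.pi : ℂ) ≠ 0 := by exact_mod_cast Real.pi_ne_zero
  have hs := sin_pi_mul_ne_zero_of_forall_ne hb
  have h1b : 1 - b ≠ 0 := sub_ne_zero.2 fun h => hb 1 (by rw [← h]; simp)
  have g1 := inv_Gamma_mul_Gamma_one_sub (b - a)
  have g2 := inv_Gamma_mul_Gamma_one_sub a
  have g3 := inv_Gamma_mul_Gamma_one_sub b
  have g4 := Complex.Gamma_add_one (1 - b) h1b
  rw [show 1 - b + 1 = 2 - b by ring] at g4
  rw [show 1 - (b - a) = 1 + a - b by ring] at g1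
  -- The Gamma factors pair off under the reflection formula, leaving only sines.
  have k1 : kummerUCoeff₁ a b * kummerUCoeff₂ (b - a) b =
      -(Complex.sin (Real.pi * (b - a)) / (Complex.sin (Real.pi * b) * (1 - b))) := by
    have : kummerUCoeff₁ a b * kummerUCoeff₂ (b - a) b =
        -((Real.pi / Complex.sin (Real.pi * b)) ^ 2 *
          (Complex.Gamma (b - a) * Complex.Gamma (1 + a - b))⁻¹ *
          ((Complex.Gamma b * Complex.Gamma (1 - b))⁻¹ * (1 - b)⁻¹)) := by
      rw [kummerUCoeff₁, kummerUCoeff₂, g4]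
      simp only [div_eq_mul_inv, mul_inv]
      ring
    rw [this, g1, g3]
    field_simp
  have k2 : kummerUCoeff₂ a b * kummerUCoeff₁ (b - a) b =
      -(Complex.sin (Real.pi * a) / (Complex.sin (Real.pi * b) * (1 - b))) := by
    have : kummerUCoeff₂ a b * kummerUCoeff₁ (b - a) b =
        -((Real.pi / Complex.sin (Real.pi * b)) ^ 2 *
          (Complex.Gamma a * Complex.Gamma (1 - a))⁻¹ *
          ((Complex.Gamma b * Complex.Gamma (1 - b))⁻¹ * (1 - b)⁻¹)) := by
      rw [kummerUCoeff₁, kummerUCoeff₂, g4, show 1 + (b - a) - b = 1 - a by ring]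
      simp only [div_eq_mul_inv, mul_inv]
      ring
    rw [this, g2, g3]
    field_simp
  have hexp : ∀ x : ℂ, Complex.exp (x * Complex.I) = Complex.cos x + Complex.sin x * Complex.I :=
    Complex.exp_mul_I
  rw [← mul_assoc, k1, k2]
  have hsc := Complex.sin_sq_add_cos_sq (Real.pi * b)
  have hI := Complex.I_sq
  -- For `σ = 1` the identity is `sin π(b - a) exp(-iπb) + sin πa = sin πb exp(-iπ(b - a))`; the
  -- other case is obtained by replacing `i` with `-i`.
  rcases hσ with rfl | rfl
  · rw [show (((1 : ℝ) : ℂ) * (Real.pi * Complex.I * (1 - b))) =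
        Real.pi * Complex.I + (-(Real.pi * b)) * Complex.I by push_cast; ring,
      Complex.exp_add, Complex.exp_pi_mul_I,
      show (-((1 : ℝ) : ℂ) * (Real.pi * Complex.I * (b - a))) =
        (-(Real.pi * (b - a))) * Complex.I by push_cast; ring, hexp, hexp, Complex.sin_neg,
      Complex.cos_neg, Complex.sin_neg, Complex.cos_neg, mul_sub (Real.pi : ℂ) b a,
      Complex.sin_sub, Complex.cos_sub]
    generalize (Real.pi : ℂ) * b = x at hs hsc ⊢
    field_simp
    linear_combination (-Complex.sin (Real.pi * a)) * hsc
  · rw [show (((-1 : ℝ) : ℂ) * (Real.pi * Complex.I * (1 - b))) =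
        -(Real.pi * Complex.I) + (Real.pi * b) * Complex.I by push_cast; ring,
      Complex.exp_add, Complex.exp_neg, Complex.exp_pi_mul_I,
      show (-((-1 : ℝ) : ℂ) * (Real.pi * Complex.I * (b - a))) =
        (Real.pi * (b - a)) * Complex.I by push_cast; ring, hexp, hexp, mul_sub (Real.pi : ℂ) b a,
      Complex.sin_sub, Complex.cos_sub]
    generalize (Real.pi : ℂ) * b = x at hs hsc ⊢
    field_simp
    linear_combination (-Complex.sin (Real.pi * a)) * hsc

/-- The two solutions `U(a, b, z)` and `exp z U(b - a, b, -z)` on the real line. -/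
theorem kummerU_solutions {b : ℂ} (hb : ∀ k : ℤ, b ≠ k) (a : ℂ) {σ z : ℝ} (hσ : IsSignOf σ z) :
    ∃ f' f'' g' g'' : ℝ → ℂ, HasDeriv2At (fun t : ℝ => kummerU a b t) f' f'' z ∧
      HasDeriv2At (fun t : ℝ => Complex.exp t * kummerU (b - a) b (-(t : ℂ))) g' g'' z ∧
      (z * f'' z + (b - z) * f' z - a * kummerU a b z = 0) ∧
      (z * g'' z + (b - z) * g' z - a * (Complex.exp z * kummerU (b - a) b (-(z : ℂ))) = 0) ∧
      kummerU a b z * g' z - Complex.exp z * kummerU (b - a) b (-(z : ℂ)) * f' z =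
        Complex.exp (-σ * (Real.pi * Complex.I * (b - a))) * ((z : ℂ) ^ (-b) * Complex.exp z) := by
  have hbn := notNonposInt_of_forall_ne hb
  have hbn' := notNonposInt_two_sub hb
  have hz0 := hσ.ne_zero
  have hz0' : (z : ℂ) ≠ 0 := by exact_mod_cast hz0
  have m1 := hasDeriv2At_kummerM a b z
  have m2 := (hasDeriv2At_ofReal_cpow hz0 (1 - b)).mul
    (hasDeriv2At_kummerM (1 + a - b) (2 - b) z)
  have o1 := kummer_ode hbn a z
  have o2 := kummer_ode hbn' (1 + a - b) z
  have w := kummer_wronskian hbn hbn' a z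
  have hconst := kummerUCoeff_wronskian hb a (σ := σ) (hσ.imp (·.1) (·.1))
  set ρ := Complex.exp (σ * (Real.pi * Complex.I * (1 - b))) with hρ
  have hU : ∀ t : ℝ, kummerU a b t = kummerUCoeff₁ a b * kummerM a b t +
      kummerUCoeff₂ a b * ((t : ℂ) ^ (1 - b) * kummerM (1 + a - b) (2 - b) t) := fun t =>
    kummerU_eq a b t
  -- Near `z` the sign is constant, so the branch factor `ρ` is a constant coefficient and can be
  -- differentiated past.
  have hV : ∀ t : ℝ, IsSignOf σ t → Complex.exp t * kummerU (b - a) b (-(t : ℂ)) =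
      kummerUCoeff₁ (b - a) b * kummerM a b t + kummerUCoeff₂ (b - a) b * ρ *
        ((t : ℂ) ^ (1 - b) * kummerM (1 + a - b) (2 - b) t) := fun t ht => by
    rw [exp_mul_kummerU hbn hbn', neg_cpow_of_isSignOf ht]
    ring
  have hp1 : (z : ℂ) ^ (1 - b) = z * (z : ℂ) ^ (-b) := by
    rw [sub_eq_add_neg, Complex.cpow_add _ _ hz0', Complex.cpow_one]
  have hp2 : (z : ℂ) ^ (1 - b - 1) = (z : ℂ) ^ (-b) := by ring_nf
  have hp3 : (z : ℂ) ^ (1 - b - 1 - 1) = (z : ℂ) ^ (-b) / z := by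
    rw [Complex.cpow_sub _ _ hz0', hp2, Complex.cpow_one]
  refine ⟨_, _, _, _, ((m1.const_mul (kummerUCoeff₁ a b)).add (m2.const_mul
    (kummerUCoeff₂ a b))).congr (.of_forall hU), ((m1.const_mul (kummerUCoeff₁ (b - a) b)).add
    (m2.const_mul (kummerUCoeff₂ (b - a) b * ρ))).congr (hσ.eventually.mono hV), ?_, ?_, ?_⟩
  · rw [hU]
    simp only [hp2, hp3, hp1]
    field_simp
    linear_combination kummerUCoeff₁ a b * o1 + kummerUCoeff₂ a b * (z : ℂ) ^ (-b) * z * o2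
  · rw [hV z hσ]
    simp only [hp2, hp3, hp1]
    field_simp
    linear_combination kummerUCoeff₁ (b - a) b * o1 +
      kummerUCoeff₂ (b - a) b * ρ * (z : ℂ) ^ (-b) * z * o2
  · rw [hV z hσ, hU, ← hconst]
    simp only [hp2, hp1]
    linear_combination (kummerUCoeff₁ a b * (kummerUCoeff₂ (b - a) b * ρ) -
      kummerUCoeff₂ a b * kummerUCoeff₁ (b - a) b) * (z : ℂ) ^ (-b) * w

/-! ### The integrals of Kummer's functions -/

theorem rising_div_rising_add_one {s : ℂ} (hs : NotNonposInt s) (n : ℕ) :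
    rising s n / rising (s + 1) n = s / (s + n) := by
  have h1 : s + n ≠ 0 := fun h => hs n (eq_neg_of_add_eq_zero_left h)
  have h0 : s ≠ 0 := by simpa using hs 0
  have h2 := rising_add_one s n
  have h3 : rising s n ≠ 0 := rising_ne_zero hs n
  have h4 : rising (s + 1) n ≠ 0 := fun h => by
    rw [h, mul_zero] at h2
    exact mul_ne_zero h1 h3 h2.symm
  rw [div_eq_div_iff h4 h1]
  linear_combination -h2

/-- The coefficients in the integral of `z ^ (s - 1) M(a, b, z)`. -/
noncomputable def kummerIntCoeff (s a b : ℂ) (n : ℕ) : ℂ := s / (s + n) * kummerCoeff a b n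

theorem hypSeries_kummerInt {s : ℂ} (hs : NotNonposInt s) (a b : ℂ) :
    hypSeries [s, a] [s + 1, b] = powSum (kummerIntCoeff s a b) := by
  funext z
  simp only [hypSeries, powSum, kummerIntCoeff, ← rising_div_rising_add_one hs, kummerCoeff,
    List.map_cons, List.map_nil, List.prod_cons, List.prod_nil, mul_one]
  refine tsum_congr fun n => ?_
  rw [div_mul_div_comm, mul_assoc (rising (s + 1) n)]

theorem coeffBounded_kummerInt (s a b : ℂ) (R : ℝ) : CoeffBounded (kummerIntCoeff s a b) R := by
  have h := ((coeffBounded_kummer a b R).mul (coeffBounded_inv_add s)).const_mul s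
  have e : (fun n : ℕ => s * (kummerCoeff a b n * (1 / (s + n)))) = kummerIntCoeff s a b := by
    funext n
    rw [kummerIntCoeff]
    ring
  rwa [e] at h

/-- The operator `z d/dz + s` multiplies the coefficient of `z ^ n` by `n + s` and cancels the
denominator in `kummerIntCoeff`. -/
theorem kummerInt_ode {s : ℂ} (hs : NotNonposInt s) (a b z : ℂ) :
    z * deriv (powSum (kummerIntCoeff s a b)) z + s * powSum (kummerIntCoeff s a b) z =
      s * kummerM a b z := by
  have hz := norm_lt_add_one z
  have hu := coeffBounded_kummerInt s a b (‖z‖ + 1)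
  rw [hu.mul_deriv_powSum hz, kummerM_eq_powSum]
  have h := (hu.natCast_mul.hasSum hz).add ((hu.hasSum hz).mul_left s)
  refine h.unique (Eq.mpr (congrArg (fun f => HasSum f _) (funext fun n => ?_))
    (((coeffBounded_kummer a b (‖z‖ + 1)).hasSum hz).mul_left s))
  have h1 : s + n ≠ 0 := fun h => hs n (eq_neg_of_add_eq_zero_left h)
  rw [kummerIntCoeff]
  field_simp
  ring

/-- The coefficients in the integral of `(M(a, b, z) - 1) / z`. -/
noncomputable def kummerLogCoeff (a b : ℂ) (n : ℕ) : ℂ := kummerCoeff a b (n + 1) / (n + 1)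

theorem rising_two (n : ℕ) : rising 2 n = (n + 1) ! := by
  have h := rising_succ_left 1 n
  rw [one_mul, rising_one, show (1 : ℂ) + 1 = 2 by norm_num] at h
  exact h.symm

theorem hypSeries_kummerLog (a b z : ℂ) :
    a / b * hypSeries [a + 1, 1, 1] [b + 1, 2, 2] z = powSum (kummerLogCoeff a b) z := by
  rw [hypSeries, powSum, ← tsum_mul_left]
  refine tsum_congr fun n => ?_
  have h1 : (n ! : ℂ) ≠ 0 := by exact_mod_cast n.factorial_ne_zero
  have h2 : (n + 1 : ℂ) ≠ 0 := by exact_mod_cast n.succ_ne_zero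
  simp only [List.map_cons, List.map_nil, List.prod_cons, List.prod_nil, mul_one, rising_one,
    rising_two, kummerLogCoeff, kummerCoeff, rising_succ_left, Nat.factorial_succ]
  push_cast
  field_simp

theorem coeffBounded_kummerLog (a b : ℂ) (R : ℝ) : CoeffBounded (kummerLogCoeff a b) R := by
  have h := (coeffBounded_kummer a b R).shift.mul (coeffBounded_inv_add 1)
  have e : (fun n : ℕ => kummerCoeff a b (n + 1) * (1 / (1 + (n : ℂ)))) = kummerLogCoeff a b := by
    funext n
    rw [kummerLogCoeff]
    ring
  rwa [e] at h

theorem kummerLog_ode (a b z : ℂ) :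
    z * (powSum (kummerLogCoeff a b) z + z * deriv (powSum (kummerLogCoeff a b)) z) =
      kummerM a b z - 1 := by
  have hz := norm_lt_add_one z
  have hu := coeffBounded_kummerLog a b (‖z‖ + 1)
  have hk := (coeffBounded_kummer a b (‖z‖ + 1)).hasSum hz
  rw [hu.mul_deriv_powSum hz, kummerM_eq_powSum]
  have h := ((hu.hasSum hz).add (hu.natCast_mul.hasSum hz)).mul_left z
  have h2 := (hasSum_nat_add_iff' 1).2 hk
  simp only [Finset.range_one, Finset.sum_singleton, pow_zero, mul_one] at h2
  have h0 : kummerCoeff a b 0 = 1 := by simp [kummerCoeff, rising_zero]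
  rw [h0] at h2
  refine h.unique (Eq.mpr (congrArg (fun f => HasSum f _) (funext fun n => ?_)) h2)
  have h1 : (n + 1 : ℂ) ≠ 0 := by exact_mod_cast n.succ_ne_zero
  rw [kummerLogCoeff]
  field_simp
  ring

/-- Along the negative axis the principal logarithm is `log |t| + π i`, with constant imaginary
part; the cut is not crossed. -/
theorem hasDerivAt_clog_ofReal {x : ℝ} (hx : x ≠ 0) :
    HasDerivAt (fun t : ℝ => Complex.log t) (x : ℂ)⁻¹ x := by
  rcases hx.lt_or_gt with h | h
  · have h1 : HasDerivAt (fun t : ℝ => ((Real.log t : ℝ) : ℂ) + Real.pi * Complex.I) (x : ℂ)⁻¹ x := by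
      have := ((Real.hasDerivAt_log hx).ofReal_comp).add_const (Real.pi * Complex.I)
      simpa using this
    refine h1.congr_of_eventuallyEq ?_
    filter_upwards [eventually_lt_nhds h] with t ht
    rw [Complex.log, Complex.arg_ofReal_of_neg ht, Complex.norm_real, Real.norm_eq_abs,
      Real.log_abs]
  · have h1 : HasDerivAt (fun t : ℝ => ((Real.log t : ℝ) : ℂ)) (x : ℂ)⁻¹ x := by
      simpa using (Real.hasDerivAt_log hx).ofReal_comp
    refine h1.congr_of_eventuallyEq ?_
    filter_upwards [eventually_gt_nhds h] with t ht
    rw [Complex.ofReal_log ht.le]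

theorem hasDerivAt_ofReal_mul (ε : ℂ) (x : ℝ) : HasDerivAt (fun t : ℝ => ε * (t : ℂ)) ε x := by
  simpa using (Complex.ofRealCLM.hasDerivAt (x := x)).const_mul ε

theorem hasDerivAt_powSum_ofReal_mul {u : ℕ → ℂ} (hu : ∀ R, CoeffBounded u R) (ε : ℂ) (x : ℝ) :
    HasDerivAt (fun t : ℝ => powSum u (ε * t)) (deriv (powSum u) (ε * x) * ε) x :=
  HasDerivAt.comp (h₂ := powSum u) x
    (((hu _).analyticAt (norm_lt_add_one (ε * x))).differentiableAt.hasDerivAt)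
    (hasDerivAt_ofReal_mul ε x)

/-- The antiderivative of `x ^ ν M(a, b, ε x)` on the real line. -/
theorem hasDerivAt_kummer_integral {ν : ℂ} (hν : NotNonposInt (ν + 1)) (a b ε : ℂ) {x : ℝ}
    (hx : x ≠ 0) :
    HasDerivAt (fun t : ℝ => (t : ℂ) ^ (ν + 1) / (ν + 1) *
      hypSeries [ν + 1, a] [ν + 2, b] (ε * t)) ((x : ℂ) ^ ν * kummerM a b (ε * x)) x := by
  have h0 : ν + 1 ≠ 0 := by simpa using hν 0
  rw [show ν + 2 = ν + 1 + 1 by ring, hypSeries_kummerInt hν]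
  have h := hasDerivAt_cpow_mul hx h0
    (hasDerivAt_powSum_ofReal_mul (coeffBounded_kummerInt (ν + 1) a b) ε x)
    (g := kummerM a b (ε * x)) (by linear_combination kummerInt_ode hν a b (ε * x))
  simpa only [mul_one_div, add_sub_cancel_right] using h

/-- The antiderivative of `M(a, b, ε x) / x` on the real line. -/
theorem hasDerivAt_kummer_log (a b ε : ℂ) {x : ℝ} (hx : x ≠ 0) :
    HasDerivAt (fun t : ℝ => Complex.log t +
      a / b * (ε * t) * hypSeries [a + 1, 1, 1] [b + 1, 2, 2] (ε * t))
      ((x : ℂ)⁻¹ * kummerM a b (ε * x)) x := by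
  have hx' : (x : ℂ) ≠ 0 := by exact_mod_cast hx
  have e : (fun t : ℝ => Complex.log t +
      a / b * (ε * t) * hypSeries [a + 1, 1, 1] [b + 1, 2, 2] (ε * t)) =
      fun t : ℝ => Complex.log t + ε * t * powSum (kummerLogCoeff a b) (ε * t) := by
    funext t
    rw [← hypSeries_kummerLog]
    ring
  rw [e]
  refine ((hasDerivAt_clog_ofReal hx).fun_add ((hasDerivAt_ofReal_mul ε x).fun_mul
    (hasDerivAt_powSum_ofReal_mul (coeffBounded_kummerLog a b) ε x))).congr_deriv ?_
  have h := kummerLog_ode a b (ε * x)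
  refine mul_left_cancel₀ hx' ?_
  linear_combination h + (1 - kummerM a b (ε * x)) * mul_inv_cancel₀ hx'

theorem hasDerivAt_kummerMInt {ν : ℂ} (hν : ν = -1 ∨ NotNonposInt (ν + 1)) (a b : ℂ) {x : ℝ}
    (hx : x ≠ 0) :
    HasDerivAt (fun t : ℝ => kummerMInt ν a b t) ((x : ℂ) ^ ν * kummerM a b x) x := by
  by_cases h : ν = -1
  · simp only [kummerMInt, if_pos h]
    simpa [h, Complex.cpow_neg_one] using hasDerivAt_kummer_log a b 1 hx
  · simp only [kummerMInt, if_neg h]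
    simpa using hasDerivAt_kummer_integral (hν.resolve_left h) a b 1 hx

/-- Kummer's transformation absorbs the exponential into `M(b - a, b, -z)`, which is the case `ε =
-1` of the two integrals above. -/
theorem hasDerivAt_kummerMExpInt {ν : ℂ} (hν : ν = -1 ∨ NotNonposInt (ν + 1)) (a : ℂ) {b : ℂ}
    (hb : NotNonposInt b) {x : ℝ} (hx : x ≠ 0) :
    HasDerivAt (fun t : ℝ => kummerMExpInt ν a b t)
      (Complex.exp (-x) * (x : ℂ) ^ ν * kummerM a b x) x := by
  rw [mul_right_comm, exp_neg_mul_kummerM hb, mul_comm]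
  by_cases h : ν = -1
  · simp only [kummerMExpInt, if_pos h]
    simpa [h, Complex.cpow_neg_one] using hasDerivAt_kummer_log (b - a) b (-1) hx
  · simp only [kummerMExpInt, if_neg h]
    simpa using hasDerivAt_kummer_integral (hν.resolve_left h) (b - a) b (-1) hx

theorem kummerUInt_eq (ν a b z : ℂ) : kummerUInt ν a b z =
    kummerUCoeff₁ a b * kummerMInt ν a b z +
      kummerUCoeff₂ a b * kummerMInt (ν + 1 - b) (1 + a - b) (2 - b) z := by
  rw [kummerUInt, kummerUCoeff₁, kummerUCoeff₂]
  ring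

theorem kummerUExpInt_eq (ν a b z : ℂ) : kummerUExpInt ν a b z =
    kummerUCoeff₁ a b * kummerMExpInt ν a b z +
      kummerUCoeff₂ a b * kummerMExpInt (ν + 1 - b) (1 + a - b) (2 - b) z := by
  rw [kummerUExpInt, kummerUCoeff₁, kummerUCoeff₂]
  ring

theorem hasDerivAt_kummerUInt {ν a b : ℂ} (hν : ν = -1 ∨ NotNonposInt (ν + 1))
    (hν' : ν + 1 - b = -1 ∨ NotNonposInt (ν + 1 - b + 1)) {x : ℝ} (hx : x ≠ 0) :
    HasDerivAt (fun t : ℝ => kummerUInt ν a b t) ((x : ℂ) ^ ν * kummerU a b x) x := by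
  have hx' : (x : ℂ) ≠ 0 := by exact_mod_cast hx
  simp only [kummerUInt_eq]
  refine (((hasDerivAt_kummerMInt hν a b hx).const_mul (kummerUCoeff₁ a b)).fun_add
    ((hasDerivAt_kummerMInt hν' (1 + a - b) (2 - b) hx).const_mul
      (kummerUCoeff₂ a b))).congr_deriv ?_
  rw [kummerU_eq, add_sub_assoc, Complex.cpow_add _ _ hx']
  ring

theorem hasDerivAt_kummerUExpInt {ν a b : ℂ} (hb : ∀ k : ℤ, b ≠ k)
    (hν : ν = -1 ∨ NotNonposInt (ν + 1))
    (hν' : ν + 1 - b = -1 ∨ NotNonposInt (ν + 1 - b + 1)) {x : ℝ} (hx : x ≠ 0) :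
    HasDerivAt (fun t : ℝ => kummerUExpInt ν a b t)
      (Complex.exp (-x) * (x : ℂ) ^ ν * kummerU a b x) x := by
  have hx' : (x : ℂ) ≠ 0 := by exact_mod_cast hx
  simp only [kummerUExpInt_eq]
  refine (((hasDerivAt_kummerMExpInt hν a (notNonposInt_of_forall_ne hb) hx).const_mul
    (kummerUCoeff₁ a b)).fun_add ((hasDerivAt_kummerMExpInt hν' (1 + a - b)
      (notNonposInt_two_sub hb) hx).const_mul (kummerUCoeff₂ a b))).congr_deriv ?_
  rw [kummerU_eq, add_sub_assoc, Complex.cpow_add _ _ hx']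
  ring

/-! ### Variance linear in log-strike -/

namespace Segment

variable {M : Segment}

theorem mul_zLog (ha : M.a₂ ≠ 0) (χ : ℝ) : M.a₂ * M.zLog χ = M.v χ := by
  rw [zLog, v]
  field_simp
  ring

theorem isSignOf_zLog (ha : M.a₂ ≠ 0) {χ : ℝ} (hv : 0 < M.v χ) :
    IsSignOf (SignType.sign M.a₂ : ℝ) (M.zLog χ) := by
  rw [← mul_zLog ha] at hv
  rcases ha.lt_or_gt with h | h
  · exact Or.inr ⟨by simp [h], by nlinarith⟩
  · exact Or.inl ⟨by simp [h], by nlinarith⟩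

theorem eventually_v_pos {χ : ℝ} (hv : 0 < M.v χ) : ∀ᶠ t in 𝓝 χ, 0 < M.v t := by
  have h : ContinuousAt M.v χ := by
    unfold v
    fun_prop
  exact h.eventually_const_lt hv

/-- A solution of Kummer's equation gives a solution of the equation in log-strike. -/
theorem log_solution (ha : M.a₂ ≠ 0) {χ : ℝ} (hv : 0 < M.v χ) {f f' f'' u : ℝ → ℂ}
    (hf : HasDeriv2At f f' f'' (M.zLog χ))
    (ho : M.zLog χ * f'' (M.zLog χ) + (M.β₁ - M.zLog χ) * f' (M.zLog χ) -
      M.α₁ * f (M.zLog χ) = 0)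
    (hu : ∀ t, u t = (M.v t : ℂ) ^ ((M.β₁ : ℂ) - 1) * f (M.zLog t)) :
    ∃ u' u'' : ℝ → ℂ, HasDeriv2At u u' u'' χ ∧
      (-(M.v χ : ℂ) * u'' χ + (M.b₁ + M.v χ : ℝ) * u' χ + M.b₀ * u χ = 0) ∧
      u' χ = (M.v χ : ℂ) ^ ((M.β₁ : ℂ) - 1) *
        (((M.β₁ : ℂ) - 1) / M.zLog χ * f (M.zLog χ) + f' (M.zLog χ)) := by
  have hz : ∀ t, 1 * t + M.b₂ / M.a₂ = M.zLog t := fun t => by rw [one_mul, zLog]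
  have hw : ∀ t, M.a₂ * t + M.b₂ = M.v t := fun t => by rw [v, add_comm]
  have ha' : (M.a₂ : ℂ) ≠ 0 := by exact_mod_cast ha
  have hz0 : (M.zLog χ : ℂ) ≠ 0 := by exact_mod_cast (isSignOf_zLog ha hv).ne_zero
  have hv0 : (M.v χ : ℂ) ≠ 0 := by exact_mod_cast hv.ne'
  have e1 : HasDeriv2At (fun t : ℝ => ((M.a₂ * t + M.b₂ : ℝ) : ℂ) ^ ((M.β₁ : ℂ) - 1)) _ _ χ :=
    HasDeriv2At.comp_affine (f := fun t : ℝ => (t : ℂ) ^ ((M.β₁ : ℂ) - 1))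
      (hasDeriv2At_ofReal_cpow (by rw [hw]; exact hv.ne') _)
  have e2 : HasDeriv2At (fun t : ℝ => f (1 * t + M.b₂ / M.a₂)) _ _ χ :=
    HasDeriv2At.comp_affine (by rw [hz]; exact hf)
  refine ⟨_, _, (e1.mul e2).congr (.of_forall fun t => ?_), ?_, ?_⟩
  · simp only [hu, hw, hz]
  · simp only [hu, hw, hz]
    have hβ : (M.b₁ : ℂ) = M.a₂ * (M.β₁ - 2) := by
      rw [β₁]
      push_cast
      field_simp
      ring
    have hα : (M.b₀ : ℂ) = M.a₂ * (M.α₁ - M.β₁ + 1) := by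
      rw [β₁, α₁]
      push_cast
      field_simp
      ring
    simp only [Complex.cpow_sub _ _ hv0, Complex.cpow_one]
    push_cast
    rw [hβ, hα, ← mul_zLog ha χ]
    push_cast
    field_simp
    -- Divided by `a₂`, the equation reads `-z V'' + (β₁ - 2 + z) V' + (α₁ - β₁ + 1) V = 0`. For `V
    -- = z ^ (β₁ - 1) f` the terms in `f / z` cancel, and minus Kummer's equation for `f` remains.
    linear_combination (-((M.a₂ : ℂ) * M.zLog χ) ^ (M.β₁ : ℂ) * M.zLog χ) * ho
  · simp only [hw, hz]
    simp only [Complex.cpow_sub _ _ hv0, Complex.cpow_one]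
    rw [← mul_zLog ha χ]
    push_cast
    field_simp

/-- The two solutions in log-strike and their Wronskian. -/
theorem log_solutions (ha : M.a₂ ≠ 0) (hβ : ∀ k : ℤ, M.β₁ ≠ k) {χ : ℝ} (hv : 0 < M.v χ) :
    ∃ u₁' u₁'' u₂' u₂'' : ℝ → ℂ, HasDeriv2At M.u₁ u₁' u₁'' χ ∧ HasDeriv2At M.u₂ u₂' u₂'' χ ∧
      (-(M.v χ : ℂ) * u₁'' χ + (M.b₁ + M.v χ : ℝ) * u₁' χ + M.b₀ * M.u₁ χ = 0) ∧
      (-(M.v χ : ℂ) * u₂'' χ + (M.b₁ + M.v χ : ℝ) * u₂' χ + M.b₀ * M.u₂ χ = 0) ∧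
      wronskian M.u₁ M.u₂ χ = ((M.v χ : ℂ) ^ ((M.β₁ : ℂ) - 1)) ^ 2 *
        (Complex.exp (-(SignType.sign M.a₂ : ℝ) * (Real.pi * Complex.I * (M.β₁ - M.α₁))) *
          ((M.zLog χ : ℂ) ^ (-(M.β₁ : ℂ)) * Complex.exp (M.zLog χ))) := by
  have hβ' : ∀ k : ℤ, (M.β₁ : ℂ) ≠ k := fun k h => hβ k (by exact_mod_cast h)
  obtain ⟨f', f'', g', g'', hf, hg, of, og, w⟩ :=
    kummerU_solutions hβ' M.α₁ (isSignOf_zLog ha hv)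
  obtain ⟨u₁', u₁'', h1, o1, d1⟩ := log_solution ha hv hf of (u := M.u₁) fun t => by
    rw [u₁, mul_zLog ha]
  obtain ⟨u₂', u₂'', h2, o2, d2⟩ := log_solution ha hv hg og (u := M.u₂) fun t => by
    rw [u₂, mul_zLog ha]
    ring
  refine ⟨u₁', u₁'', u₂', u₂'', h1, h2, o1, o2, ?_⟩
  rw [wronskian, h1.deriv_eq, h2.deriv_eq, d1, d2, u₁, u₂, mul_zLog ha, ← w]
  ring

theorem log_wronskian_ne_zero (ha : M.a₂ ≠ 0) (hβ : ∀ k : ℤ, M.β₁ ≠ k) {χ : ℝ}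
    (hv : 0 < M.v χ) : wronskian M.u₁ M.u₂ χ ≠ 0 := by
  obtain ⟨_, _, _, _, -, -, -, -, w⟩ := log_solutions ha hβ hv
  have hz0 : (M.zLog χ : ℂ) ≠ 0 := by exact_mod_cast (isSignOf_zLog ha hv).ne_zero
  have hv0 : (M.v χ : ℂ) ≠ 0 := by exact_mod_cast hv.ne'
  rw [w]
  simp [Complex.cpow_eq_zero_iff, hz0, hv0]

/-- The integrand contains `v ^ (-β₁) z ^ β₁` and a phase from the Wronskian. Their product is the
constant `κ`, whose value depends on the sign of `a₂`; prescribing it by `hκ` treats both edge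
intervals at once. -/
theorem logIntegrand_eq (ha : M.a₂ ≠ 0) (hβ : ∀ k : ℤ, M.β₁ ≠ k) {χ : ℝ} (hv : 0 < M.v χ)
    (c : ℝ → ℝ) {κ : ℂ} (hκ : κ * (M.v χ : ℂ) ^ (M.β₁ : ℂ) =
      Complex.exp ((SignType.sign M.a₂ : ℝ) * (Real.pi * Complex.I * (M.β₁ - M.α₁))) *
        (M.zLog χ : ℂ) ^ (M.β₁ : ℂ)) :
    M.logIntegrand₁ c χ =
        κ * (c χ * Complex.exp (-M.zLog χ) * kummerU M.α₁ M.β₁ (M.zLog χ)) ∧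
      M.logIntegrand₂ c χ =
        κ * (c χ * kummerU (M.β₁ - M.α₁) M.β₁ (-(M.zLog χ : ℂ))) := by
  obtain ⟨_, _, _, _, -, -, -, -, w⟩ := log_solutions ha hβ hv
  have hz0 : (M.zLog χ : ℂ) ≠ 0 := by exact_mod_cast (isSignOf_zLog ha hv).ne_zero
  have hv0 : (M.v χ : ℂ) ≠ 0 := by exact_mod_cast hv.ne'
  have h1 : (M.v χ : ℂ) ^ (M.β₁ : ℂ) ≠ 0 := by simp [Complex.cpow_eq_zero_iff, hv0]
  have h2 : (M.zLog χ : ℂ) ^ (M.β₁ : ℂ) ≠ 0 := by simp [Complex.cpow_eq_zero_iff, hz0]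
  have h3 := Complex.exp_ne_zero (M.zLog χ)
  rw [eq_div_of_mul_eq h1 hκ]
  simp only [logIntegrand₁, logIntegrand₂, u₁, u₂, w, mul_zLog ha, Complex.cpow_sub _ _ hv0,
    Complex.cpow_one, Complex.cpow_neg, neg_mul, Complex.exp_neg]
  constructor <;> field_simp

theorem logSourceSolvesAt (ha : M.a₂ ≠ 0) (hβ : ∀ k : ℤ, M.β₁ ≠ k) {c : ℝ → ℝ} {G₁ G₂ : ℝ → ℂ}
    {χ : ℝ} (hv : 0 < M.v χ) (hc : ∀ t, 0 < M.v t → ContinuousAt c t)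
    (hG₁ : ∀ t, 0 < M.v t → HasDerivAt G₁ (M.logIntegrand₁ c t) t)
    (hG₂ : ∀ t, 0 < M.v t → HasDerivAt G₂ (M.logIntegrand₂ c t) t) :
    M.LogSourceSolvesAt c G₁ G₂ χ := by
  obtain ⟨_, _, _, _, h1, h2, o1, o2, -⟩ := log_solutions ha hβ hv
  have hV := eventually_v_pos hv
  refine solvesAt_source_term h1 h2 (q := fun t => (c t : ℂ)) (hV.mono fun t ht => ?_)
    (.of_forall fun t => ?_) hv.ne' (log_wronskian_ne_zero ha hβ hv)
    (hV.mono fun t ht => hG₁ t ht) (hV.mono fun t ht => hG₂ t ht) o1 o2 rfl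
  · exact Complex.continuous_ofReal.continuousAt.comp (hc t ht)
  · unfold v
    fun_prop

/-! #### The last interval -/

theorem zLog_pos (ha : 0 < M.a₂) {χ : ℝ} (hv : 0 < M.v χ) : 0 < M.zLog χ := by
  rw [← mul_zLog ha.ne'] at hv
  exact pos_of_mul_pos_right hv ha.le

theorem zLog_neg (ha : M.a₂ < 0) {χ : ℝ} (hv : 0 < M.v χ) : M.zLog χ < 0 := by
  rw [← mul_zLog ha.ne] at hv
  nlinarith

theorem hasDerivAt_comp_zLog {F : ℝ → ℂ} {F' : ℂ} {χ : ℝ} (h : HasDerivAt F F' (M.zLog χ)) :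
    HasDerivAt (fun t => F (M.zLog t)) F' χ := by
  have := h.scomp χ ((hasDerivAt_id χ).add_const (M.b₂ / M.a₂))
  rw [one_smul] at this
  exact this

theorem hasDerivAt_comp_neg {F : ℝ → ℂ} {F' : ℂ} {x : ℝ} (h : HasDerivAt F F' (-x)) :
    HasDerivAt (fun t => F (-t)) (-F') x := by
  have := h.scomp x (hasDerivAt_neg x)
  rw [neg_smul, one_smul] at this
  exact this

theorem neg_one_cpow (s : ℂ) : (-1 : ℂ) ^ s = Complex.exp (Real.pi * Complex.I * s) := by
  rw [Complex.cpow_def_of_ne_zero (by simp), Complex.log_neg_one]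

theorem last_integrand (ha : 0 < M.a₂) (hβ : ∀ k : ℤ, M.β₁ ≠ k) (γ ν : ℝ) {χ : ℝ}
    (hv : 0 < M.v χ) :
    M.logIntegrand₁ (M.powerSource γ ν) χ = M.ξInf γ * (Complex.exp (-M.zLog χ) *
        (M.zLog χ : ℂ) ^ (-(ν : ℂ)) * kummerU M.α₁ M.β₁ (M.zLog χ)) ∧
      M.logIntegrand₂ (M.powerSource γ ν) χ = M.ξInf γ * ((M.zLog χ : ℂ) ^ (-(ν : ℂ)) *
        kummerU (M.β₁ - M.α₁) M.β₁ (-(M.zLog χ : ℂ))) := by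
  have hz := zLog_pos ha hv
  have ha0 : (M.a₂ : ℂ) ≠ 0 := by exact_mod_cast ha.ne'
  have hκ : (-1 : ℂ) ^ ((M.β₁ : ℂ) - M.α₁) * (M.a₂ : ℂ) ^ (-(M.β₁ : ℂ)) *
      (M.v χ : ℂ) ^ (M.β₁ : ℂ) =
      Complex.exp ((SignType.sign M.a₂ : ℝ) * (Real.pi * Complex.I * (M.β₁ - M.α₁))) *
        (M.zLog χ : ℂ) ^ (M.β₁ : ℂ) := by
    have h1 : (M.a₂ : ℂ) ^ (M.β₁ : ℂ) ≠ 0 := by simp [Complex.cpow_eq_zero_iff, ha0]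
    rw [← mul_zLog ha.ne', Complex.ofReal_mul, Complex.mul_cpow_ofReal_nonneg ha.le hz.le,
      neg_one_cpow, Complex.cpow_neg]
    simp only [sign_pos ha, SignType.coe_one, Complex.ofReal_one, one_mul]
    field_simp
  have hc : (M.powerSource γ ν χ : ℂ) = γ * (M.zLog χ : ℂ) ^ (-(ν : ℂ)) := by
    rw [powerSource, Complex.ofReal_mul, Complex.ofReal_cpow hz.le, Complex.ofReal_neg]
  obtain ⟨h1, h2⟩ := logIntegrand_eq ha.ne' hβ hv (M.powerSource γ ν) hκ
  rw [h1, h2, hc, ξInf]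
  constructor <;> ring

theorem hasDerivAt_lastKummer (ha : 0 < M.a₂) (hβ : ∀ k : ℤ, M.β₁ ≠ k) (γ : ℝ) {ν : ℝ}
    (hν : NotNonposInt (1 - ν)) (hν' : NotNonposInt (2 - M.β₁ - ν)) {χ : ℝ} (hv : 0 < M.v χ) :
    HasDerivAt (M.lastKummer₁ γ ν) (M.logIntegrand₁ (M.powerSource γ ν) χ) χ ∧
      HasDerivAt (M.lastKummer₂ γ ν) (M.logIntegrand₂ (M.powerSource γ ν) χ) χ := by
  have hβ' : ∀ k : ℤ, (M.β₁ : ℂ) ≠ k := fun k h => hβ k (by exact_mod_cast h)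
  have hz := zLog_pos ha hv
  have n1 : NotNonposInt (-(ν : ℂ) + 1) := by rwa [neg_add_eq_sub]
  have n2 : NotNonposInt (-(ν : ℂ) + 1 - M.β₁ + 1) := by
    rwa [show -(ν : ℂ) + 1 - M.β₁ + 1 = 2 - M.β₁ - ν by ring]
  obtain ⟨h1, h2⟩ := last_integrand ha hβ γ ν hv
  rw [h1, h2]
  constructor
  · exact (hasDerivAt_comp_zLog (hasDerivAt_kummerUExpInt hβ' (.inr n1) (.inr n2)
      hz.ne')).const_mul (M.ξInf γ)
  · have e := (hasDerivAt_comp_zLog (hasDerivAt_comp_neg (hasDerivAt_kummerUInt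
      (a := M.β₁ - M.α₁) (b := M.β₁) (.inr n1) (.inr n2) (neg_ne_zero.2 hz.ne')))).const_mul
        ((-1 : ℂ) ^ ((ν : ℂ) + 1) * M.ξInf γ)
    simp only [Complex.ofReal_neg] at e
    refine e.congr_deriv ?_
    -- Differentiating in `-z` gives a factor `-1`, and `(-z) ^ (-ν)` gives the phase `exp(-iπν)`;
    -- the prefactor `(-1) ^ (ν + 1)` cancels both.
    rw [neg_cpow_of_isSignOf (σ := 1) (.inl ⟨rfl, hz⟩), neg_one_cpow, mul_add, mul_one,
      Complex.exp_add, Complex.exp_pi_mul_I]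
    have h3 : Complex.exp (Real.pi * Complex.I * ν) *
        Complex.exp ((1 : ℝ) * (Real.pi * Complex.I * -(ν : ℂ))) = 1 := by
      rw [← Complex.exp_add]
      simp
    linear_combination (M.ξInf γ * ((M.zLog χ : ℂ) ^ (-(ν : ℂ)) *
      kummerU (M.β₁ - M.α₁) M.β₁ (-(M.zLog χ : ℂ)))) * h3

theorem continuousAt_powerSource (ha : 0 < M.a₂) (γ ν : ℝ) {χ : ℝ} (hv : 0 < M.v χ) :
    ContinuousAt (M.powerSource γ ν) χ := by
  have h : ContinuousAt M.zLog χ := by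
    unfold zLog
    fun_prop
  exact continuousAt_const.mul (h.rpow_const (.inl (zLog_pos ha hv).ne'))

/-! #### The first interval -/

theorem first_integrand (ha : M.a₂ < 0) (hβ : ∀ k : ℤ, M.β₁ ≠ k) (ω : ℝ) {χ : ℝ}
    (hv : 0 < M.v χ) :
    M.logIntegrand₁ (M.expSource ω) χ = M.ξZero ω * ((M.zLog χ : ℂ)⁻¹ *
        kummerU M.α₁ M.β₁ (M.zLog χ)) ∧
      M.logIntegrand₂ (M.expSource ω) χ = M.ξZero ω * (Complex.exp (M.zLog χ) *
        (M.zLog χ : ℂ)⁻¹ * kummerU (M.β₁ - M.α₁) M.β₁ (-(M.zLog χ : ℂ))) := by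
  have hz := zLog_neg ha hv
  have ha0 : ((|M.a₂| : ℝ) : ℂ) ≠ 0 := by exact_mod_cast (abs_pos.2 ha.ne).ne'
  have hκ : Complex.exp (Complex.I * Real.pi * M.α₁) * ((|M.a₂| : ℝ) : ℂ) ^ (-(M.β₁ : ℂ)) *
      (M.v χ : ℂ) ^ (M.β₁ : ℂ) =
      Complex.exp ((SignType.sign M.a₂ : ℝ) * (Real.pi * Complex.I * (M.β₁ - M.α₁))) *
        (M.zLog χ : ℂ) ^ (M.β₁ : ℂ) := by
    have h1 : ((|M.a₂| : ℝ) : ℂ) ^ (M.β₁ : ℂ) ≠ 0 := by simp [Complex.cpow_eq_zero_iff, ha0]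
    have h2 : M.v χ = |M.a₂| * -M.zLog χ := by
      rw [← mul_zLog ha.ne, abs_of_neg ha]
      ring
    rw [h2, Complex.ofReal_mul, Complex.mul_cpow_ofReal_nonneg (abs_nonneg _) (by linarith),
      Complex.ofReal_neg, neg_cpow_of_isSignOf (σ := -1) (.inr ⟨rfl, hz⟩), Complex.cpow_neg]
    simp only [sign_neg ha, SignType.coe_neg, SignType.coe_one, Complex.ofReal_neg,
      Complex.ofReal_one]
    -- For `z < 0` one has `(-z) ^ β₁ = exp(-iπβ₁) z ^ β₁`. Together with the phase of the Wronskian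
    -- this turns the constant into `exp(iπα₁)`.
    have h3 : Complex.exp (Complex.I * Real.pi * M.α₁) *
        Complex.exp (-1 * (Real.pi * Complex.I * M.β₁)) =
        Complex.exp (-1 * (Real.pi * Complex.I * (M.β₁ - M.α₁))) := by
      rw [← Complex.exp_add]
      ring_nf
    rw [← h3]
    field_simp
  have hc : (M.expSource ω χ : ℂ) = ω * Complex.exp (M.zLog χ) * (M.zLog χ : ℂ)⁻¹ := by
    rw [expSource]
    push_cast
    rfl
  have h3 : Complex.exp (M.zLog χ) * Complex.exp (-M.zLog χ) = 1 := by
    rw [← Complex.exp_add]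
    simp
  obtain ⟨h1, h2⟩ := logIntegrand_eq ha.ne hβ hv (M.expSource ω) hκ
  rw [h1, h2, hc, ξZero]
  constructor
  · linear_combination (Complex.exp (Complex.I * Real.pi * M.α₁) * ω *
      ((|M.a₂| : ℝ) : ℂ) ^ (-(M.β₁ : ℂ)) * ((M.zLog χ : ℂ)⁻¹ *
        kummerU M.α₁ M.β₁ (M.zLog χ))) * h3
  · ring

theorem hasDerivAt_firstKummer (ha : M.a₂ < 0) (hβ : ∀ k : ℤ, M.β₁ ≠ k) (ω : ℝ) {χ : ℝ}
    (hv : 0 < M.v χ) :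
    HasDerivAt (M.firstKummer₁ ω) (M.logIntegrand₁ (M.expSource ω) χ) χ ∧
      HasDerivAt (M.firstKummer₂ ω) (M.logIntegrand₂ (M.expSource ω) χ) χ := by
  have hβ' : ∀ k : ℤ, (M.β₁ : ℂ) ≠ k := fun k h => hβ k (by exact_mod_cast h)
  have hz := zLog_neg ha hv
  have n2 : NotNonposInt (-1 + 1 - (M.β₁ : ℂ) + 1) := fun n h =>
    hβ' (1 + n) (by push_cast; linear_combination -h)
  obtain ⟨h1, h2⟩ := first_integrand ha hβ ω hv
  rw [h1, h2]
  constructor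
  · have e := (hasDerivAt_comp_zLog (hasDerivAt_kummerUInt (a := M.α₁) (b := M.β₁) (.inl rfl)
      (.inr n2) hz.ne)).const_mul (M.ξZero ω)
    rw [Complex.cpow_neg_one] at e
    exact e
  · have e := (hasDerivAt_comp_zLog (hasDerivAt_comp_neg (hasDerivAt_kummerUExpInt
      (a := M.β₁ - M.α₁) hβ' (.inl rfl) (.inr n2) (neg_ne_zero.2 hz.ne)))).const_mul (M.ξZero ω)
    simp only [Complex.ofReal_neg] at e
    refine e.congr_deriv ?_
    -- The sign of the inner derivative cancels that of `(-z)⁻¹`, so no phase is needed here.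
    rw [Complex.cpow_neg_one, neg_neg, inv_neg]
    ring

theorem continuousAt_expSource (ha : M.a₂ < 0) (ω : ℝ) {χ : ℝ} (hv : 0 < M.v χ) :
    ContinuousAt (M.expSource ω) χ := by
  have h : ContinuousAt M.zLog χ := by
    unfold zLog
    fun_prop
  exact (continuousAt_const.mul (Real.continuous_exp.continuousAt.comp h)).div h
    (zLog_neg ha hv).ne

end Segment

/-! ### Residues -/

/-- By Cauchy's formula for the derivative the integral is the same over all small circles, so the
limit is that of a constant. -/
theorem residueAt_div_sq {f g : ℂ → ℂ} {s₀ : ℂ} (hg : AnalyticAt ℂ g s₀)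
    (h : ∀ᶠ s in 𝓝[≠] s₀, f s = g s / (s - s₀) ^ 2) : residueAt f s₀ = deriv g s₀ := by
  refine Tendsto.limUnder_eq (tendsto_const_nhds.congr' ?_)
  obtain ⟨r₁, hr₁, h1⟩ := Metric.eventually_nhds_iff_ball.1 hg.eventually_analyticAt
  obtain ⟨r₂, hr₂, h2⟩ := Metric.eventually_nhds_iff_ball.1 (eventually_nhdsWithin_iff.1 h)
  have hr : 0 < min r₁ r₂ := lt_min hr₁ hr₂
  filter_upwards [Ioo_mem_nhdsGT hr] with ε hε
  have h3 : Metric.closedBall s₀ ε ⊆ Metric.ball s₀ r₁ :=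
    Metric.closedBall_subset_ball (hε.2.trans_le (min_le_left _ _))
  rw [← Complex.two_pi_I_inv_smul_circleIntegral_sub_sq_inv_smul_of_differentiable
    Metric.isOpen_ball h3 (fun s hs => (h1 s hs).differentiableAt.differentiableWithinAt)
    (Metric.mem_ball_self hε.1), smul_eq_mul]
  congr 1
  refine circleIntegral.integral_congr hε.1.le fun s hs => ?_
  have hs' : dist s s₀ = ε := hs
  have hne : s ≠ s₀ := fun h => by
    rw [h, dist_self] at hs'
    exact hε.1.ne hs'
  rw [h2 s (by rw [Metric.mem_ball, hs']; exact hε.2.trans_le (min_le_right _ _)) hne,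
    smul_eq_mul, div_eq_inv_mul]

theorem residueAt_div {f g : ℂ → ℂ} {s₀ : ℂ} (hg : AnalyticAt ℂ g s₀)
    (h : ∀ᶠ s in 𝓝[≠] s₀, f s = g s / (s - s₀)) : residueAt f s₀ = g s₀ := by
  have hd : HasDerivAt (fun s => g s * (s - s₀)) (g s₀) s₀ := by
    have := hg.differentiableAt.hasDerivAt.fun_mul ((hasDerivAt_id s₀).sub_const s₀)
    simpa using this
  rw [residueAt_div_sq (g := fun s => g s * (s - s₀))
    (hg.mul (analyticAt_id.sub analyticAt_const)), hd.deriv]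
  filter_upwards [h, self_mem_nhdsWithin] with s hs hne
  have : s - s₀ ≠ 0 := sub_ne_zero.2 hne
  rw [hs]
  field_simp

theorem analyticAt_Gamma {s : ℂ} (hs : NotNonposInt s) : AnalyticAt ℂ Complex.Gamma s := by
  have h := (Complex.differentiable_one_div_Gamma.analyticAt s).inv
    (inv_ne_zero (Complex.Gamma_ne_zero hs))
  exact h.congr (.of_forall fun t => inv_inv _)

theorem analyticAt_Gamma_sub {b s : ℂ} (hs : NotNonposInt (b - s)) :
    AnalyticAt ℂ (fun s => Complex.Gamma (b - s)) s :=
  (analyticAt_Gamma hs).fun_comp (analyticAt_const.sub analyticAt_id)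

theorem analyticAt_Gamma_add {b s : ℂ} (hs : NotNonposInt (b + s)) :
    AnalyticAt ℂ (fun s => Complex.Gamma (b + s)) s :=
  (analyticAt_Gamma hs).fun_comp (analyticAt_const.add analyticAt_id)

theorem analyticAt_inv_Gamma_sub (b s : ℂ) :
    AnalyticAt ℂ (fun s => (Complex.Gamma (b - s))⁻¹) s :=
  AnalyticAt.fun_comp (g := fun s => (Complex.Gamma s)⁻¹)
    (Complex.differentiable_one_div_Gamma.analyticAt (b - s))
    (analyticAt_const.sub analyticAt_id)

theorem analyticAt_const_cpow {w : ℂ} (hw : w ≠ 0) (s : ℂ) : AnalyticAt ℂ (fun s => w ^ s) s := by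
  have h : Differentiable ℂ fun s : ℂ => w ^ s := fun s =>
    differentiableAt_id.const_cpow (.inl hw)
  exact h.analyticAt s

/-- The poles of the Gamma function. -/
theorem exists_Gamma_sub_eq_div (b : ℂ) (k : ℕ) : ∃ ρ : ℂ → ℂ, AnalyticAt ℂ ρ (b + k) ∧
    ρ (b + k) = -((-1) ^ k / (k ! : ℂ)) ∧
    ∀ᶠ s in 𝓝[≠] (b + k), Complex.Gamma (b - s) = ρ s / (s - (b + k)) := by
  induction k generalizing b with
  | zero =>
    refine ⟨fun s => -Complex.Gamma (b + 1 - s), ?_, by simp, ?_⟩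
    · refine (analyticAt_Gamma_sub fun n h => ?_).neg
      have : ((n + 1 : ℕ) : ℂ) = 0 := by
        push_cast at h ⊢
        linear_combination h
      exact n.succ_ne_zero (by exact_mod_cast this)
    · filter_upwards [self_mem_nhdsWithin] with s hs
      have hs' : s ≠ b := by simpa using hs
      have h1 : b - s ≠ 0 := sub_ne_zero.2 (Ne.symm hs')
      have h2 : s - b ≠ 0 := sub_ne_zero.2 hs'
      have h3 := Complex.Gamma_add_one (b - s) h1
      rw [show b + 1 - s = b - s + 1 by ring, h3]
      simp only [Nat.cast_zero, add_zero]
      field_simp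
      ring
  | succ k ih =>
    obtain ⟨ρ, h1, h2, h3⟩ := ih (b + 1)
    have e : b + 1 + k = b + (k + 1 : ℕ) := by
      push_cast
      ring
    rw [e] at h1 h2 h3
    have hk : ((k : ℂ) + 1) ≠ 0 := by exact_mod_cast k.succ_ne_zero
    have hf : (k ! : ℂ) ≠ 0 := by exact_mod_cast k.factorial_ne_zero
    have hb : b - (b + (k + 1 : ℕ)) ≠ 0 := by
      push_cast
      rw [sub_add_cancel_left]
      exact neg_ne_zero.2 hk
    -- `Γ(b - s) = Γ(b + 1 - s) / (b - s)`, and the pole in question has index `k` relative to `b +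
    -- 1`.
    refine ⟨fun s => ρ s / (b - s), h1.div (analyticAt_const.sub analyticAt_id) hb, ?_, ?_⟩
    · dsimp only
      rw [h2, Nat.factorial_succ, sub_add_cancel_left, pow_succ]
      push_cast
      field_simp
    · have hne : ∀ᶠ s in 𝓝 (b + (k + 1 : ℕ)), b - s ≠ 0 :=
        (continuousAt_const.sub continuousAt_id).eventually_ne hb
      filter_upwards [h3, nhdsWithin_le_nhds hne] with s hs hbs
      rw [show b + 1 - s = b - s + 1 by ring, Complex.Gamma_add_one _ hbs] at hs
      rw [div_right_comm, ← hs]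
      field_simp

theorem residueAt_Gamma_mul {f R : ℂ → ℂ} {b : ℂ} {k : ℕ} (hR : AnalyticAt ℂ R (b + k))
    (h : ∀ᶠ s in 𝓝[≠] (b + k), f s = Complex.Gamma (b - s) * R s) :
    residueAt f (b + k) = -((-1) ^ k / (k ! : ℂ)) * R (b + k) := by
  obtain ⟨ρ, h1, h2, h3⟩ := exists_Gamma_sub_eq_div b k
  rw [residueAt_div (g := fun s => ρ s * R s) (h1.mul hR), h2]
  filter_upwards [h, h3] with s hs hs'
  rw [hs, hs', div_mul_eq_mul_div]

theorem Gamma_sub_nat {b : ℂ} (hb : ∀ k : ℤ, b ≠ k) (n : ℕ) :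
    Complex.Gamma (b - n) = Complex.Gamma b * (-1) ^ n / rising (1 - b) n := by
  induction n with
  | zero => simp [rising_zero]
  | succ n ih =>
    have h1 : b - (n + 1 : ℕ) ≠ 0 := sub_ne_zero.2 fun h => hb (n + 1 : ℕ) (by exact_mod_cast h)
    have h2 : 1 - b + n ≠ 0 := fun h => h1 (by push_cast; linear_combination -h)
    have h3 := Complex.Gamma_add_one _ h1
    rw [show b - (n + 1 : ℕ) + 1 = b - n by push_cast; ring, ih] at h3
    refine mul_left_cancel₀ h1 (h3.symm.trans ?_)
    rw [rising_succ, mul_comm (rising _ _), ← div_div, show b - (n + 1 : ℕ) = -(1 - b + n) by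
      push_cast; ring, pow_succ]
    field_simp

/-- Unlike the formula for `Γ` itself this needs no condition on `b`, since `1 / Γ` is entire and
the poles become zeros. -/
theorem inv_Gamma_sub_nat (b : ℂ) (n : ℕ) :
    (Complex.Gamma (b - n))⁻¹ = (Complex.Gamma b)⁻¹ * ((-1) ^ n * rising (1 - b) n) := by
  induction n with
  | zero => simp [rising_zero]
  | succ n ih =>
    rw [Complex.one_div_Gamma_eq_self_mul_one_div_Gamma_add_one,
      show b - (n + 1 : ℕ) + 1 = b - n by push_cast; ring, ih, rising_succ]
    push_cast
    ring

theorem Gamma_add_nat {b : ℂ} (hb : NotNonposInt b) (n : ℕ) :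
    Complex.Gamma (b + n) = Complex.Gamma b * rising b n := by
  induction n with
  | zero => simp [rising_zero]
  | succ n ih =>
    rw [show b + (n + 1 : ℕ) = b + n + 1 by push_cast; ring, Complex.Gamma_add_one _ fun h =>
      hb n (eq_neg_of_add_eq_zero_left h), ih, rising_succ]
    ring

/-! ### Residue series -/

/-- As `b' - b` is not an integer, the two ladders of poles are disjoint. The index is a set of
points, so a repeated parameter in `l` adds nothing. -/
theorem tsum_poles {F : ℂ → ℂ} {l : List ℂ} {b b' S S' : ℂ} (hl : ∀ x, x ∈ l ↔ x = b ∨ x = b')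
    (hbb : ∀ k : ℤ, b' - b ≠ k) (hS : HasSum (fun k : ℕ => F (b + k)) S)
    (hS' : HasSum (fun k : ℕ => F (b' + k)) S') :
    ∑' s : {s : ℂ // ∃ x ∈ l, ∃ k : ℕ, s = x + k}, F s = S + S' := by
  let e : ℕ ⊕ ℕ → {s : ℂ // ∃ x ∈ l, ∃ k : ℕ, s = x + k} :=
    Sum.elim (fun k => ⟨b + k, b, (hl b).2 (.inl rfl), k, rfl⟩)
      (fun k => ⟨b' + k, b', (hl b').2 (.inr rfl), k, rfl⟩)
  have hne : ∀ j k : ℕ, b + j ≠ b' + k := fun j k h =>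
    hbb (j - k) (by push_cast; linear_combination -h)
  have he : Function.Bijective e := by
    constructor
    · rintro (j | j) (k | k) h
      · have h' : b + (j : ℂ) = b + k := congrArg Subtype.val h
        rw [Nat.cast_injective (add_left_cancel h')]
      · exact absurd (congrArg Subtype.val h) (hne j k)
      · exact absurd (congrArg Subtype.val h).symm (hne k j)
      · have h' : b' + (j : ℂ) = b' + k := congrArg Subtype.val h
        rw [Nat.cast_injective (add_left_cancel h')]
    · rintro ⟨s, x, hx, k, rfl⟩
      rcases (hl x).1 hx with rfl | rfl
      exacts [⟨.inl k, rfl⟩, ⟨.inr k, rfl⟩]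
  rw [← (Equiv.ofBijective e he).tsum_eq]
  exact (HasSum.sum hS hS').tsum_eq

/-- The residues at a sequence of simple poles add up to the integral of a Kummer function. -/
theorem hasSum_residueAt_simple {f H : ℂ → ℂ} {b b' t h w ε : ℂ} (hbb : ∀ k : ℤ, b' - b ≠ k)
    (ht : NotNonposInt (t + b)) (hw : w ≠ 0) (hH : ∀ k : ℕ, AnalyticAt ℂ H (b + k))
    (hHk : ∀ k : ℕ, H (b + k) = H b * (ε ^ k * rising h k))
    (hf : ∀ k : ℕ, ∀ᶠ s in 𝓝[≠] (b + k),
      f s = Complex.Gamma (b - s) * (Complex.Gamma (b' - s) * H s / (t + s) * w ^ s)) :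
    HasSum (fun k : ℕ => residueAt f (b + k)) (-(Complex.Gamma (b' - b) * H b *
      (w ^ b / (t + b) * powSum (kummerIntCoeff (t + b) h (1 + b - b')) (ε * w)))) := by
  have ht' : ∀ k : ℕ, t + (b + k) ≠ 0 := fun k h =>
    ht k (eq_neg_of_add_eq_zero_left (by rw [add_assoc]; exact h))
  have ht0 : t + b ≠ 0 := by simpa using ht' 0
  have key := (((coeffBounded_kummerInt (t + b) h (1 + b - b') _).hasSum
    (norm_lt_add_one (ε * w))).mul_left (Complex.Gamma (b' - b) * H b * (w ^ b / (t + b)))).neg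
  rw [mul_assoc (_ * _) (_ / _)] at key
  refine Eq.mpr (congrArg (fun f => HasSum f _) (funext fun k => ?_)) key
  have hg : NotNonposInt (b' - (b + k)) := fun n h =>
    hbb (k - n) (by push_cast; linear_combination h)
  rw [residueAt_Gamma_mul (R := fun s => Complex.Gamma (b' - s) * H s / (t + s) * w ^ s) ((((analyticAt_Gamma_sub hg).mul (hH k)).div
    (analyticAt_const.add analyticAt_id) (ht' k)).mul (analyticAt_const_cpow hw _)) (hf k)]
  -- One sign comes from the residue of `Γ(b - s)`, the other from `Γ(b' - b - k)`; the latter also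
  -- supplies the lower parameter `1 + b - b'` of Kummer's series.
  have h1 : ((-1 : ℂ) ^ k) * (-1) ^ k = 1 := by rw [← mul_pow]; simp
  have h2 : rising (1 + b - b') k ≠ 0 := rising_ne_zero (fun n h =>
    hbb (n + 1) (by push_cast; linear_combination -h)) k
  have h3 : (k ! : ℂ) ≠ 0 := by exact_mod_cast k.factorial_ne_zero
  have h4 : t + b + k ≠ 0 := by rw [add_assoc]; exact ht' k
  rw [hHk, ← sub_sub, Gamma_sub_nat hbb, show 1 - (b' - b) = 1 + b - b' by ring,
    Complex.cpow_add _ _ hw, Complex.cpow_natCast, ← add_assoc, kummerIntCoeff, kummerCoeff,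
    mul_pow]
  field_simp
  linear_combination (-(Complex.Gamma (b' - b) * H b * ε ^ k * rising h k * w ^ b)) * h1

/-- The residues at a double pole, followed by a sequence of simple poles, add up to the
logarithmic integral of a Kummer function. -/
theorem hasSum_residueAt_double {f H : ℂ → ℂ} {b h w ε : ℂ} (hb : ∀ k : ℤ, b ≠ k) (hw : w ≠ 0)
    (hH : ∀ k : ℕ, AnalyticAt ℂ H k) (hHk : ∀ k : ℕ, H k = H 0 * (ε ^ k * rising h k))
    (hf : ∀ k : ℕ, ∀ᶠ s in 𝓝[≠] (k : ℂ),
      f s = Complex.Gamma (0 - s) * (Complex.Gamma (b - s) * H s / s * w ^ s)) :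
    HasSum (fun k : ℕ => residueAt f k)
      (-(deriv (fun s => Complex.Gamma (1 - s) * Complex.Gamma (b - s) * H s) 0 +
        Complex.Gamma b * H 0 *
          (Complex.log w + ε * w * powSum (kummerLogCoeff h (1 - b)) (ε * w)))) := by
  have hg : ∀ k : ℕ, NotNonposInt (b - k) := fun k n h =>
    hb (k - n) (by push_cast; linear_combination h)
  have key := (((coeffBounded_kummerLog h (1 - b) _).hasSum
    (norm_lt_add_one (ε * w))).mul_left (Complex.Gamma b * H 0 * (ε * w))).neg
  -- Here `Γ(-s) = -Γ(1 - s) / s` meets the factor `1 / s`. The derivative of the remaining product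
  -- at `0` consists of `log w`, from `w ^ s`, and a term independent of `w`.
  have h0 : residueAt f (0 : ℕ) =
      -(deriv (fun s => Complex.Gamma (1 - s) * Complex.Gamma (b - s) * H s) 0 +
        Complex.Gamma b * H 0 * Complex.log w) := by
    have a1 : AnalyticAt ℂ (fun s => Complex.Gamma (1 - s) * Complex.Gamma (b - s) * H s) 0 := by
      refine ((analyticAt_Gamma_sub fun n h => ?_).mul (analyticAt_Gamma_sub ?_)).mul ?_
      · have : ((n + 1 : ℕ) : ℂ) = 0 := by
          push_cast
          linear_combination h
        exact n.succ_ne_zero (by exact_mod_cast this)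
      · simpa using hg 0
      · simpa using hH 0
    have a2 := analyticAt_const_cpow hw 0
    have d2 : HasDerivAt (fun s : ℂ => w ^ s) (Complex.log w) 0 := by
      simpa using (hasDerivAt_id (0 : ℂ)).const_cpow (c := w) (.inl hw)
    have d := (a1.differentiableAt.hasDerivAt.fun_mul d2).fun_neg
    rw [Nat.cast_zero, residueAt_div_sq (a1.mul a2).neg ?_]
    · refine d.deriv.trans ?_
      simp
    · have hf0 := hf 0
      rw [Nat.cast_zero] at hf0
      filter_upwards [hf0, self_mem_nhdsWithin] with s hs hne
      have hne' : s ≠ 0 := hne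
      have h1 := Complex.Gamma_add_one (-s) (neg_ne_zero.2 hne')
      rw [neg_add_eq_sub] at h1
      rw [hs, sub_zero, Pi.neg_apply, Pi.mul_apply, h1, zero_sub]
      field_simp
  refine (hasSum_nat_add_iff' 1).1 ?_
  rw [Finset.sum_range_one, h0]
  have e : -(deriv (fun s => Complex.Gamma (1 - s) * Complex.Gamma (b - s) * H s) 0 +
        Complex.Gamma b * H 0 *
          (Complex.log w + ε * w * powSum (kummerLogCoeff h (1 - b)) (ε * w))) -
      -(deriv (fun s => Complex.Gamma (1 - s) * Complex.Gamma (b - s) * H s) 0 +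
        Complex.Gamma b * H 0 * Complex.log w) =
      -(Complex.Gamma b * H 0 * (ε * w) * powSum (kummerLogCoeff h (1 - b)) (ε * w)) := by
    ring
  rw [e]
  refine Eq.mpr (congrArg (fun f => HasSum f _) (funext fun k => ?_)) key
  have hk : ((k + 1 : ℕ) : ℂ) ≠ 0 := by exact_mod_cast k.succ_ne_zero
  have r := residueAt_Gamma_mul (f := f) (b := 0) (k := k + 1)
    (R := fun s => Complex.Gamma (b - s) * H s / s * w ^ s)
    (by
      rw [zero_add]
      exact (((analyticAt_Gamma_sub (hg _)).mul (hH _)).div analyticAt_id hk).mul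
        (analyticAt_const_cpow hw _))
    (by rw [zero_add]; exact hf (k + 1))
  rw [zero_add] at r
  rw [r]
  have h1 : ((-1 : ℂ) ^ (k + 1)) * (-1) ^ (k + 1) = 1 := by rw [← mul_pow]; simp
  have h2 : rising (1 - b) (k + 1) ≠ 0 := rising_ne_zero (fun n h =>
    hb (n + 1) (by push_cast; linear_combination -h)) _
  have h3 : ((k + 1)! : ℂ) ≠ 0 := by exact_mod_cast (k + 1).factorial_ne_zero
  rw [hHk, Gamma_sub_nat hb, Complex.cpow_natCast, kummerLogCoeff, kummerCoeff, mul_pow,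
    ← Nat.cast_add_one]
  field_simp
  linear_combination (-(Complex.Gamma b * H 0 * ε ^ (k + 1) * w ^ (k + 1) *
    rising h (k + 1))) * h1

/-! ### Meijer's functions as integrals of Kummer's functions -/

theorem kummerMInt_eq {ν : ℂ} (hν : NotNonposInt (ν + 1)) (a b w : ℂ) : kummerMInt ν a b w =
    w ^ (ν + 1) / (ν + 1) * powSum (kummerIntCoeff (ν + 1) a b) w := by
  have h : ν ≠ -1 := fun h => hν 0 (by simp [h])
  rw [kummerMInt, if_neg h, show ν + 2 = ν + 1 + 1 by ring, hypSeries_kummerInt hν]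

theorem kummerMExpInt_eq {ν : ℂ} (hν : NotNonposInt (ν + 1)) (a b w : ℂ) :
    kummerMExpInt ν a b w =
      w ^ (ν + 1) / (ν + 1) * powSum (kummerIntCoeff (ν + 1) (b - a) b) (-1 * w) := by
  have h : ν ≠ -1 := fun h => hν 0 (by simp [h])
  rw [kummerMExpInt, if_neg h, show ν + 2 = ν + 1 + 1 by ring, hypSeries_kummerInt hν, neg_one_mul]

theorem kummerMInt_neg_one (a b w : ℂ) : kummerMInt (-1) a b w =
    Complex.log w + w * powSum (kummerLogCoeff a b) w := by
  rw [kummerMInt, if_pos rfl, ← hypSeries_kummerLog]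
  ring

theorem kummerMExpInt_neg_one (a b w : ℂ) : kummerMExpInt (-1) a b w =
    Complex.log w + -1 * w * powSum (kummerLogCoeff (b - a) b) (-1 * w) := by
  rw [kummerMExpInt, if_pos rfl, neg_one_mul, ← hypSeries_kummerLog]
  ring

theorem kummerUCoeff₁_eq {b : ℂ} (hb : ∀ k : ℤ, b ≠ k) (a : ℂ) :
    kummerUCoeff₁ a b = Complex.Gamma (1 - b) * (Complex.Gamma (1 + a - b))⁻¹ := by
  have h := Complex.Gamma_ne_zero (notNonposInt_of_forall_ne hb)
  rw [kummerUCoeff₁, ← Complex.Gamma_mul_Gamma_one_sub]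
  field_simp

theorem kummerUCoeff₂_eq {b : ℂ} (hb : ∀ k : ℤ, b ≠ k) (a : ℂ) :
    kummerUCoeff₂ a b = Complex.Gamma (b - 1) * (Complex.Gamma a)⁻¹ := by
  have h := Complex.Gamma_ne_zero (notNonposInt_two_sub hb)
  have e := Complex.Gamma_mul_Gamma_one_sub (b - 1)
  rw [show 1 - (b - 1) = 2 - b by ring, mul_sub, mul_one, Complex.sin_sub_pi, div_neg] at e
  rw [kummerUCoeff₂, ← neg_div, ← e]
  field_simp

theorem eventually_Gamma_ne_zero {t s₀ : ℂ} (h : NotNonposInt (t + s₀)) :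
    ∀ᶠ s in 𝓝 s₀, Complex.Gamma (t + s) ≠ 0 :=
  (analyticAt_Gamma_add h).continuousAt.eventually_ne (Complex.Gamma_ne_zero h)

/-- `Complex.Gamma` takes the value `0` at its poles, so the hypothesis excludes exactly these
points. -/
theorem Gamma_div_Gamma_add_one {s : ℂ} (hs : Complex.Gamma s ≠ 0) :
    Complex.Gamma s / Complex.Gamma (s + 1) = 1 / s := by
  have h0 : s ≠ 0 := fun h => hs (by rw [h, Complex.Gamma_zero])
  rw [Complex.Gamma_add_one _ h0]
  field_simp

theorem NotNonposInt.add_nat {s : ℂ} (hs : NotNonposInt s) (k : ℕ) : NotNonposInt (s + k) :=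
  fun n h => hs (n + k) (by push_cast; linear_combination h)

/-- The factor `Γ(s) / Γ(1 + s) = 1 / s` integrates `w ^ (s - 1)`. The two ladders of simple poles
give the two series of `U`, with no additive constant. -/
theorem meijerG_two_one {a b ν w : ℂ} (hb : ∀ k : ℤ, b ≠ k) (hν : NotNonposInt (1 - ν))
    (hν' : NotNonposInt (2 - b - ν)) (hw : w ≠ 0) :
    meijerG [1] [2 + a - b - ν] [1 - ν, 2 - b - ν] [0] w = kummerUExpInt (-ν) a b w := by
  set f := meijerIntegrand [1] [2 + a - b - ν] [1 - ν, 2 - b - ν] [0] w with hf_def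
  have hf : ∀ s₀, NotNonposInt (0 + s₀) → ∀ᶠ s in 𝓝 s₀, f s =
      Complex.Gamma (1 - ν - s) * Complex.Gamma (2 - b - ν - s) *
        (Complex.Gamma (2 + a - b - ν - s))⁻¹ / (0 + s) * w ^ s := fun s₀ h => by
    filter_upwards [eventually_Gamma_ne_zero h] with s hs
    have e := Gamma_div_Gamma_add_one hs
    rw [zero_add] at e
    simp only [hf_def, meijerIntegrand, List.map_cons, List.map_nil, List.prod_cons,
      List.prod_nil, mul_one, sub_self, sub_zero, zero_add, add_comm 1 s]
    rw [mul_comm (Complex.Gamma (s + 1)), mul_div_mul_comm, e]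
    ring
  have n1 : NotNonposInt (0 + (1 - ν)) := by rwa [zero_add]
  have n2 : NotNonposInt (0 + (2 - b - ν)) := by rwa [zero_add]
  have s1 := hasSum_residueAt_simple (f := f) (b := 1 - ν) (b' := 2 - b - ν) (t := 0)
    (H := fun s => (Complex.Gamma (2 + a - b - ν - s))⁻¹) (ε := -1) (h := b - a)
    (fun k h => hb (1 - k) (by push_cast; linear_combination -h)) n1 hw
    (fun k => analyticAt_inv_Gamma_sub _ _)
    (fun k => by
      rw [← sub_sub, inv_Gamma_sub_nat]
      ring_nf)
    fun k => nhdsWithin_le_nhds ((hf _ (by rw [← add_assoc]; exact n1.add_nat k)).mono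
      fun s hs => by rw [hs]; ring)
  have s2 := hasSum_residueAt_simple (f := f) (b := 2 - b - ν) (b' := 1 - ν) (t := 0)
    (H := fun s => (Complex.Gamma (2 + a - b - ν - s))⁻¹) (ε := -1) (h := 1 - a)
    (fun k h => hb (k + 1) (by push_cast; linear_combination h)) n2 hw
    (fun k => analyticAt_inv_Gamma_sub _ _)
    (fun k => by
      rw [← sub_sub, inv_Gamma_sub_nat]
      ring_nf)
    fun k => nhdsWithin_le_nhds ((hf _ (by rw [← add_assoc]; exact n2.add_nat k)).mono
      fun s hs => by rw [hs]; ring)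
  rw [meijerG, tsum_poles (F := residueAt f) (by simp)
    (fun k h => hb (1 - k) (by push_cast; linear_combination -h)) s1 s2, kummerUExpInt_eq,
    kummerUCoeff₁_eq hb, kummerUCoeff₂_eq hb,
    kummerMExpInt_eq (by rwa [neg_add_eq_sub]), kummerMExpInt_eq (by
      rwa [show -ν + 1 - b + 1 = 2 - b - ν by ring])]
  simp only [zero_add, show 2 - b - ν - (1 - ν) = 1 - b by ring,
    show 2 + a - b - ν - (1 - ν) = 1 + a - b by ring, show 1 + (1 - ν) - (2 - b - ν) = b by ring,
    show 1 - ν - (2 - b - ν) = b - 1 by ring, show 2 + a - b - ν - (2 - b - ν) = a by ring,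
    show 1 + (2 - b - ν) - (1 - ν) = 2 - b by ring, neg_add_eq_sub,
    show 1 - ν - b + 1 = 2 - b - ν by ring, show 2 - b - (1 + a - b) = 1 - a by ring]
  ring

/-- Now `Γ(1 - ν + s) / Γ(2 - ν + s) = 1 / (1 - ν + s)`, which is the integration after the factor
`w ^ (1 - ν)` is taken out. -/
theorem meijerG_two_two {a b ν w : ℂ} (hb : ∀ k : ℤ, b ≠ k) (hν : NotNonposInt (1 - ν))
    (hν' : NotNonposInt (2 - b - ν)) (ha : NotNonposInt (1 - a)) (hba : NotNonposInt (b - a))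
    (hw : w ≠ 0) :
    w ^ (1 - ν) / (Complex.Gamma (1 - a) * Complex.Gamma (b - a)) *
      meijerG [ν, 1 + a - b] [] [0, 1 - b] [ν - 1] w = kummerUInt (-ν) (b - a) b w := by
  set f := meijerIntegrand [ν, 1 + a - b] [] [0, 1 - b] [ν - 1] w with hf_def
  have hf : ∀ s₀, NotNonposInt (1 - ν + s₀) → ∀ᶠ s in 𝓝 s₀, f s =
      Complex.Gamma (0 - s) * Complex.Gamma (1 - b - s) *
        Complex.Gamma (b - a + s) / (1 - ν + s) * w ^ s := fun s₀ h => by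
    filter_upwards [eventually_Gamma_ne_zero h] with s hs
    have e := Gamma_div_Gamma_add_one hs
    simp only [hf_def, meijerIntegrand, List.map_cons, List.map_nil, List.prod_cons,
      List.prod_nil, mul_one, show 1 - (ν - 1) + s = 1 - ν + s + 1 by ring,
      show 1 - (1 + a - b) + s = b - a + s by ring]
    rw [mul_div_assoc, mul_comm (Complex.Gamma (1 - ν + s)), mul_div_assoc, e]
    ring
  have n1 : NotNonposInt (1 - ν + 0) := by rwa [add_zero]
  have n2 : NotNonposInt (1 - ν + (1 - b)) := by
    rwa [show 1 - ν + (1 - b) = 2 - b - ν by ring]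
  have m1 : NotNonposInt (b - a + 0) := by rwa [add_zero]
  have m2 : NotNonposInt (b - a + (1 - b)) := by rwa [show b - a + (1 - b) = 1 - a by ring]
  have s1 := hasSum_residueAt_simple (f := f) (b := 0) (b' := 1 - b) (t := 1 - ν)
    (H := fun s => Complex.Gamma (b - a + s)) (ε := 1) (h := b - a)
    (fun k h => hb (1 - k) (by push_cast; linear_combination -h)) n1 hw
    (fun k => analyticAt_Gamma_add (by rw [← add_assoc]; exact m1.add_nat k))
    (fun k => by
      rw [zero_add, add_zero, Gamma_add_nat hba, one_pow, one_mul])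
    fun k => nhdsWithin_le_nhds ((hf _ (by rw [← add_assoc]; exact n1.add_nat k)).mono
      fun s hs => by rw [hs]; ring)
  have s2 := hasSum_residueAt_simple (f := f) (b := 1 - b) (b' := 0) (t := 1 - ν)
    (H := fun s => Complex.Gamma (b - a + s)) (ε := 1) (h := 1 - a)
    (fun k h => hb (k + 1) (by push_cast; linear_combination h)) n2 hw
    (fun k => analyticAt_Gamma_add (by rw [← add_assoc]; exact m2.add_nat k))
    (fun k => by
      rw [← add_assoc, Gamma_add_nat m2, one_pow, one_mul,
        show b - a + (1 - b) = 1 - a by ring])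
    fun k => nhdsWithin_le_nhds ((hf _ (by rw [← add_assoc]; exact n2.add_nat k)).mono
      fun s hs => by rw [hs]; ring)
  rw [meijerG, tsum_poles (F := residueAt f) (by simp)
    (fun k h => hb (1 - k) (by push_cast; linear_combination -h)) s1 s2, kummerUInt_eq,
    kummerUCoeff₁_eq hb, kummerUCoeff₂_eq hb,
    kummerMInt_eq (by rwa [neg_add_eq_sub]), kummerMInt_eq (by
      rwa [show -ν + 1 - b + 1 = 2 - b - ν by ring])]
  have hp : w ^ (2 - b - ν) = w ^ (1 - ν) * w ^ (1 - b) := by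
    rw [← Complex.cpow_add _ _ hw]
    ring_nf
  have g1 := Complex.Gamma_ne_zero ha
  have g2 := Complex.Gamma_ne_zero hba
  simp only [sub_zero, add_zero, Complex.cpow_zero, zero_sub, neg_sub, one_mul,
    show 1 - (1 - b) = b by ring, show b - a + (1 - b) = 1 - a by ring,
    show 1 - ν + (1 - b) = 2 - b - ν by ring, show 1 + (1 - b) = 2 - b by ring,
    show 1 + (b - a) - b = 1 - a by ring, neg_add_eq_sub,
    show 1 - ν - b + 1 = 2 - b - ν by ring, hp]
  field_simp
  ring

/-- The quotient `Γ(-s) / Γ(1 - s)` near the poles of the integrand. -/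
theorem eventually_Gamma_neg_div {b : ℂ} (hb : ∀ k : ℤ, b ≠ k) (k : ℕ) :
    (∀ᶠ s in 𝓝[≠] (k : ℂ), Complex.Gamma (0 - s) / Complex.Gamma (1 - s) = -1 / s) ∧
      ∀ᶠ s in 𝓝 (1 - b + k), Complex.Gamma (0 - s) / Complex.Gamma (1 - s) = -1 / s := by
  have key : ∀ s : ℂ, Complex.Gamma (0 - s) ≠ 0 →
      Complex.Gamma (0 - s) / Complex.Gamma (1 - s) = -1 / s := fun s hs => by
    have := Gamma_div_Gamma_add_one hs
    rwa [show 0 - s + 1 = 1 - s by ring, zero_sub, one_div_neg_eq_neg_one_div, ← neg_div,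
      ← zero_sub s] at this
  constructor
  · obtain ⟨ρ, h1, h2, h3⟩ := exists_Gamma_sub_eq_div 0 k
    rw [zero_add] at h1 h2 h3
    have h4 : ρ k ≠ 0 := by
      rw [h2]
      have : (k ! : ℂ) ≠ 0 := by exact_mod_cast k.factorial_ne_zero
      simp [this]
    -- The pole itself is excluded, since `Γ` is `0` there by convention; near it `ρ s / (s - k)` is
    -- nonzero.
    filter_upwards [h3, nhdsWithin_le_nhds (h1.continuousAt.eventually_ne h4),
      self_mem_nhdsWithin] with s hs hs' hne
    refine key s ?_
    rw [hs]
    exact div_ne_zero hs' (sub_ne_zero.2 hne)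
  · have h : NotNonposInt (0 - (1 - b + k)) := fun n h =>
      hb (1 + k - n) (by push_cast; linear_combination h)
    exact ((analyticAt_Gamma_sub h).continuousAt.eventually_ne (Complex.Gamma_ne_zero h)).mono key

/-- Meijer's functions with a double pole at the origin. -/
theorem meijerG_double {an ap : List ℂ} {b h h' ε : ℂ} {H : ℂ → ℂ} (hb : ∀ k : ℤ, b ≠ k)
    (hI : ∀ w s, meijerIntegrand an ap [0, 0, 1 - b] [] w s = Complex.Gamma (0 - s) *
      (Complex.Gamma (0 - s) / Complex.Gamma (1 - s)) * Complex.Gamma (1 - b - s) * H s * w ^ s)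
    (hH : ∀ k : ℕ, AnalyticAt ℂ H k) (hH' : ∀ k : ℕ, AnalyticAt ℂ H (1 - b + k))
    (hHk : ∀ k : ℕ, H k = H 0 * (ε ^ k * rising h k))
    (hHk' : ∀ k : ℕ, H (1 - b + k) = H (1 - b) * (ε ^ k * rising h' k)) :
    ∃ C : ℂ, ∀ w ≠ 0, -meijerG an ap [0, 0, 1 - b] [] w = C + Complex.Gamma (1 - b) * H 0 *
        (Complex.log w + ε * w * powSum (kummerLogCoeff h b) (ε * w)) +
      Complex.Gamma (b - 1) * H (1 - b) *
        (w ^ (1 - b) / (1 - b) * powSum (kummerIntCoeff (1 - b) h' (2 - b)) (ε * w)) := by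
  -- The constant is the part of the residue at the double pole that does not involve `w`. The sign
  -- in `-H` comes from `Γ(-s) / Γ(1 - s) = -1 / s`.
  refine ⟨-deriv (fun s => Complex.Gamma (1 - s) * Complex.Gamma (1 - b - s) * -H s) 0,
    fun w hw => ?_⟩
  set f := meijerIntegrand an ap [0, 0, 1 - b] [] w with hf_def
  have s1 := hasSum_residueAt_double (f := f) (b := 1 - b) (H := fun s => -H s) (ε := ε) (h := h)
    (fun k h => hb (1 - k) (by push_cast; linear_combination -h)) hw (fun k => (hH k).neg)
    (fun k => by rw [hHk]; ring)
    fun k => (eventually_Gamma_neg_div hb k).1.mono fun s hs => by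
      rw [hf_def, hI, hs]
      ring
  have s2 := hasSum_residueAt_simple (f := f) (b := 1 - b) (b' := 0) (t := 0)
    (H := fun s => -H s) (ε := ε) (h := h')
    (fun k h => hb (k + 1) (by push_cast; linear_combination h))
    (fun n h => hb (1 + n) (by push_cast; linear_combination -h)) hw (fun k => (hH' k).neg)
    (fun k => by rw [hHk']; ring)
    fun k => nhdsWithin_le_nhds ((eventually_Gamma_neg_div hb k).2.mono fun s hs => by
      rw [hf_def, hI, hs]
      ring)
  rw [meijerG, neg_neg, tsum_poles (F := residueAt f) (b := 0) (by simp)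
    (fun k h => hb (1 - k) (by push_cast; linear_combination -h))
      (by simp only [zero_add]; exact s1) s2]
  generalize deriv (fun s => Complex.Gamma (1 - s) * Complex.Gamma (1 - b - s) * -H s) 0 = D
  simp only [zero_add, zero_sub, neg_sub, sub_sub_cancel, sub_zero,
    show 1 + (1 - b) = 2 - b by ring]
  ring

theorem exists_meijerG_three_one {a b : ℂ} (hb : ∀ k : ℤ, b ≠ k) (ha : NotNonposInt a)
    (hab : NotNonposInt (1 + a - b)) :
    ∃ C : ℂ, ∀ w ≠ 0, -(meijerG [1 - a] [1] [0, 0, 1 - b] [] w /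
      (Complex.Gamma a * Complex.Gamma (1 + a - b))) = C + kummerUInt (-1) a b w := by
  have m2 : NotNonposInt (a + (1 - b)) := by rwa [show a + (1 - b) = 1 + a - b by ring]
  obtain ⟨C, hC⟩ := meijerG_double (an := [1 - a]) (ap := [1])
    (H := fun s => Complex.Gamma (a + s)) (ε := 1) (h := a) (h' := 1 + a - b) hb
    (fun w s => by
      simp only [meijerIntegrand, List.map_cons, List.map_nil, List.prod_cons, List.prod_nil,
        mul_one, one_mul, sub_sub_cancel]
      ring) (fun k => analyticAt_Gamma_add (ha.add_nat k))
    (fun k => analyticAt_Gamma_add (by rw [← add_assoc]; exact m2.add_nat k))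
    (fun k => by
      rw [add_zero, Gamma_add_nat ha, one_pow, one_mul])
    (fun k => by
      rw [← add_assoc, Gamma_add_nat m2, one_pow, one_mul,
        show a + (1 - b) = 1 + a - b by ring])
  refine ⟨C / (Complex.Gamma a * Complex.Gamma (1 + a - b)), fun w hw => ?_⟩
  have g1 := Complex.Gamma_ne_zero ha
  have g2 := Complex.Gamma_ne_zero hab
  have n2 : NotNonposInt (-1 + 1 - b + 1) := fun n h =>
    hb (1 + n) (by push_cast; linear_combination -h)
  rw [← neg_div, hC w hw, kummerUInt_eq, kummerMInt_neg_one, kummerMInt_eq n2,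
    kummerUCoeff₁_eq hb, kummerUCoeff₂_eq hb]
  simp only [add_zero, one_mul, show a + (1 - b) = 1 + a - b by ring,
    show -1 + 1 - b + 1 = 1 - b by ring]
  field_simp
  ring

theorem exists_meijerG_three_zero {b : ℂ} (hb : ∀ k : ℤ, b ≠ k) (a : ℂ) :
    ∃ C : ℂ, ∀ w ≠ 0, -meijerG [] [1 - a, 1] [0, 0, 1 - b] [] w =
      C + kummerUExpInt (-1) (b - a) b w := by
  obtain ⟨C, hC⟩ := meijerG_double (an := []) (ap := [1 - a, 1])
    (H := fun s => (Complex.Gamma (1 - a - s))⁻¹) (ε := -1) (h := a) (h' := 1 + a - b) hb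
    (fun w s => by
      simp only [meijerIntegrand, List.map_cons, List.map_nil, List.prod_cons, List.prod_nil,
        mul_one, one_mul]
      ring) (fun k => analyticAt_inv_Gamma_sub _ _)
    (fun k => analyticAt_inv_Gamma_sub _ _)
    (fun k => by
      rw [inv_Gamma_sub_nat, sub_zero, sub_sub_cancel])
    (fun k => by
      rw [← sub_sub, inv_Gamma_sub_nat]
      ring_nf)
  refine ⟨C, fun w hw => ?_⟩
  have n2 : NotNonposInt (-1 + 1 - b + 1) := fun n h =>
    hb (1 + n) (by push_cast; linear_combination -h)
  rw [hC w hw, kummerUExpInt_eq, kummerMExpInt_neg_one, kummerMExpInt_eq n2,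
    kummerUCoeff₁_eq hb, kummerUCoeff₂_eq hb]
  simp only [sub_zero, sub_sub_cancel, show 1 - a - (1 - b) = b - a by ring,
    show 1 + (b - a) - b = 1 - a by ring, show -1 + 1 - b + 1 = 1 - b by ring,
    show 2 - b - (1 - a) = 1 + a - b by ring]
  ring

/-! ### The alternative antiderivatives -/

namespace Segment

variable {M : Segment}

theorem lastMeijer₁_eq (ha : 0 < M.a₂) (hβ : ∀ k : ℤ, M.β₁ ≠ k) (γ : ℝ) {ν : ℝ}
    (hν : NotNonposInt (1 - ν)) (hν' : NotNonposInt (2 - M.β₁ - ν)) {χ : ℝ} (hv : 0 < M.v χ) :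
    M.lastMeijer₁ γ ν χ = M.lastKummer₁ γ ν χ := by
  have hβ' : ∀ k : ℤ, (M.β₁ : ℂ) ≠ k := fun k h => hβ k (by exact_mod_cast h)
  rw [lastMeijer₁, lastKummer₁, meijerG_two_one hβ' hν hν'
    (by exact_mod_cast (zLog_pos ha hv).ne')]

theorem lastMeijer₂_eq (ha : 0 < M.a₂) (hβ : ∀ k : ℤ, M.β₁ ≠ k) (γ : ℝ) {ν : ℝ}
    (hν : NotNonposInt (1 - ν)) (hν' : NotNonposInt (2 - M.β₁ - ν))
    (hα : NotNonposInt (1 - M.α₁)) (hαβ : NotNonposInt (M.β₁ - M.α₁)) {χ : ℝ} (hv : 0 < M.v χ) :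
    M.lastMeijer₂ γ ν χ = M.lastKummer₂ γ ν χ := by
  have hβ' : ∀ k : ℤ, (M.β₁ : ℂ) ≠ k := fun k h => hβ k (by exact_mod_cast h)
  have hz := zLog_pos ha hv
  -- The phases of `(-1) ^ (ν + 1)` and of `(-z) ^ (1 - ν)` add up to a full turn.
  have h1 : Complex.exp (Real.pi * Complex.I * (ν + 1)) *
      Complex.exp ((1 : ℝ) * (Real.pi * Complex.I * (1 - ν))) = 1 := by
    rw [← Complex.exp_add, show Real.pi * Complex.I * ((ν : ℂ) + 1) +
      (1 : ℝ) * (Real.pi * Complex.I * (1 - ν)) = 2 * Real.pi * Complex.I by push_cast; ring,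
      Complex.exp_two_pi_mul_I]
  rw [lastMeijer₂, lastKummer₂, ← meijerG_two_two hβ' hν hν' hα hαβ
    (neg_ne_zero.2 (by exact_mod_cast hz.ne')), neg_cpow_of_isSignOf (σ := 1) (.inl ⟨rfl, hz⟩),
    neg_one_cpow]
  linear_combination (-(M.ξInf γ * ((M.zLog χ : ℂ) ^ (1 - (ν : ℂ)) /
    (Complex.Gamma (1 - M.α₁) * Complex.Gamma (M.β₁ - M.α₁)) *
      meijerG [(ν : ℂ), 1 + M.α₁ - M.β₁] [] [0, 1 - M.β₁] [ν - 1] (-(M.zLog χ : ℂ))))) * h1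

theorem exists_firstMeijer₁_eq (ha : M.a₂ < 0) (hβ : ∀ k : ℤ, M.β₁ ≠ k) (ω : ℝ)
    (hα : NotNonposInt M.α₁) (hαβ : NotNonposInt (1 + M.α₁ - M.β₁)) :
    ∃ C : ℂ, ∀ χ, 0 < M.v χ → M.firstMeijer₁ ω χ = C + M.firstKummer₁ ω χ := by
  obtain ⟨C, hC⟩ := exists_meijerG_three_one (b := M.β₁)
    (fun k h => hβ k (by exact_mod_cast h)) hα hαβ
  refine ⟨M.ξZero ω * C, fun χ hv => ?_⟩
  rw [firstMeijer₁, firstKummer₁, ← mul_add,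
    ← hC _ (by exact_mod_cast (zLog_neg ha hv).ne)]
  ring

theorem exists_firstMeijer₂_eq (ha : M.a₂ < 0) (hβ : ∀ k : ℤ, M.β₁ ≠ k) (ω : ℝ) :
    ∃ C : ℂ, ∀ χ, 0 < M.v χ → M.firstMeijer₂ ω χ = C + M.firstKummer₂ ω χ := by
  obtain ⟨C, hC⟩ := exists_meijerG_three_zero (b := M.β₁)
    (fun k h => hβ k (by exact_mod_cast h)) M.α₁
  refine ⟨M.ξZero ω * C, fun χ hv => ?_⟩
  rw [firstMeijer₂, firstKummer₂, ← mul_add,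
    ← hC _ (neg_ne_zero.2 (by exact_mod_cast (zLog_neg ha hv).ne))]
  ring

theorem hasDerivAt_of_eq_const_add {F G : ℝ → ℂ} {C F' : ℂ} {χ : ℝ}
    (h : ∀ t, 0 < M.v t → G t = C + F t) (hv : 0 < M.v χ) (hF : HasDerivAt F F' χ) :
    HasDerivAt G F' χ :=
  (hF.const_add C).congr_of_eventuallyEq ((eventually_v_pos hv).mono h)

end Segment

/-! ### Assembly of the three kinds of intervals. -/

theorem mainTheorem8 (M : Segment) (hp : 0 < M.p) (hq : 0 < M.q) (hrq : M.q < M.r)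
    (ha : M.a₂ ≠ 0) :
    -- inner intervals: variance linear in strike, quadratic interpolation of the price
    (M.b₂ ≠ 0 → (∀ k : ℤ, M.c ≠ k) → NotNonposInt (2 - M.m) → NotNonposInt (M.c - M.m + 1) →
      -- the integrals in the variable `z`
      (∀ x : ℝ, 0 < x → 0 < M.v x → ∀ γ₀ γ₁ γ₂ : ℝ, ∀ z : ℝ, z = M.zStrike x →
        HasDerivAt (M.I₀ γ₀)
          (γ₀ * (M.Y₁ z / ((1 - z) * z ^ 2 * wronskian M.y₁ M.y₂ x))) z ∧
        HasDerivAt (M.I₁ γ₁)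
          (γ₁ * (z * M.Y₁ z / ((1 - z) * z ^ 2 * wronskian M.y₁ M.y₂ x))) z ∧
        HasDerivAt (M.I₂ γ₂)
          (γ₂ * (z ^ 2 * M.Y₁ z / ((1 - z) * z ^ 2 * wronskian M.y₁ M.y₂ x))) z ∧
        HasDerivAt (M.calI₀ γ₀)
          (γ₀ * (M.Y₂ z / ((1 - z) * z ^ 2 * wronskian M.y₁ M.y₂ x))) z ∧
        HasDerivAt (M.calI₁ γ₁)
          (γ₁ * (z * M.Y₂ z / ((1 - z) * z ^ 2 * wronskian M.y₁ M.y₂ x))) z ∧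
        HasDerivAt (M.calI₂ γ₂)
          (γ₂ * (z ^ 2 * M.Y₂ z / ((1 - z) * z ^ 2 * wronskian M.y₁ M.y₂ x))) z) ∧
      -- the source integrals and the source term for the interpolated price; `θ = 1` in the
      -- money and `θ = 0` out of the money
      (∀ S A B x₁ x₃ P₁ P₃ : ℝ, 0 < S → 0 < x₁ → x₁ < x₃ →
        ∀ θ : ℝ, ∀ x ∈ Set.Icc x₁ x₃, 0 < M.v x → (θ = 1 ∧ B ≤ A * x ∨ θ = 0 ∧ A * x ≤ B) →
        ∀ γ₀ γ₁ γ₂ : ℝ,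
        γ₀ = quadCoeff₀ x₁ x₃ P₁ P₃ + θ * (B * S) →
        γ₁ = θ * (M.b₂ / M.a₂ * A * S) →
        γ₂ = quadCoeff₂ x₁ x₃ P₁ P₃ * (M.b₂ ^ 2 / M.a₂ ^ 2) →
        coveredPut S A B x₁ x₃ P₁ P₃ x
          = γ₀ + γ₁ * M.zStrike x + γ₂ * M.zStrike x ^ 2 ∧
        HasDerivAt (M.strikeSource₁ γ₀ γ₁ γ₂)
          (M.y₁ x * coveredPut S A B x₁ x₃ P₁ P₃ x /
            (M.v x * x ^ 2 * wronskian M.y₁ M.y₂ x)) x ∧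
        HasDerivAt (M.strikeSource₂ γ₀ γ₁ γ₂)
          (M.y₂ x * coveredPut S A B x₁ x₃ P₁ P₃ x /
            (M.v x * x ^ 2 * wronskian M.y₁ M.y₂ x)) x ∧
        SolvesAt (-(M.v x * x ^ 2)) (M.b₁ * x) M.b₀ (coveredPut S A B x₁ x₃ P₁ P₃ x)
          (fun t => -M.y₂ t * M.strikeSource₁ γ₀ γ₁ γ₂ t + M.y₁ t * M.strikeSource₂ γ₀ γ₁ γ₂ t)
          x)) ∧
    -- last interval: variance linear in log-strike, power interpolation
    (0 < M.a₂ → (∀ k : ℤ, M.β₁ ≠ k) → ∀ γ ν : ℝ, 0 < ν →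
      NotNonposInt (1 - ν) → NotNonposInt (2 - M.β₁ - ν) →
      ∀ χ : ℝ, 0 < M.v χ → ∀ z : ℝ, z = M.zLog χ →
        M.logIntegrand₁ (M.powerSource γ ν) χ
          = M.ξInf γ * (Complex.exp (-z) * (z : ℂ) ^ (-(ν : ℂ)) * kummerU M.α₁ M.β₁ z) ∧
        M.logIntegrand₂ (M.powerSource γ ν) χ
          = M.ξInf γ * ((z : ℂ) ^ (-(ν : ℂ)) * kummerU (M.β₁ - M.α₁) M.β₁ (-(z : ℂ))) ∧
        HasDerivAt (M.lastKummer₁ γ ν) (M.logIntegrand₁ (M.powerSource γ ν) χ) χ ∧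
        HasDerivAt (M.lastKummer₂ γ ν) (M.logIntegrand₂ (M.powerSource γ ν) χ) χ ∧
        M.LogSourceSolvesAt (M.powerSource γ ν) (M.lastKummer₁ γ ν) (M.lastKummer₂ γ ν) χ ∧
        HasDerivAt (M.lastMeijer₁ γ ν) (M.logIntegrand₁ (M.powerSource γ ν) χ) χ ∧
        (NotNonposInt (1 - M.α₁) → NotNonposInt (M.β₁ - M.α₁) →
          HasDerivAt (M.lastMeijer₂ γ ν) (M.logIntegrand₂ (M.powerSource γ ν) χ) χ ∧
          M.LogSourceSolvesAt (M.powerSource γ ν) (M.lastMeijer₁ γ ν) (M.lastMeijer₂ γ ν) χ)) ∧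
    -- first interval: variance linear in log-strike, exponential interpolation
    (M.a₂ < 0 → (∀ k : ℤ, M.β₁ ≠ k) → ∀ ω : ℝ,
      ∀ χ : ℝ, 0 < M.v χ → ∀ z : ℝ, z = M.zLog χ →
        M.logIntegrand₁ (M.expSource ω) χ
          = M.ξZero ω * ((z : ℂ)⁻¹ * kummerU M.α₁ M.β₁ z) ∧
        M.logIntegrand₂ (M.expSource ω) χ
          = M.ξZero ω * (Complex.exp z * (z : ℂ)⁻¹ *
              kummerU (M.β₁ - M.α₁) M.β₁ (-(z : ℂ))) ∧
        HasDerivAt (M.firstKummer₁ ω) (M.logIntegrand₁ (M.expSource ω) χ) χ ∧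
        HasDerivAt (M.firstKummer₂ ω) (M.logIntegrand₂ (M.expSource ω) χ) χ ∧
        M.LogSourceSolvesAt (M.expSource ω) (M.firstKummer₁ ω) (M.firstKummer₂ ω) χ ∧
        HasDerivAt (M.firstMeijer₂ ω) (M.logIntegrand₂ (M.expSource ω) χ) χ ∧
        (NotNonposInt M.α₁ → NotNonposInt (1 + M.α₁ - M.β₁) →
          HasDerivAt (M.firstMeijer₁ ω) (M.logIntegrand₁ (M.expSource ω) χ) χ ∧
          M.LogSourceSolvesAt (M.expSource ω) (M.firstMeijer₁ ω) (M.firstMeijer₂ ω) χ)) := by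
  refine ⟨fun hb hc hm hcm => ⟨fun x hx hv γ₀ γ₁ γ₂ z hz =>
    M.strike_integrals hp hq hrq ha hb hc hm hcm hx hv γ₀ γ₁ γ₂ hz, ?_⟩, ?_, ?_⟩
  · intro S A B x₁ x₃ P₁ P₃ hS hx₁ _ θ x hx hv hθ γ₀ γ₁ γ₂ h₀ h₁ h₂
    have hx0 : 0 < x := hx₁.trans_le hx.1
    have hcp : coveredPut S A B x₁ x₃ P₁ P₃ x =
        γ₀ + γ₁ * M.zStrike x + γ₂ * M.zStrike x ^ 2 := by
      rw [coveredPut_eq ha hb hS hθ, h₀, h₁, h₂]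
    obtain ⟨d₁, d₂⟩ := Segment.strike_source hp hq hrq ha hb hc hm hcm hx0 hv γ₀ γ₁ γ₂
    rw [← hcp, Complex.ofReal_mul, Complex.ofReal_pow] at d₁ d₂
    refine ⟨hcp, d₁, d₂, ?_⟩
    rw [hcp]
    exact Segment.strike_source_solvesAt hp hq hrq ha hb hc hm hcm hx0 hv γ₀ γ₁ γ₂
  · intro ha hβ γ ν _ hν hν' χ hv z hz
    obtain ⟨i₁, i₂⟩ := Segment.last_integrand ha hβ γ ν hv
    have hc := fun t (ht : 0 < M.v t) => Segment.continuousAt_powerSource ha γ ν ht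
    have k := fun t (ht : 0 < M.v t) => Segment.hasDerivAt_lastKummer ha hβ γ hν hν' ht
    -- On the last interval the two antiderivatives are equal, so the constant is `0`; on the first
    -- interval it is the contribution of the double pole.
    have g₁ := fun t (ht : 0 < M.v t) => Segment.hasDerivAt_of_eq_const_add (C := 0)
      (G := M.lastMeijer₁ γ ν)
      (fun t ht => by rw [Segment.lastMeijer₁_eq ha hβ γ hν hν' ht, zero_add]) ht (k t ht).1
    subst hz
    refine ⟨i₁, i₂, (k χ hv).1, (k χ hv).2, Segment.logSourceSolvesAt ha.ne' hβ hv hc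
      (fun t ht => (k t ht).1) (fun t ht => (k t ht).2), g₁ χ hv, fun hα hαβ => ?_⟩
    have g₂ := fun t (ht : 0 < M.v t) => Segment.hasDerivAt_of_eq_const_add (C := 0)
      (G := M.lastMeijer₂ γ ν)
      (fun t ht => by rw [Segment.lastMeijer₂_eq ha hβ γ hν hν' hα hαβ ht, zero_add]) ht (k t ht).2
    exact ⟨g₂ χ hv, Segment.logSourceSolvesAt ha.ne' hβ hv hc g₁ g₂⟩
  · intro ha hβ ω χ hv z hz
    obtain ⟨i₁, i₂⟩ := Segment.first_integrand ha hβ ω hv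
    have hc := fun t (ht : 0 < M.v t) => Segment.continuousAt_expSource ha ω ht
    have k := fun t (ht : 0 < M.v t) => Segment.hasDerivAt_firstKummer ha hβ ω ht
    obtain ⟨C₂, hC₂⟩ := Segment.exists_firstMeijer₂_eq ha hβ ω
    have g₂ := fun t (ht : 0 < M.v t) => Segment.hasDerivAt_of_eq_const_add hC₂ ht (k t ht).2
    subst hz
    refine ⟨i₁, i₂, (k χ hv).1, (k χ hv).2, Segment.logSourceSolvesAt ha.ne hβ hv hc
      (fun t ht => (k t ht).1) (fun t ht => (k t ht).2), g₂ χ hv, fun hα hαβ => ?_⟩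
    obtain ⟨C₁, hC₁⟩ := Segment.exists_firstMeijer₁_eq ha hβ ω hα hαβ
    have g₁ := fun t (ht : 0 < M.v t) => Segment.hasDerivAt_of_eq_const_add hC₁ ht (k t ht).1
    exact ⟨g₁ χ hv, Segment.logSourceSolvesAt ha.ne hβ hv hc g₁ g₂⟩
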